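/- Let $p\in(1,\infty)$. A curve is an immersed $\gamma\in W^{2,p}(0,1;\mathbf R^2)$, i.e. (for the $C^1$ representative) $\gamma'(t)\neq0$ for all $t\in[0,1]$; let $k$ be its signed curvature, $s$ its arclength, $L$ its length, $\tilde\gamma:[0,L]\to\mathbf R^2$ its arclength parameterization. Such a $\gamma$ is a $p$-elastica if there is $\lambda\in\mathbf R$ such that $\frac{d}{d\varepsilon}\big(\int_{\gamma+\varepsilon\eta}|k|^p\,ds+\lambda\,\mathrm{length}(\gamma+\varepsilon\eta)\big)\big|_{\varepsilon=0}=0$ for all $\eta\in C^\infty_c((0,1);\mathbf R^2)$. It is closed if $\tilde\gamma(0)=\tilde\gamma(L)$ and $\tilde\gamma'(0)=\tilde\gamma'(L)$. "Represented by" means: equal up to a similarity of $\mathbf R^2$ (translation, rotation, reflection, dilation) and reparameterization. Put $$\mathrm F_{1,p}(x,q)=\int_0^x\frac{|\cos\theta|^{1-2/p}}{\sqrt{1-q^2\sin^2\theta}}\,d\theta,\quad \mathrm E_{1,p}(x,q)=\int_0^x\sqrt{1-q^2\sin^2\theta}\,|\cos\theta|^{1-2/p}\,d\theta,$$ $$\mathrm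 F_{2,p}(x,q)=\int_0^x\frac{d\theta}{\sqrt[p]{1-q^2\sin^2\theta}},\quad \mathrm E_{2,p}(x,q)=\int_0^x\sqrt[p]{1-q^2\sin^2\theta}\,d\theta,$$ $\mathrm K_{1,p}(q)=\mathrm F_{1,p}(\pi/2,q)$, $\mathrm E_{1,p}(q)=\mathrm E_{1,p}(\pi/2,q)$, and $\mathrm K_p(1)=\int_0^{\pi/2}(\cos\theta)^{-2/p}\,d\theta\in(0,\infty]$ (finite iff $p>2$). Let $\mathrm{am}_{i,p}(\cdot,q)$ be the inverse of $\mathrm F_{i,p}(\cdot,q)$ (of its restriction to $(-\frac\pi2,\frac\pi2)$ if $q=1$ and $p\le2$), $\mathrm{cn}_p=|\cos\mathrm{am}_{1,p}|^{2/p-1}\cos\mathrm{am}_{1,p}$, $\mathrm{dn}_p=\sqrt[p]{1-q^2\sin^2\mathrm{am}_{2,p}}$, $\mathrm{sech}_p=\mathrm{cn}_p(\cdot,1)$ on $(-\mathrm K_p(1),\mathrm K_p(1))$ and $0$ elsewhere, $\tanh_p x=\int_0^x(\mathrm{sech}_p t)^p\,dt$. Define $$\gamma_\ell(s)=(s,0),\qquad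 \gamma_c(s)=(\cos s,\sin s),$$ $$\gamma_w(s,q)=\Big(2\mathrm E_{1,p}(\mathrm{am}_{1,p}(s,q),q)-s,\ -q\tfrac p{p-1}|\mathrm{cn}_p(s,q)|^{p-2}\mathrm{cn}_p(s,q)\Big),$$ $$\gamma_b^{\pm}(s)=\Big(2\tanh_p s-s,\ \mp\tfrac p{p-1}(\mathrm{sech}_p s)^{p-1}\Big),$$ $$\gamma_o(s,q)=\tfrac1{q^2}\Big(2\mathrm E_{2,\frac p{p-1}}(\mathrm{am}_{2,p}(s,q),q)+(q^2-2)s,\ -\tfrac p{p-1}\mathrm{dn}_p(s,q)^{p-1}\Big).$$ A curve is linear, borderline (only for $p\le2$) or orbitlike if it is represented by $[0,\ell]\ni s\mapsto\gamma_*(s+s_0)$ for some $\ell>0$, $s_0\in\mathbf R$, with $\gamma_*=\gamma_\ell$, $\gamma_*=\gamma_b^+$, or $\gamma_*=\gamma_o(\cdot,q)$ for some $q\in(0,1)$, respectively. For $p>2$ it is flat-core if it is represented by the restriction to a nondegenerate subinterval of a finite concatenation (each piece translated so as to start where the previous one ends) of $N\ge1$ pairs, the $j$-th pair being a segment $[0,L_j]\ni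 s\mapsto(-s,0)$ with $L_j\ge0$ followed by a loop $\gamma_b^{\sigma_j}|_{[-\mathrm K_p(1),\mathrm K_p(1)]}$ with $\sigma_j\in\{+,-\}$. Then there is a unique $q^*=q^*(p)\in(0,1)$ with $2\mathrm E_{1,p}(q^*)/\mathrm K_{1,p}(q^*)=1$, and the following hold. (a) A curve $\gamma$ is a closed $p$-elastica if and only if, for some integer $N\ge1$, it is an $N$-fold circle, i.e. represented by $[0,2N\pi]\ni s\mapsto\gamma_c(s+s_0)$ for some $s_0\in\mathbf R$, or an $N$-fold figure-eight $p$-elastica, i.e. represented by $[0,4N\mathrm K_{1,p}(q^*)]\ni s\mapsto\gamma_w(s+s_0,q^*)$ for some $s_0\in\mathbf R$. (b) In particular, linear, borderline, orbitlike and flat-core curves are never closed. -/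

import Mathlib

open scoped ContDiff

noncomputable section

namespace PElastica

/-- The Euclidean plane. -/
abbrev Plane : Type := EuclideanSpace ℝ (Fin 2)

/-! ### Planar curves of class `W^{2,p}` on the unit interval

A curve is a function `γ : ℝ → Plane` of which only the values on `[0,1]` matter. -/

/-- `η` is a test function: smooth with compact support in the open interval `(0,1)`. -/
def IsTestFunction {F : Type*} [NormedAddCommGroup F] [NormedSpace ℝ F] (η : ℝ → F) : Prop :=
  ContDiff ℝ ∞ η ∧ HasCompactSupport η ∧ tsupport η ⊆ Set.Ioo (0 : ℝ) 1

/-- `g` is the weak derivative of `f` on `(0,1)`. -/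
def HasWeakDeriv (f g : ℝ → Plane) : Prop :=
  ∀ φ : ℝ → ℝ, IsTestFunction φ →
    ∫ t in Set.Ioo (0 : ℝ) 1, deriv φ t • f t = -∫ t in Set.Ioo (0 : ℝ) 1, φ t • g t

/-- `f ∈ L^p(0,1; ℝ²)`. -/
def MemLpUnit (p : ℝ) (f : ℝ → Plane) : Prop :=
  MeasureTheory.MemLp f (ENNReal.ofReal p) (MeasureTheory.volume.restrict (Set.Ioo (0 : ℝ) 1))

/-- `γ ∈ W^{2,p}(0,1; ℝ²)`: `γ` and its first two weak derivatives are in `L^p`.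
As usual `γ` is its continuous representative on `[0,1]` (which is then of class `C¹`). -/
def MemW2p (p : ℝ) (γ : ℝ → Plane) : Prop :=
  ContinuousOn γ (Set.Icc (0 : ℝ) 1) ∧ MemLpUnit p γ ∧
    ∃ v w : ℝ → Plane, MemLpUnit p v ∧ MemLpUnit p w ∧ HasWeakDeriv γ v ∧ HasWeakDeriv v w

/-- `γ` is an immersed curve of class `W^{2,p}` on `[0,1]`. -/
def IsImmersedW2p (p : ℝ) (γ : ℝ → Plane) : Prop :=
  MemW2p p γ ∧
    ∀ t ∈ Set.Icc (0 : ℝ) 1, derivWithin γ (Set.Icc (0 : ℝ) 1) t ≠ 0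

/-! ### Length, signed curvature, `p`-bending energy -/

/-- The arclength of `γ` from parameter `0` to parameter `t`. -/
def arclength (γ : ℝ → Plane) (t : ℝ) : ℝ := ∫ u in (0 : ℝ)..t, ‖deriv γ u‖

/-- The length of `γ`. -/
def curveLength (γ : ℝ → Plane) : ℝ := arclength γ 1

/-- The (counterclockwise) signed curvature `det(γ', γ'') / |γ'|³`. -/
def signedCurvature (γ : ℝ → Plane) (t : ℝ) : ℝ :=
  (deriv γ t 0 * deriv (deriv γ) t 1 - deriv γ t 1 * deriv (deriv γ) t 0) / ‖deriv γ t‖ ^ 3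

/-- The `p`-bending energy `∫_γ |k|^p ds`, with `ds = |γ'(t)| dt`. -/
def bendingEnergy (p : ℝ) (γ : ℝ → Plane) : ℝ :=
  ∫ t in (0 : ℝ)..1, |signedCurvature γ t| ^ p * ‖deriv γ t‖

/-- `γ` is a `p`-elastica: an immersed `W^{2,p}` curve that is a critical point of
`bendingEnergy p + lam * curveLength` for some real `lam`. -/
def IsPElastica (p : ℝ) (γ : ℝ → Plane) : Prop :=
  IsImmersedW2p p γ ∧ ∃ lam : ℝ, ∀ η : ℝ → Plane, IsTestFunction η →
    HasDerivAt (fun ε : ℝ => bendingEnergy p (γ + ε • η) + lam * curveLength (γ + ε • η)) 0 0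

/-- The arclength parameterization `[0, curveLength γ] → ℝ²` of `γ`. -/
def arclengthParam (γ : ℝ → Plane) (s : ℝ) : Plane :=
  γ (Function.invFunOn (arclength γ) (Set.Icc (0 : ℝ) 1) s)

/-- `γ` is closed: for its arclength parameterization, the endpoints agree and the tangent vectors
at the endpoints agree. -/
def IsClosedCurve (γ : ℝ → Plane) : Prop :=
  arclengthParam γ 0 = arclengthParam γ (curveLength γ) ∧
    derivWithin (arclengthParam γ) (Set.Icc 0 (curveLength γ)) 0 =
      derivWithin (arclengthParam γ) (Set.Icc 0 (curveLength γ)) (curveLength γ)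

/-- Up to similarity (translation, rotation, reflection, dilation) and reparameterization, `γ` is
represented by `c` on the interval `[0, ℓ]`. -/
def IsRepresentedBy (γ : ℝ → Plane) (c : ℝ → Plane) (ℓ : ℝ) : Prop :=
  ∃ (r : ℝ) (A : Plane ≃ₗᵢ[ℝ] Plane) (v : Plane) (φ : ℝ → ℝ),
    0 < r ∧
    ContDiffOn ℝ 1 φ (Set.Icc (0 : ℝ) 1) ∧
    (∀ t ∈ Set.Icc (0 : ℝ) 1, 0 < derivWithin φ (Set.Icc (0 : ℝ) 1) t) ∧
    φ 0 = 0 ∧ φ 1 = ℓ ∧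
    ∀ t ∈ Set.Icc (0 : ℝ) 1, γ t = r • A (c (φ t)) + v

/-! ### `p`-elliptic integrals

For `q = 1` the integrands below equal `|cos θ|^(-2/p)` except at the zeros of `cos`. -/

/-- Incomplete `p`-elliptic integral of the first kind `F_{1,p}(x,q)`. -/
def F1 (p x q : ℝ) : ℝ :=
  ∫ θ in (0 : ℝ)..x, |Real.cos θ| ^ (1 - 2 / p) / Real.sqrt (1 - q ^ 2 * Real.sin θ ^ 2)

/-- Incomplete `p`-elliptic integral of the first kind `F_{2,p}(x,q)`. -/
def F2 (p x q : ℝ) : ℝ :=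
  ∫ θ in (0 : ℝ)..x, 1 / (1 - q ^ 2 * Real.sin θ ^ 2) ^ (1 / p)

/-- Complete `p`-elliptic integral of the first kind `K_{1,p}(q)`; for `p > 2` the value at `q = 1`
is the finite number `K_p(1)`. -/
def K1 (p q : ℝ) : ℝ := F1 p (Real.pi / 2) q

/-- Incomplete `p`-elliptic integral of the second kind `E_{1,p}(x,q)`. -/
def E1 (p x q : ℝ) : ℝ :=
  ∫ θ in (0 : ℝ)..x, Real.sqrt (1 - q ^ 2 * Real.sin θ ^ 2) * |Real.cos θ| ^ (1 - 2 / p)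

/-- Incomplete `p`-elliptic integral of the second kind `E_{2,p}(x,q)`. -/
def E2 (p x q : ℝ) : ℝ :=
  ∫ θ in (0 : ℝ)..x, (1 - q ^ 2 * Real.sin θ ^ 2) ^ (1 / p)

/-- Complete `p`-elliptic integral of the second kind `E_{1,p}(q)`. -/
def E1c (p q : ℝ) : ℝ := E1 p (Real.pi / 2) q

/-! ### `p`-elliptic and `p`-hyperbolic functions -/

open Classical in
/-- The domain on which the integrals of the first kind are inverted: the whole line, except that
it is `(-π/2, π/2)` if `q = 1` and `p ≤ 2`. -/
def amRange (p q : ℝ) : Set ℝ :=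
  if q = 1 ∧ p ≤ 2 then Set.Ioo (-(Real.pi / 2)) (Real.pi / 2) else Set.univ

/-- The amplitude `am_{1,p}(x,q)`, inverse of `F_{1,p}(·,q)`. -/
def am1 (p x q : ℝ) : ℝ := Function.invFunOn (fun y => F1 p y q) (amRange p q) x

/-- The amplitude `am_{2,p}(x,q)`, inverse of `F_{2,p}(·,q)`. -/
def am2 (p x q : ℝ) : ℝ := Function.invFunOn (fun y => F2 p y q) (amRange p q) x

/-- The `p`-elliptic cosine. -/
def cnp (p x q : ℝ) : ℝ := |Real.cos (am1 p x q)| ^ (2 / p - 1) * Real.cos (am1 p x q)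

/-- The `p`-delta amplitude. -/
def dnp (p x q : ℝ) : ℝ := (1 - q ^ 2 * Real.sin (am2 p x q) ^ 2) ^ (1 / p)

open Classical in
/-- The `p`-hyperbolic secant: `cn_p(·,1)` on `(-K_p(1), K_p(1))` and `0` elsewhere, where this
interval is the whole line if `p ≤ 2`. -/
def sechp (p x : ℝ) : ℝ := if p ≤ 2 ∨ |x| < K1 p 1 then cnp p x 1 else 0

/-- The `p`-hyperbolic tangent. -/
def tanhp (p x : ℝ) : ℝ := ∫ t in (0 : ℝ)..x, sechp p t ^ p

/-! ### The model curves -/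

/-- The linear curve. -/
def gammaLinear (s : ℝ) : Plane := !₂[s, 0]

/-- The circular curve. -/
def gammaCirc (s : ℝ) : Plane := !₂[Real.cos s, Real.sin s]

/-- The wavelike curve of modulus `q`. -/
def gammaWave (p q s : ℝ) : Plane :=
  !₂[2 * E1 p (am1 p s q) q - s,
    -(q * (p / (p - 1)) * (|cnp p s q| ^ (p - 2) * cnp p s q))]

/-- The borderline curve with sign `σ`; the sign `σ = 1` gives the borderline curve itself. -/
def gammaBorder (p σ s : ℝ) : Plane :=
  !₂[2 * tanhp p s - s, -(σ * (p / (p - 1)) * sechp p s ^ (p - 1))]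

/-- The orbitlike curve of modulus `q`. -/
def gammaOrbit (p q s : ℝ) : Plane :=
  (1 / q ^ 2) • !₂[2 * E2 (p / (p - 1)) (am2 p s q) q + (q ^ 2 - 2) * s,
    -(p / (p - 1) * dnp p s q ^ (p - 1))]

/-- A parameterized arc on the interval `[a, b]`. -/
structure Arc where
  a : ℝ
  b : ℝ
  toFun : ℝ → Plane

/-- The concatenation of two arcs, parameterized on `[0, L₁ + L₂]`. -/
def Arc.concat (c d : Arc) : Arc where
  a := 0
  b := (c.b - c.a) + (d.b - d.a)
  toFun s :=
    if s ≤ c.b - c.a then c.toFun (s + c.a)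
    else d.toFun (s + d.a - (c.b - c.a)) + c.toFun c.b - d.toFun d.a

/-- The concatenation of the `n + 1` arcs `c 0, …, c n`. -/
def Arc.concatUpTo (c : ℕ → Arc) : ℕ → Arc
  | 0 => c 0
  | n + 1 => (Arc.concatUpTo c n).concat (c (n + 1))

/-- The leftward segment of length `ℓ`. -/
def segmentArc (ℓ : ℝ) : Arc where
  a := 0
  b := ℓ
  toFun s := !₂[-s, 0]

/-- The borderline loop with sign `σ`, on `[-K_p(1), K_p(1)]` (used for `p > 2`). -/
def loopArc (p σ : ℝ) : Arc where
  a := -K1 p 1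
  b := K1 p 1
  toFun := gammaBorder p σ

/-- The flat-core curve made of `n + 1` pairs of a segment of length `ℓ j` and a loop of
sign `σ j`. -/
def flatCoreArc (p : ℝ) (n : ℕ) (σ ℓ : ℕ → ℝ) : Arc :=
  Arc.concatUpTo (fun j => (segmentArc (ℓ j)).concat (loopArc p (σ j))) n

/-! ### Classes of curves -/

/-- `γ` is an `N`-fold circle. -/
def IsNFoldCircle (N : ℕ) (γ : ℝ → Plane) : Prop :=
  ∃ s₀ : ℝ, IsRepresentedBy γ (fun s => gammaCirc (s + s₀)) (2 * N * Real.pi)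

/-- `q` is a root in `(0,1)` of `2 E_{1,p}(q) / K_{1,p}(q) = 1`. -/
def IsFigureEightModulus (p q : ℝ) : Prop :=
  q ∈ Set.Ioo (0 : ℝ) 1 ∧ 2 * (E1c p q / K1 p q) - 1 = 0

/-- `γ` is an `N`-fold closed figure-eight `p`-elastica, where `q` is the modulus of the
figure-eight. -/
def IsNFoldFigureEight (p q : ℝ) (N : ℕ) (γ : ℝ → Plane) : Prop :=
  ∃ s₀ : ℝ, IsRepresentedBy γ (fun s => gammaWave p q (s + s₀)) (4 * N * K1 p q)

/-- `γ` is a linear curve. -/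
def IsLinear (γ : ℝ → Plane) : Prop :=
  ∃ s₀ ℓ : ℝ, IsRepresentedBy γ (fun s => gammaLinear (s + s₀)) ℓ

/-- `γ` is a borderline curve (a class that exists for `p ≤ 2` only). -/
def IsBorderline (p : ℝ) (γ : ℝ → Plane) : Prop :=
  p ≤ 2 ∧ ∃ s₀ ℓ : ℝ, IsRepresentedBy γ (fun s => gammaBorder p 1 (s + s₀)) ℓ

/-- `γ` is an orbitlike curve. -/
def IsOrbitlike (p : ℝ) (γ : ℝ → Plane) : Prop :=
  ∃ q ∈ Set.Ioo (0 : ℝ) 1, ∃ s₀ ℓ : ℝ,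
    IsRepresentedBy γ (fun s => gammaOrbit p q (s + s₀)) ℓ

/-- `γ` is a flat-core curve (a class that exists for `p > 2` only): a part of some concatenation
of segments and loops. -/
def IsFlatCore (p : ℝ) (γ : ℝ → Plane) : Prop :=
  2 < p ∧ ∃ (n : ℕ) (σ l : ℕ → ℝ), (∀ j, σ j = 1 ∨ σ j = -1) ∧ (∀ j, 0 ≤ l j) ∧
    ∃ s₀ ℓ : ℝ, 0 ≤ s₀ ∧ s₀ + ℓ ≤ (flatCoreArc p n σ l).b ∧
      IsRepresentedBy γ (fun s => (flatCoreArc p n σ l).toFun (s + s₀)) ℓ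

end PElastica

end

noncomputable section

namespace PElastica

open MeasureTheory Set Filter Topology

/-! ### Test functions and the du Bois-Reymond lemma on `(0,1)` -/

/-! The symmetries of the plane integrate the Euler-Lagrange equation of a `p`-elastica. Translation
invariance, in the form of a second-order du Bois-Reymond lemma, makes the coefficients of the
second derivatives of the test functions absolutely continuous and produces two constants. Rotation
invariance then gives `|k|^(p-2) k = C + c₀ x + c₁ y`: the signed power of the curvature is an
affine function of position. This is equivalent to criticality
(`isPElastica_iff_hasAffineCurvature`). It also supplies the needed regularity, since `k` becomes
continuous and Frenet's equations hold at every interior point, and it reduces the claim that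
circles and figure-eights are elasticae to reading off their curvature.

If `c₀ = c₁ = 0` the curvature is constant, and a closed curve of constant curvature is a circle.
Otherwise an adapted rotation turns the affine function into `C - c Y` with `c > 0`, and there is a
first integral `(p-1)|k|^p = lam + p c a`, where `a` is the horizontal component of the unit tangent
`(a, b)`. As for a pendulum, `lam` decides the type (`AdaptedSolution.abs_lt_of_closesUp`).

If `lam ≤ -p c`, the tangent is constant. If `lam > p c`, the curvature keeps a sign `δ`, and `X - δ
b / m`, with `m` the value of `|k|` corresponding to a vertical tangent, is monotone and cannot be
constant. If `lam = p c`, the abscissa `X - V`, where the correction `V` depends only on height and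
tangent, decreases at rate `1/(p-1)` in arclength away from the zeros of `k`. For `p ≤ 2` a zero of
`k` forces a line, by Gronwall; for `p > 2` the curve may be flat on pieces, but there `X` decreases
at rate `1 > 1/(p-1)`, so `X - V + s/(p-1)` still never increases. In all these cases a quantity
determined by position and tangent differs at the two ends.

There remains `|lam| < p c`. Then the zeros of the curvature are finite in number, the amplitude can
be reconstructed, and the curve is wavelike of some modulus `q`
(`AdaptedSolution.exists_waveTangent`). Equal heights and tangents at the ends force a whole number
of periods, and each period moves the curve horizontally by `4(2E - K)`, so closing up means `2E =
K`. Since `E` is nonincreasing and `K` strictly increasing in `q`, and since `2E > K` at `q = 0`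
while `2E < K` for some larger modulus, this equation has exactly one root.

Part (b) applies the same monotone quantities to the explicit model curves. A complete
classification of elasticae, in particular a description of all flat-core solutions of the equation,
is not needed. -/

/-- Lebesgue measure on the open unit interval. -/
abbrev unitMeasure : Measure ℝ := volume.restrict (Ioo (0 : ℝ) 1)

section TestFunctions

variable {F : Type*} [NormedAddCommGroup F] [NormedSpace ℝ F]

theorem IsTestFunction.deriv {η : ℝ → F} (h : IsTestFunction η) : IsTestFunction (deriv η) := by
  refine ⟨?_, h.2.1.deriv, (tsupport_deriv_subset (𝕜 := ℝ)).trans h.2.2⟩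
  exact (contDiff_infty_iff_deriv.1 h.1).2

theorem IsTestFunction.differentiable {η : ℝ → F} (h : IsTestFunction η) :
    Differentiable ℝ η := h.1.differentiable (by simp)

theorem IsTestFunction.hasDerivAt {η : ℝ → F} (h : IsTestFunction η) (t : ℝ) :
    HasDerivAt η (_root_.deriv η t) t := (h.differentiable t).hasDerivAt

theorem IsTestFunction.continuous {η : ℝ → F} (h : IsTestFunction η) : Continuous η :=
  h.1.continuous

theorem IsTestFunction.eq_zero_of_notMem {η : ℝ → F} (h : IsTestFunction η) {t : ℝ}
    (ht : t ∉ Ioo (0 : ℝ) 1) : η t = 0 :=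
  image_eq_zero_of_notMem_tsupport fun h' => ht (h.2.2 h')

theorem IsTestFunction.exists_bound {η : ℝ → F} (h : IsTestFunction η) :
    ∃ C, ∀ t, ‖η t‖ ≤ C :=
  h.2.1.exists_bound_of_continuous h.continuous

theorem IsTestFunction.sub {η ζ : ℝ → F} (h : IsTestFunction η) (h' : IsTestFunction ζ) :
    IsTestFunction (fun t => η t - ζ t) := by
  refine ⟨h.1.sub h'.1, h.2.1.sub h'.2.1, ?_⟩
  exact (tsupport_sub η ζ).trans (union_subset h.2.2 h'.2.2)

theorem IsTestFunction.const_smul {η : ℝ → F} (h : IsTestFunction η) (c : ℝ) :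
    IsTestFunction (fun t => c • η t) := by
  refine ⟨contDiff_const.smul h.1, ?_, ?_⟩
  · exact h.2.1.smul_left (f := fun _ => c)
  · exact (tsupport_smul_subset_right (fun _ => c) η).trans h.2.2

theorem IsTestFunction.comp_clm {G : Type*} [NormedAddCommGroup G] [NormedSpace ℝ G]
    {η : ℝ → F} (h : IsTestFunction η) (A : F →L[ℝ] G) :
    IsTestFunction (fun t => A (η t)) := by
  refine ⟨A.contDiff.comp h.1, h.2.1.comp_left (g := A) (map_zero A), ?_⟩
  exact (tsupport_comp_subset (map_zero A) η).trans h.2.2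

end TestFunctions

theorem IsTestFunction.integrable_mul {φ : ℝ → ℝ} (h : IsTestFunction φ) {f : ℝ → ℝ}
    (hf : Integrable f unitMeasure) : Integrable (fun t => φ t * f t) unitMeasure := by
  obtain ⟨C, hC⟩ := h.exists_bound
  exact hf.bdd_mul h.continuous.aestronglyMeasurable (Eventually.of_forall hC)

/-- Leaves room between the support and the ends of `(0,1)`, so that a primitive can be shown to be
supported in the same compact interval. -/
theorem exists_Icc_of_tsupport {φ : ℝ → ℝ} (h : IsTestFunction φ) :
    ∃ a b : ℝ, 0 < a ∧ a < b ∧ b < 1 ∧ tsupport φ ⊆ Icc a b := by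
  rcases (tsupport φ).eq_empty_or_nonempty with he | hne
  · exact ⟨1 / 4, 1 / 2, by norm_num, by norm_num, by norm_num, by simp [he]⟩
  · obtain ⟨a, ha⟩ := h.2.1.exists_isLeast hne
    obtain ⟨b, hb⟩ := h.2.1.exists_isGreatest hne
    have ha1 := h.2.2 ha.1
    have hb1 := h.2.2 hb.1
    refine ⟨a / 2, (b + 1) / 2, by linarith [ha1.1], by linarith [ha1.1, ha1.2, hb.2 ha.1],
      by linarith [hb1.2], fun t ht => ⟨?_, ?_⟩⟩
    · linarith [ha.2 ht, ha1.1]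
    · linarith [hb.2 ht, hb1.2]

/-- A test function with vanishing mean is the derivative of a test function. -/
theorem IsTestFunction.exists_primitive {ψ : ℝ → ℝ} (h : IsTestFunction ψ)
    (h0 : ∫ t in Ioo (0 : ℝ) 1, ψ t = 0) :
    ∃ φ : ℝ → ℝ, IsTestFunction φ ∧ _root_.deriv φ = ψ := by
  obtain ⟨a, b, ha, hab, hb, hs⟩ := exists_Icc_of_tsupport h
  have hz : ∀ t, t ∉ Icc a b → ψ t = 0 := fun t ht =>
    image_eq_zero_of_notMem_tsupport fun h' => ht (hs h')
  set φ : ℝ → ℝ := fun t => ∫ s in (0 : ℝ)..t, ψ s with hφ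
  have hd : ∀ t, HasDerivAt φ (ψ t) t := fun t =>
    intervalIntegral.integral_hasDerivAt_right (h.continuous.intervalIntegrable _ _)
      (h.continuous.stronglyMeasurableAtFilter _ _) h.continuous.continuousAt
  have hderiv : _root_.deriv φ = ψ := funext fun t => (hd t).deriv
  have hleft : ∀ t, t < a → φ t = 0 := by
    intro t ht
    rw [hφ]
    simp only
    rw [intervalIntegral.integral_zero_ae]
    refine Eventually.of_forall fun s hs' => hz s fun hs'' => ?_
    have := hs'.2
    have h3 := hs''.1
    rcases max_choice 0 t with h4 | h4 <;> rw [h4] at this <;> linarith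
  -- The vanishing mean is what makes the primitive vanish again to the right of the support.
  have h01 : ∫ s in (0 : ℝ)..1, ψ s = 0 := by
    rw [intervalIntegral.integral_of_le zero_le_one, integral_Ioc_eq_integral_Ioo, h0]
  have hright : ∀ t, b < t → φ t = 0 := by
    intro t ht
    have h1 : φ t = (∫ s in (0 : ℝ)..1, ψ s) + ∫ s in (1 : ℝ)..t, ψ s :=
      (intervalIntegral.integral_add_adjacent_intervals (h.continuous.intervalIntegrable _ _)
        (h.continuous.intervalIntegrable _ _)).symm
    rw [h1, h01, zero_add, intervalIntegral.integral_zero_ae]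
    refine Eventually.of_forall fun s hs' => hz s fun hs'' => ?_
    have := hs'.1
    have h3 := hs''.2
    rcases min_choice 1 t with h4 | h4 <;> rw [h4] at this <;> linarith
  have hsupp : tsupport φ ⊆ Icc a b := by
    refine closure_minimal (fun t ht => ?_) isClosed_Icc
    by_contra hc
    rw [mem_Icc, not_and_or, not_le, not_le] at hc
    rcases hc with hc | hc
    · exact ht (hleft t hc)
    · exact ht (hright t hc)
  refine ⟨φ, ⟨?_, ?_, hsupp.trans fun t ht => ⟨by linarith [ht.1], by linarith [ht.2]⟩⟩, hderiv⟩
  · rw [contDiff_infty_iff_deriv, hderiv]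
    exact ⟨fun t => (hd t).differentiableAt, h.1⟩
  · exact HasCompactSupport.of_support_subset_isCompact isCompact_Icc
      (subset_closure.trans hsupp)

/-- Subtracting the right multiple of this bump gives any test function vanishing mean, hence makes
it the derivative of a test function. Both du Bois-Reymond lemmas rest on this correction. -/
theorem exists_isTestFunction_integral_one :
    ∃ ρ : ℝ → ℝ, IsTestFunction ρ ∧ ∫ t in Ioo (0 : ℝ) 1, ρ t = 1 := by
  let f : ContDiffBump (1 / 2 : ℝ) := ⟨1 / 8, 1 / 4, by norm_num, by norm_num⟩
  have hs : tsupport (f.normed volume) ⊆ Ioo (0 : ℝ) 1 := by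
    rw [f.tsupport_normed_eq]
    intro t ht
    rw [Metric.mem_closedBall, Real.dist_eq, abs_le] at ht
    have h1 := ht.1
    have h2 := ht.2
    simp only [f] at h1 h2
    constructor <;> linarith
  refine ⟨f.normed volume, ⟨f.contDiff_normed, f.hasCompactSupport_normed, hs⟩, ?_⟩
  rw [setIntegral_eq_integral_of_forall_compl_eq_zero, f.integral_normed]
  intro t ht
  exact image_eq_zero_of_notMem_tsupport fun h' => ht (hs h')

theorem ae_eq_zero_of_integral_test {f : ℝ → ℝ} (hf : Integrable f unitMeasure)
    (h : ∀ φ : ℝ → ℝ, IsTestFunction φ → ∫ t in Ioo (0 : ℝ) 1, φ t * f t = 0) :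
    ∀ᵐ t ∂unitMeasure, f t = 0 := by
  rw [ae_restrict_iff' measurableSet_Ioo]
  refine isOpen_Ioo.ae_eq_zero_of_integral_contDiff_smul_eq_zero
    (IntegrableOn.locallyIntegrableOn hf) fun g h1 h2 h3 => ?_
  rw [← h g ⟨h1, h2, h3⟩, setIntegral_eq_integral_of_forall_compl_eq_zero]
  · rfl
  · intro t ht
    rw [image_eq_zero_of_notMem_tsupport fun h' => ht (h3 h'), zero_mul]

/-- The first-order du Bois-Reymond lemma. -/
theorem ae_eq_const_of_integral_deriv {f : ℝ → ℝ} (hf : Integrable f unitMeasure)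
    (h : ∀ φ : ℝ → ℝ, IsTestFunction φ → ∫ t in Ioo (0 : ℝ) 1, deriv φ t * f t = 0) :
    ∃ c : ℝ, ∀ᵐ t ∂unitMeasure, f t = c := by
  obtain ⟨ρ, hρ, hρ1⟩ := exists_isTestFunction_integral_one
  -- The only possible value: if `f` is constant, its integral against a function of mean one is
  -- that constant.
  set c := ∫ t in Ioo (0 : ℝ) 1, ρ t * f t with hc
  refine ⟨c, ?_⟩
  have hone : Integrable (fun _ : ℝ => (1 : ℝ)) unitMeasure := integrable_const _
  have key := ae_eq_zero_of_integral_test (f := fun t => f t - c) (hf.sub (integrable_const _)) ?_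
  · filter_upwards [key] with t ht
    linarith
  intro g hg
  have hgi : Integrable g unitMeasure := by simpa using hg.integrable_mul hone
  have hρi : Integrable ρ unitMeasure := by simpa using hρ.integrable_mul hone
  set m := ∫ t in Ioo (0 : ℝ) 1, g t with hm
  have hψ : IsTestFunction (fun t => g t - m • ρ t) := hg.sub (hρ.const_smul m)
  obtain ⟨φ, hφ, hφd⟩ := hψ.exists_primitive (by
    rw [integral_sub hgi (show Integrable (fun t => m • ρ t) unitMeasure from hρi.smul m),
      integral_smul, hρ1]; simp [hm])
  have h1 := h φ hφ
  rw [hφd] at h1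
  have h2 : ∫ t in Ioo (0 : ℝ) 1, (g t - m • ρ t) * f t
      = (∫ t in Ioo (0 : ℝ) 1, g t * f t) - m * c := by
    rw [hc, ← integral_const_mul, ← integral_sub (hg.integrable_mul hf)
      ((hρ.integrable_mul hf).const_mul m)]
    congr 1; ext t; simp only [smul_eq_mul]; ring
  have h3 : ∫ t in Ioo (0 : ℝ) 1, g t * (f t - c)
      = (∫ t in Ioo (0 : ℝ) 1, g t * f t) - m * c := by
    rw [hm, ← integral_mul_const, ← integral_sub (hg.integrable_mul hf) (hgi.mul_const c)]
    congr 1; ext t; ring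
  rw [h3, ← h2, h1]

/-- If `f` has weak derivative `g` on `(0,1)`, then `f` is a primitive of `g` almost everywhere. -/
theorem ae_eq_primitive_of_weak_deriv {f g : ℝ → ℝ} (hf : Integrable f unitMeasure)
    (hg : Integrable g unitMeasure)
    (h : ∀ φ : ℝ → ℝ, IsTestFunction φ →
      ∫ t in Ioo (0 : ℝ) 1, deriv φ t * f t = -∫ t in Ioo (0 : ℝ) 1, φ t * g t) :
    ∃ c : ℝ, ∀ᵐ t ∂unitMeasure, f t = c + ∫ s in (0 : ℝ)..t, g s := by
  set G : ℝ → ℝ := fun t => ∫ s in (0 : ℝ)..t, g s with hG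
  have hgi : IntervalIntegrable g volume 0 1 := by
    rw [intervalIntegrable_iff_integrableOn_Ioo_of_le zero_le_one]; exact hg
  have hGac : AbsolutelyContinuousOnInterval G 0 1 :=
    hgi.absolutelyContinuousOnInterval_intervalIntegral (by simp)
  have hGi : Integrable G unitMeasure := by
    have h1 : IntervalIntegrable G volume 0 1 := hGac.continuousOn.intervalIntegrable
    rw [intervalIntegrable_iff_integrableOn_Ioo_of_le zero_le_one] at h1; exact h1
  have hGd : ∀ᵐ t ∂unitMeasure, HasDerivAt G (g t) t := by
    rw [ae_restrict_iff' measurableSet_Ioo]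
    filter_upwards [hgi.ae_hasDerivAt_integral] with t ht ht'
    exact ht (by rw [uIcc_of_le zero_le_one]; exact Ioo_subset_Icc_self ht') 0 (by simp)
  -- Integration by parts shows that `f - G` has zero weak derivative, because `G` has `g` as
  -- derivative almost everywhere.
  obtain ⟨c, hc⟩ := ae_eq_const_of_integral_deriv (f := fun t => f t - G t) (hf.sub hGi) (by
    intro φ hφ
    have hφac : AbsolutelyContinuousOnInterval φ 0 1 :=
      (hφ.1.of_le (by exact_mod_cast le_top)).contDiffOn.absolutelyContinuousOnInterval
    have h1 := hGac.integral_mul_deriv_eq_deriv_mul hφac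
    rw [hφ.eq_zero_of_notMem (by simp), hφ.eq_zero_of_notMem (by simp)] at h1
    simp only [mul_zero, sub_zero, zero_sub] at h1
    rw [intervalIntegral.integral_of_le zero_le_one, intervalIntegral.integral_of_le zero_le_one,
      integral_Ioc_eq_integral_Ioo, integral_Ioc_eq_integral_Ioo] at h1
    have h2 : ∫ t in Ioo (0 : ℝ) 1, deriv G t * φ t = ∫ t in Ioo (0 : ℝ) 1, φ t * g t := by
      refine integral_congr_ae ?_
      filter_upwards [hGd] with t ht
      rw [ht.deriv, mul_comm]
    have h3 : ∫ t in Ioo (0 : ℝ) 1, deriv φ t * (f t - G t)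
        = (∫ t in Ioo (0 : ℝ) 1, deriv φ t * f t) - ∫ t in Ioo (0 : ℝ) 1, G t * deriv φ t := by
      rw [← integral_sub (hφ.deriv.integrable_mul hf)
        (by simpa only [mul_comm] using hφ.deriv.integrable_mul hGi)]
      congr 1; ext t; ring
    rw [h3, h φ hφ, h1, h2, sub_self])
  refine ⟨c, ?_⟩
  filter_upwards [hc] with t ht
  simp only [hG] at ht ⊢
  linarith

/-- The second-order du Bois-Reymond lemma: if `∫ A φ'' + B φ' = 0` for all test functions, then
`A` agrees a.e. with a primitive of `B + c` for a constant `c`. -/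
theorem ae_eq_primitive_of_integral_deriv_deriv {A B : ℝ → ℝ} (hA : Integrable A unitMeasure)
    (hB : Integrable B unitMeasure)
    (h : ∀ φ : ℝ → ℝ, IsTestFunction φ →
      ∫ t in Ioo (0 : ℝ) 1, (deriv (deriv φ) t * A t + deriv φ t * B t) = 0) :
    ∃ c d : ℝ, ∀ᵐ t ∂unitMeasure, A t = d + ∫ s in (0 : ℝ)..t, (B s + c) := by
  obtain ⟨ρ, hρ, hρ1⟩ := exists_isTestFunction_integral_one
  have hone : Integrable (fun _ : ℝ => (1 : ℝ)) unitMeasure := integrable_const _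
  have hρi : Integrable ρ unitMeasure := by simpa using hρ.integrable_mul hone
  -- Testing with a primitive of `g - m ρ`, where `m` is the mean of `g`, gives `∫ g' A + g B = m
  -- κ`; in other words, `A` has the weak derivative `B - κ`.
  set κ := ∫ t in Ioo (0 : ℝ) 1, (deriv ρ t * A t + ρ t * B t) with hκ
  obtain ⟨d, hd⟩ := ae_eq_primitive_of_weak_deriv (f := A) (g := fun t => B t + (-κ)) hA
    (hB.add (integrable_const _)) (by
      intro g hg
      have hgi : Integrable g unitMeasure := by simpa using hg.integrable_mul hone
      set m := ∫ t in Ioo (0 : ℝ) 1, g t with hm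
      have hψ : IsTestFunction (fun t => g t - m • ρ t) := hg.sub (hρ.const_smul m)
      obtain ⟨φ, hφ, hφd⟩ := hψ.exists_primitive (by
        rw [integral_sub hgi (show Integrable (fun t => m • ρ t) unitMeasure from hρi.smul m),
      integral_smul, hρ1]; simp [hm])
      have h1 := h φ hφ
      have hdd : deriv (fun t => g t - m • ρ t) = fun t => deriv g t - m * deriv ρ t := by
        ext t
        exact ((hg.hasDerivAt t).sub ((hρ.hasDerivAt t).const_smul m)).deriv
      rw [hφd, hdd] at h1
      have h2 : ∫ t in Ioo (0 : ℝ) 1, ((deriv g t - m * deriv ρ t) * A t + (g t - m • ρ t) * B t)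
          = ((∫ t in Ioo (0 : ℝ) 1, deriv g t * A t) + ∫ t in Ioo (0 : ℝ) 1, g t * B t) - m * κ := by
        have h4 : Integrable (fun t => deriv g t * A t + g t * B t) unitMeasure :=
          (hg.deriv.integrable_mul hA).add (hg.integrable_mul hB)
        have h5 : Integrable (fun t => m * (deriv ρ t * A t + ρ t * B t)) unitMeasure :=
          ((hρ.deriv.integrable_mul hA).add (hρ.integrable_mul hB)).const_mul m
        rw [hκ, ← integral_const_mul, ← integral_add (hg.deriv.integrable_mul hA)
          (hg.integrable_mul hB), ← integral_sub h4 h5]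
        congr 1; ext t; simp only [smul_eq_mul]; ring
      have h3 : ∫ t in Ioo (0 : ℝ) 1, g t * (B t + (-κ))
          = (∫ t in Ioo (0 : ℝ) 1, g t * B t) - m * κ := by
        rw [hm, ← integral_mul_const, ← integral_sub (hg.integrable_mul hB) (hgi.mul_const κ)]
        congr 1; ext t; ring
      rw [h3]
      linarith)
  exact ⟨-κ, d, hd⟩

/-! ### Absolutely continuous functions -/

theorem absolutelyContinuousOnInterval_congr {f g : ℝ → ℝ} {a b : ℝ}
    (hf : AbsolutelyContinuousOnInterval f a b) (h : EqOn f g (uIcc a b)) :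
    AbsolutelyContinuousOnInterval g a b := by
  rw [absolutelyContinuousOnInterval_iff] at hf ⊢
  intro ε hε
  obtain ⟨δ, hδ, H⟩ := hf ε hε
  refine ⟨δ, hδ, fun E hE hE' => ?_⟩
  convert H E hE hE' using 1
  refine Finset.sum_congr rfl fun i hi => ?_
  rw [h (hE.1 i (by simpa using hi)).1, h (hE.1 i (by simpa using hi)).2]

theorem absolutelyContinuousOnInterval_lipschitz_comp {f g : ℝ → ℝ} {a b : ℝ} {s : Set ℝ}
    {K : NNReal} (hf : AbsolutelyContinuousOnInterval f a b) (hg : LipschitzOnWith K g s)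
    (hs : MapsTo f (uIcc a b) s) : AbsolutelyContinuousOnInterval (fun t => g (f t)) a b := by
  rw [absolutelyContinuousOnInterval_iff] at hf ⊢
  intro ε hε
  obtain ⟨δ, hδ, H⟩ := hf (ε / (K + 1)) (by positivity)
  refine ⟨δ, hδ, fun E hE hE' => ?_⟩
  calc ∑ i ∈ Finset.range E.1, dist (g (f (E.2 i).1)) (g (f (E.2 i).2))
      ≤ ∑ i ∈ Finset.range E.1, K * dist (f (E.2 i).1) (f (E.2 i).2) := by
        refine Finset.sum_le_sum fun i hi => ?_
        exact hg.dist_le_mul _ (hs (hE.1 i (by simpa using hi)).1) _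
          (hs (hE.1 i (by simpa using hi)).2)
    _ = K * ∑ i ∈ Finset.range E.1, dist (f (E.2 i).1) (f (E.2 i).2) := by
        rw [Finset.mul_sum]
    _ ≤ K * (ε / (K + 1)) := by gcongr; exact (H E hE hE').le
    _ < (K + 1) * (ε / (K + 1)) := by gcongr; linarith
    _ = ε := by field_simp

/-- By compactness `f` takes values between a positive minimum and a maximum, and `z ↦ 1/√z` is
Lipschitz on that range. -/
theorem absolutelyContinuousOnInterval_inv_sqrt {f : ℝ → ℝ} {a b : ℝ}
    (hf : AbsolutelyContinuousOnInterval f a b) (hpos : ∀ t ∈ uIcc a b, 0 < f t) :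
    AbsolutelyContinuousOnInterval (fun t => (Real.sqrt (f t))⁻¹) a b := by
  obtain ⟨t₀, ht₀, hmin⟩ := isCompact_uIcc.exists_isMinOn nonempty_uIcc hf.continuousOn
  obtain ⟨t₁, ht₁, hmax⟩ := isCompact_uIcc.exists_isMaxOn nonempty_uIcc hf.continuousOn
  have hc : ContDiffOn ℝ 1 (fun z => (Real.sqrt z)⁻¹) (Icc (f t₀) (f t₁)) := by
    intro z hz
    have hz0 : 0 < z := (hpos t₀ ht₀).trans_le hz.1
    exact ((Real.contDiffAt_sqrt hz0.ne').inv (Real.sqrt_ne_zero'.2 hz0)).contDiffWithinAt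
  obtain ⟨K, hK⟩ := hc.exists_lipschitzOnWith (by decide) (convex_Icc _ _) isCompact_Icc
  exact absolutelyContinuousOnInterval_lipschitz_comp (g := fun z => (Real.sqrt z)⁻¹) hf hK fun t ht => ⟨hmin ht, hmax ht⟩

theorem ae_unit_hasDerivAt_deriv {f : ℝ → ℝ} (hf : AbsolutelyContinuousOnInterval f 0 1) :
    ∀ᵐ t ∂unitMeasure, HasDerivAt f (deriv f t) t := by
  rw [ae_restrict_iff' measurableSet_Ioo]
  filter_upwards [hf.ae_differentiableAt] with t ht ht'
  exact (ht (by rw [uIcc_of_le zero_le_one]; exact Ioo_subset_Icc_self ht')).hasDerivAt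

/-! ### Regular representatives of `W^{2,p}` curves -/

theorem ae_unit_eqOn_Icc {f g : ℝ → ℝ} (h : ∀ᵐ t ∂unitMeasure, f t = g t)
    (hf : ContinuousOn f (Icc 0 1)) (hg : ContinuousOn g (Icc 0 1)) : EqOn f g (Icc 0 1) := by
  refine Measure.eqOn_Icc_of_ae_eq (μ := volume) zero_ne_one ?_ hf hg
  have h' : f =ᵐ[volume.restrict (Ioo 0 1)] g := h
  rwa [Measure.restrict_congr_set Ioo_ae_eq_Icc] at h'

theorem memLp_unit_integrable {p : ℝ} (hp : 1 < p) {f : ℝ → ℝ}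
    (hf : MemLp f (ENNReal.ofReal p) unitMeasure) : Integrable f unitMeasure := by
  refine hf.integrable ?_
  rw [← ENNReal.ofReal_one]
  exact ENNReal.ofReal_le_ofReal hp.le

/-- A continuous function of class `W^{2,p}(0,1)` extends to a function of class `C^1` on the line
with absolutely continuous derivative on `[0,1]`, whose derivative is constant on either side. -/
theorem exists_contDiff_extension {p : ℝ} (hp : 1 < p) {f v w : ℝ → ℝ}
    (hf : ContinuousOn f (Icc 0 1)) (hv : MemLp v (ENNReal.ofReal p) unitMeasure)
    (hw : MemLp w (ENNReal.ofReal p) unitMeasure)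
    (hfv : ∀ φ : ℝ → ℝ, IsTestFunction φ →
      ∫ t in Ioo (0 : ℝ) 1, deriv φ t * f t = -∫ t in Ioo (0 : ℝ) 1, φ t * v t)
    (hvw : ∀ φ : ℝ → ℝ, IsTestFunction φ →
      ∫ t in Ioo (0 : ℝ) 1, deriv φ t * v t = -∫ t in Ioo (0 : ℝ) 1, φ t * w t) :
    ∃ x : ℝ → ℝ, (∀ t ∈ Icc (0 : ℝ) 1, f t = x t) ∧ ContDiff ℝ 1 x ∧
      AbsolutelyContinuousOnInterval (deriv x) 0 1 ∧
      MemLp (deriv (deriv x)) (ENNReal.ofReal p) unitMeasure ∧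
      ∀ t, deriv x t = deriv x (max 0 (min 1 t)) := by
  have hvi := memLp_unit_integrable hp hv
  have hwi := memLp_unit_integrable hp hw
  have hfi : Integrable f unitMeasure := by
    have h1 : IntegrableOn f (Icc 0 1) := hf.integrableOn_Icc
    exact h1.mono_set Ioo_subset_Icc_self
  obtain ⟨d, hd⟩ := ae_eq_primitive_of_weak_deriv hvi hwi hvw
  obtain ⟨c, hc⟩ := ae_eq_primitive_of_weak_deriv hfi hvi hfv
  have hwint : IntervalIntegrable w volume 0 1 := by
    rw [intervalIntegrable_iff_integrableOn_Ioo_of_le zero_le_one]; exact hwi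
  set V : ℝ → ℝ := fun t => d + ∫ s in (0 : ℝ)..t, w s with hV
  have hVac : AbsolutelyContinuousOnInterval V 0 1 :=
    (contDiff_const (c := d)).contDiffOn.absolutelyContinuousOnInterval.add
      (hwint.absolutelyContinuousOnInterval_intervalIntegral (by simp))
  have hproj : ∀ t : ℝ, max 0 (min 1 t) ∈ Icc (0 : ℝ) 1 := fun t =>
    ⟨le_max_left _ _, max_le zero_le_one (min_le_left _ _)⟩
  have hprojid : ∀ t ∈ Icc (0 : ℝ) 1, max 0 (min 1 t) = t := fun t ht => by
    rw [min_eq_right ht.2, max_eq_right ht.1]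
  -- Clamping the parameter extends the derivative continuously to the line; the extended function
  -- is affine on either side of `[0,1]`.
  set U : ℝ → ℝ := fun t => V (max 0 (min 1 t)) with hU
  have hVc : ContinuousOn V (Icc 0 1) := by
    have := hVac.continuousOn; rwa [uIcc_of_le zero_le_one] at this
  have hUc : Continuous U := by
    have h1 : Continuous fun t : ℝ => max 0 (min 1 t) := by fun_prop
    exact hVc.comp_continuous h1 hproj
  have hUV : EqOn V U (uIcc 0 1) := fun t ht => by
    rw [uIcc_of_le zero_le_one] at ht; simp only [hU, hprojid t ht]
  set x : ℝ → ℝ := fun t => c + ∫ s in (0 : ℝ)..t, U s with hx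
  have hxd : ∀ t, HasDerivAt x (U t) t := fun t =>
    (intervalIntegral.integral_hasDerivAt_right (hUc.intervalIntegrable _ _)
      (hUc.stronglyMeasurableAtFilter _ _) hUc.continuousAt).const_add c
  have hxderiv : deriv x = U := funext fun t => (hxd t).deriv
  have hxc : ContDiff ℝ 1 x := by
    rw [contDiff_one_iff_deriv, hxderiv]
    exact ⟨fun t => (hxd t).differentiableAt, hUc⟩
  have hUac : AbsolutelyContinuousOnInterval U 0 1 := absolutelyContinuousOnInterval_congr hVac hUV
  refine ⟨x, ?_, hxc, hxderiv ▸ hUac, ?_, ?_⟩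
  · refine ae_unit_eqOn_Icc ?_ hf hxc.continuous.continuousOn
    have hvU : ∀ᵐ t ∂unitMeasure, v t = U t := by
      filter_upwards [hd, ae_restrict_mem measurableSet_Ioo] with t ht ht'
      rw [ht]
      simp only [hU, hprojid t (Ioo_subset_Icc_self ht'), hV]
    filter_upwards [hc, ae_restrict_mem measurableSet_Ioo] with t ht ht'
    rw [ht]
    simp only [hx]
    congr 1
    refine intervalIntegral.integral_congr_ae ?_
    rw [ae_restrict_iff' measurableSet_Ioo] at hvU
    filter_upwards [hvU] with s hs hs'
    rw [uIoc_of_le ht'.1.le] at hs'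
    exact hs ⟨hs'.1, hs'.2.trans_lt ht'.2⟩
  · rw [hxderiv]
    refine hw.ae_eq ?_
    rw [EventuallyEq, ae_restrict_iff' measurableSet_Ioo]
    filter_upwards [hwint.ae_hasDerivAt_integral] with t ht ht'
    have h1 : HasDerivAt V (w t) t :=
      (ht (by rw [uIcc_of_le zero_le_one]; exact Ioo_subset_Icc_self ht') 0 (by simp)).const_add d
    have h2 : HasDerivAt U (w t) t := by
      refine h1.congr_of_eventuallyEq ?_
      filter_upwards [isOpen_Ioo.mem_nhds ht'] with s hs
      simp only [hU, hprojid s (Ioo_subset_Icc_self hs)]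
    exact h2.deriv.symm
  · intro t
    rw [hxderiv]
    simp only [hU, hprojid _ (hproj t)]

/-- `x` and `y` are the coordinates of a curve of class `C^1` on the line which is immersed, of class
`W^{2,p}` on `[0,1]`, and agrees there with `γ`. -/
structure IsRegularRepr (p : ℝ) (γ : ℝ → Plane) (x y : ℝ → ℝ) : Prop where
  eq_fst : ∀ t ∈ Icc (0 : ℝ) 1, γ t 0 = x t
  eq_snd : ∀ t ∈ Icc (0 : ℝ) 1, γ t 1 = y t
  contDiff_fst : ContDiff ℝ 1 x
  contDiff_snd : ContDiff ℝ 1 y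
  ac_fst : AbsolutelyContinuousOnInterval (deriv x) 0 1
  ac_snd : AbsolutelyContinuousOnInterval (deriv y) 0 1
  memLp_fst : MemLp (deriv (deriv x)) (ENNReal.ofReal p) unitMeasure
  memLp_snd : MemLp (deriv (deriv y)) (ENNReal.ofReal p) unitMeasure
  immersed : ∀ t, 0 < deriv x t ^ 2 + deriv y t ^ 2

theorem hasDerivWithinAt_plane_iff {c : ℝ → Plane} {c' : Plane} {s : Set ℝ} {t : ℝ} :
    HasDerivWithinAt c c' s t ↔ HasDerivWithinAt (fun r => c r 0) (c' 0) s t ∧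
      HasDerivWithinAt (fun r => c r 1) (c' 1) s t := by
  have key : ∀ i : Fin 2, HasDerivWithinAt (fun r => c r i) (c' i) s t ↔
      HasFDerivWithinAt (fun r => c r i)
        (EuclideanSpace.proj i ∘L ContinuousLinearMap.toSpanSingleton ℝ c') s t := by
    intro i
    rw [hasDerivWithinAt_iff_hasFDerivWithinAt]
    have : ContinuousLinearMap.toSpanSingleton ℝ (c' i)
        = EuclideanSpace.proj i ∘L ContinuousLinearMap.toSpanSingleton ℝ c' := by
      ext; simp
    rw [this]
  rw [hasDerivWithinAt_iff_hasFDerivWithinAt, hasFDerivWithinAt_euclidean, Fin.forall_fin_two,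
    key, key]

theorem hasDerivWithinAt_plane {c : ℝ → Plane} {x y : ℝ → ℝ} {x' y' : ℝ} {s : Set ℝ} {t : ℝ}
    (hx : HasDerivWithinAt x x' s t) (hy : HasDerivWithinAt y y' s t)
    (h0 : ∀ r ∈ s, c r 0 = x r) (h1 : ∀ r ∈ s, c r 1 = y r) (ht : t ∈ s) :
    HasDerivWithinAt c !₂[x', y'] s t := by
  have key : HasDerivWithinAt (fun r => (!₂[x r, y r] : Plane)) !₂[x', y'] s t := by
    rw [hasDerivWithinAt_plane_iff]
    exact ⟨by simpa using hx, by simpa using hy⟩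
  refine key.congr_of_mem (fun r hr => ?_) ht
  ext i
  fin_cases i
  · simpa using h0 r hr
  · simpa using h1 r hr

theorem hasWeakDeriv_coord {f g : ℝ → Plane} (hf : Integrable f unitMeasure)
    (hg : Integrable g unitMeasure) (h : HasWeakDeriv f g) (i : Fin 2) :
    ∀ φ : ℝ → ℝ, IsTestFunction φ →
      ∫ t in Ioo (0 : ℝ) 1, deriv φ t * f t i = -∫ t in Ioo (0 : ℝ) 1, φ t * g t i := by
  intro φ hφ
  have key : ∀ (φ : ℝ → ℝ) (_ : IsTestFunction φ) (f : ℝ → Plane) (_ : Integrable f unitMeasure),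
      (∫ t in Ioo (0 : ℝ) 1, φ t • f t) i = ∫ t in Ioo (0 : ℝ) 1, φ t * f t i := by
    intro φ hφ f hf
    have hint : Integrable (fun t => φ t • f t) unitMeasure := by
      obtain ⟨C, hC⟩ := hφ.exists_bound
      exact hf.bdd_smul C hφ.continuous.aestronglyMeasurable (Eventually.of_forall hC)
    have := (EuclideanSpace.proj (𝕜 := ℝ) i).integral_comp_comm hint
    simpa using this.symm
  have h1 := congrArg (fun z : Plane => z i) (h φ hφ)
  simp only [PiLp.neg_apply] at h1
  rw [key _ hφ.deriv f hf, key _ hφ g hg] at h1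
  exact h1

theorem memLp_coord {q : ENNReal} {f : ℝ → Plane} (hf : MemLp f q unitMeasure) (i : Fin 2) :
    MemLp (fun t => f t i) q unitMeasure :=
  (EuclideanSpace.proj (𝕜 := ℝ) i).comp_memLp' hf

/-- Each coordinate is extended separately. Since the derivatives outside `[0,1]` repeat their end
point values, immersedness on `[0,1]` becomes immersedness on the whole line, and later arguments
need no one-sided derivatives of the coordinates. -/
theorem IsImmersedW2p.exists_repr {p : ℝ} (hp : 1 < p) {γ : ℝ → Plane} (h : IsImmersedW2p p γ) :
    ∃ x y : ℝ → ℝ, IsRegularRepr p γ x y := by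
  obtain ⟨⟨hc, hγ, v, w, hv, hw, hγv, hvw⟩, himm⟩ := h
  have hp1 : (1 : ENNReal) ≤ ENNReal.ofReal p := by
    rw [← ENNReal.ofReal_one]; exact ENNReal.ofReal_le_ofReal hp.le
  have hγi : Integrable γ unitMeasure := MemLp.integrable hp1 hγ
  have hvi : Integrable v unitMeasure := MemLp.integrable hp1 hv
  have hwi : Integrable w unitMeasure := MemLp.integrable hp1 hw
  have hcoord : ∀ i : Fin 2, ContinuousOn (fun t => γ t i) (Icc 0 1) := fun i =>
    (EuclideanSpace.proj (𝕜 := ℝ) i).continuous.comp_continuousOn hc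
  obtain ⟨x, hx, hxc, hxac, hxl, hxe⟩ := exists_contDiff_extension hp (hcoord 0) (memLp_coord hv 0)
    (memLp_coord hw 0) (hasWeakDeriv_coord hγi hvi hγv 0) (hasWeakDeriv_coord hvi hwi hvw 0)
  obtain ⟨y, hy, hyc, hyac, hyl, hye⟩ := exists_contDiff_extension hp (hcoord 1) (memLp_coord hv 1)
    (memLp_coord hw 1) (hasWeakDeriv_coord hγi hvi hγv 1) (hasWeakDeriv_coord hvi hwi hvw 1)
  refine ⟨x, y, hx, hy, hxc, hyc, hxac, hyac, hxl, hyl, ?_⟩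
  have key : ∀ t ∈ Icc (0 : ℝ) 1, 0 < deriv x t ^ 2 + deriv y t ^ 2 := by
    intro t ht
    have h1 := hasDerivWithinAt_plane (c := γ)
      ((hxc.differentiable one_ne_zero t).hasDerivAt.hasDerivWithinAt)
      ((hyc.differentiable one_ne_zero t).hasDerivAt.hasDerivWithinAt) hx hy ht
    have h2 := himm t ht
    rw [h1.derivWithin (uniqueDiffOn_Icc zero_lt_one t ht)] at h2
    by_contra hcon
    have h3 : deriv x t = 0 := by nlinarith [sq_nonneg (deriv x t), sq_nonneg (deriv y t)]
    have h4 : deriv y t = 0 := by nlinarith [sq_nonneg (deriv x t), sq_nonneg (deriv y t)]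
    apply h2
    rw [h3, h4]
    ext i
    fin_cases i <;> simp
  intro t
  rw [hxe t, hye t]
  exact key _ ⟨le_max_left _ _, max_le zero_le_one (min_le_left _ _)⟩

/-! ### The first variation -/

/-- The speed of the planar curve with coordinates `x` and `y`. -/
def speed (x y : ℝ → ℝ) (t : ℝ) : ℝ := Real.sqrt (deriv x t ^ 2 + deriv y t ^ 2)

/-- The signed curvature of the planar curve with coordinates `x` and `y`. -/
def curv (x y : ℝ → ℝ) (t : ℝ) : ℝ :=
  (deriv x t * deriv (deriv y) t - deriv y t * deriv (deriv x) t) / speed x y t ^ 3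

theorem plane_norm (v : Plane) : ‖v‖ = Real.sqrt (v 0 ^ 2 + v 1 ^ 2) := by
  rw [EuclideanSpace.norm_eq, Fin.sum_univ_two]; simp

theorem hasDerivAt_plane_iff {c : ℝ → Plane} {c' : Plane} {t : ℝ} :
    HasDerivAt c c' t ↔ HasDerivAt (fun r => c r 0) (c' 0) t ∧
      HasDerivAt (fun r => c r 1) (c' 1) t := by
  simp only [← hasDerivWithinAt_univ]
  exact hasDerivWithinAt_plane_iff

/-- The energy density `μ |k|^p u + ν u` of a curve with derivatives `(X, Y)` and `(X₂, Y₂)`,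
where `u` is the speed. -/
def density (p μ ν X Y X₂ Y₂ : ℝ) : ℝ :=
  μ * (|(X * Y₂ - Y * X₂) / Real.sqrt (X ^ 2 + Y ^ 2) ^ 3| ^ p * Real.sqrt (X ^ 2 + Y ^ 2))
    + ν * Real.sqrt (X ^ 2 + Y ^ 2)

/-- The derivative of `density` in the direction `(e, f, e₂, f₂)`. -/
def densityDeriv (p μ ν X Y X₂ Y₂ e f e₂ f₂ : ℝ) : ℝ :=
  let u := Real.sqrt (X ^ 2 + Y ^ 2)
  let k := (X * Y₂ - Y * X₂) / u ^ 3
  let τ := (X * e + Y * f) / u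
  μ * (p * |k| ^ (p - 2) * k * ((e * Y₂ + X * f₂ - (f * X₂ + Y * e₂)) / u ^ 3 - 3 * k * τ / u) * u
    + |k| ^ p * τ) + ν * τ

/-- The power `|k|^p` is differentiable even at `k = 0` because `p > 1`, so no assumption on the
zeros of the curvature is needed. -/
theorem hasDerivAt_density {p : ℝ} (hp : 1 < p) (μ ν X Y X₂ Y₂ e f e₂ f₂ ε : ℝ)
    (hpos : 0 < (X + ε * e) ^ 2 + (Y + ε * f) ^ 2) :
    HasDerivAt (fun ε => density p μ ν (X + ε * e) (Y + ε * f) (X₂ + ε * e₂) (Y₂ + ε * f₂))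
      (densityDeriv p μ ν (X + ε * e) (Y + ε * f) (X₂ + ε * e₂) (Y₂ + ε * f₂) e f e₂ f₂) ε := by
  have lin : ∀ a b : ℝ, HasDerivAt (fun ε : ℝ => a + ε * b) b ε := fun a b => by
    simpa using ((hasDerivAt_id ε).mul_const b).const_add a
  have hX := lin X e
  have hY := lin Y f
  have hX₂ := lin X₂ e₂
  have hY₂ := lin Y₂ f₂
  have hu : 0 < Real.sqrt ((X + ε * e) ^ 2 + (Y + ε * f) ^ 2) := Real.sqrt_pos.2 hpos
  have hQ := ((hX.fun_pow 2).fun_add (hY.fun_pow 2)).sqrt hpos.ne'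
  have hD := (hX.fun_mul hY₂).fun_sub (hY.fun_mul hX₂)
  have hk := hD.fun_div (hQ.fun_pow 3) (by positivity)
  have hkp := (hasDerivAt_abs_rpow _ hp).comp ε hk
  have := ((hkp.mul hQ).const_mul μ).fun_add (hQ.const_mul ν)
  refine (this.congr_deriv ?_)
  simp only [densityDeriv, Function.comp]
  set u := Real.sqrt ((X + ε * e) ^ 2 + (Y + ε * f) ^ 2)
  have hne : u ≠ 0 := hu.ne'
  have e1 : ∀ A B : ℝ, A / u ^ 3 - 3 * (B / u ^ 3) * (((X + ε * e) * e + (Y + ε * f) * f) / u) / u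
      = (A * u ^ 3 - B * (3 * u ^ 2 * ((2 * (X + ε * e) * e + 2 * (Y + ε * f) * f) / (2 * u))))
        / (u ^ 3) ^ 2 := by
    intro A B
    field_simp
  rw [e1]
  have e2 : (2 * (X + ε * e) * e + 2 * (Y + ε * f) * f) / (2 * u)
      = ((X + ε * e) * e + (Y + ε * f) * f) / u := by
    field_simp
  norm_num
  rw [e2]

/-- The dominating function for differentiation under the integral sign. If `B` controls the second
derivatives, then `k` and its variation are `O(B)` and `|k|^(p-1)` is `O(B^(p-1))`, which together
give `O(B^p)`; the speed is bounded above and below. -/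
theorem abs_densityDeriv_le {p m M : ℝ} (hp : 1 < p) (hm : 0 < m) (hM : 1 ≤ M) (μ ν : ℝ) :
    ∃ C, 0 ≤ C ∧ ∀ X Y X₂ Y₂ e f e₂ f₂ B : ℝ, |X| ≤ M → |Y| ≤ M → |e| ≤ M → |f| ≤ M → |e₂| ≤ M →
      |f₂| ≤ M → 1 ≤ B → |X₂| ≤ M * B → |Y₂| ≤ M * B → m ≤ Real.sqrt (X ^ 2 + Y ^ 2) →
      |densityDeriv p μ ν X Y X₂ Y₂ e f e₂ f₂| ≤ C * B ^ p := by
  -- `c₁` bounds `|k| / B`, `c₂` the variation `τ` of the speed, and `c₃` the variation of `k`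
  -- divided by `B`.
  set c₁ := 2 * M ^ 2 / m ^ 3 with hc₁
  set c₂ := 2 * M ^ 2 / m with hc₂
  set c₃ := 4 * M ^ 2 / m ^ 3 + 3 * c₁ * c₂ / m with hc₃
  have h1 : 0 ≤ c₁ := by positivity
  have h2 : 0 ≤ c₂ := by positivity
  have h3 : 0 ≤ c₃ := by positivity
  refine ⟨|μ| * (p * c₁ ^ (p - 1) * c₃ * (2 * M) + c₁ ^ p * c₂) + |ν| * c₂, by positivity, ?_⟩
  intro X Y X₂ Y₂ e f e₂ f₂ B hX hY he hf he₂ hf₂ hB hX₂ hY₂ hu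
  simp only [densityDeriv]
  set u := Real.sqrt (X ^ 2 + Y ^ 2) with hu'
  have hu0 : 0 < u := hm.trans_le hu
  set k := (X * Y₂ - Y * X₂) / u ^ 3 with hk
  set τ := (X * e + Y * f) / u with hτ
  have hM0 : 0 ≤ M := zero_le_one.trans hM
  have hB0 : 0 ≤ B := zero_le_one.trans hB
  have prod : ∀ {a b s t : ℝ}, |a| ≤ s → |b| ≤ t → |a * b| ≤ s * t := fun {a b s t} ha hb => by
    rw [abs_mul]; exact mul_le_mul ha hb (abs_nonneg _) ((abs_nonneg _).trans ha)
  have hkB : |k| ≤ c₁ * B := by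
    rw [hk, abs_div, abs_of_pos (by positivity : 0 < u ^ 3)]
    calc |X * Y₂ - Y * X₂| / u ^ 3 ≤ (M * (M * B) + M * (M * B)) / m ^ 3 := by
          gcongr
          exact (abs_sub _ _).trans (add_le_add (prod hX hY₂) (prod hY hX₂))
      _ = c₁ * B := by rw [hc₁]; ring
  have hτB : |τ| ≤ c₂ := by
    rw [hτ, abs_div, abs_of_pos hu0]
    calc |X * e + Y * f| / u ≤ (M * M + M * M) / m := by
          gcongr
          exact (abs_add_le _ _).trans (add_le_add (prod hX he) (prod hY hf))
      _ = c₂ := by rw [hc₂]; ring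
  have hu2 : u ≤ 2 * M := by
    rw [hu', Real.sqrt_le_left (by positivity)]
    nlinarith [sq_le_sq' (abs_le.1 hX).1 (abs_le.1 hX).2, sq_le_sq' (abs_le.1 hY).1 (abs_le.1 hY).2]
  set d := (e * Y₂ + X * f₂ - (f * X₂ + Y * e₂)) / u ^ 3 - 3 * k * τ / u with hd
  have hdB : |d| ≤ c₃ * B := by
    have e1 : |(e * Y₂ + X * f₂ - (f * X₂ + Y * e₂)) / u ^ 3| ≤ 4 * M ^ 2 / m ^ 3 * B := by
      rw [abs_div, abs_of_pos (by positivity : 0 < u ^ 3)]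
      calc |e * Y₂ + X * f₂ - (f * X₂ + Y * e₂)| / u ^ 3
          ≤ ((M * (M * B) + M * M) + (M * (M * B) + M * M)) / m ^ 3 := by
            gcongr
            refine (abs_sub _ _).trans (add_le_add ?_ ?_)
            · exact (abs_add_le _ _).trans (add_le_add (prod he hY₂) (prod hX hf₂))
            · exact (abs_add_le _ _).trans (add_le_add (prod hf hX₂) (prod hY he₂))
        _ ≤ 4 * M ^ 2 * B / m ^ 3 := by
            gcongr
            nlinarith [mul_le_mul_of_nonneg_left hB (sq_nonneg M)]
        _ = 4 * M ^ 2 / m ^ 3 * B := by ring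
    have e2 : |3 * k * τ / u| ≤ 3 * c₁ * c₂ / m * B := by
      rw [abs_div, abs_of_pos hu0, abs_mul, abs_mul, abs_of_pos (by norm_num : (0 : ℝ) < 3)]
      calc 3 * |k| * |τ| / u ≤ 3 * (c₁ * B) * c₂ / m := by gcongr
        _ = 3 * c₁ * c₂ / m * B := by ring
    calc |d| ≤ 4 * M ^ 2 / m ^ 3 * B + 3 * c₁ * c₂ / m * B :=
          (abs_sub _ _).trans (add_le_add e1 e2)
      _ = c₃ * B := by rw [hc₃]; ring
  have hBp : 1 ≤ B ^ p := Real.one_le_rpow hB (by linarith)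
  have hW : |p * |k| ^ (p - 2) * k| ≤ p * c₁ ^ (p - 1) * B ^ (p - 1) := by
    rw [abs_mul, abs_mul, abs_of_pos (by linarith : 0 < p), abs_of_nonneg (by positivity)]
    have : |k| ^ (p - 2) * |k| ≤ |k| ^ (p - 1) := by
      rcases eq_or_ne k 0 with h0 | h0
      · rw [h0, abs_zero, mul_zero]; exact Real.rpow_nonneg le_rfl _
      · rw [← Real.rpow_add_one (abs_ne_zero.2 h0)]
        exact (congrArg _ (by ring)).le
    calc p * |k| ^ (p - 2) * |k| = p * (|k| ^ (p - 2) * |k|) := by ring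
      _ ≤ p * (c₁ * B) ^ (p - 1) := by
          gcongr
          exact this.trans (Real.rpow_le_rpow (abs_nonneg _) hkB (by linarith))
      _ = p * c₁ ^ (p - 1) * B ^ (p - 1) := by rw [Real.mul_rpow h1 hB0]; ring
  have hkp : |k| ^ p ≤ c₁ ^ p * B ^ p := by
    rw [← Real.mul_rpow h1 hB0]
    exact Real.rpow_le_rpow (abs_nonneg _) hkB (by linarith)
  have hBB : B ^ (p - 1) * B = B ^ p := by
    rw [← Real.rpow_add_one (by linarith)]; congr 1; ring
  have t1 : |p * |k| ^ (p - 2) * k * d * u| ≤ p * c₁ ^ (p - 1) * c₃ * (2 * M) * B ^ p := by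
    have := prod (prod hW hdB) (show |u| ≤ 2 * M by rwa [abs_of_pos hu0])
    refine this.trans (le_of_eq ?_)
    rw [← hBB]; ring
  have t2 : |(|k| ^ p * τ)| ≤ c₁ ^ p * c₂ * B ^ p := by
    have := prod (show |(|k| ^ p)| ≤ c₁ ^ p * B ^ p by rwa [abs_of_nonneg (by positivity)]) hτB
    exact this.trans (le_of_eq (by ring))
  have t3 : |ν * τ| ≤ |ν| * c₂ * B ^ p := by
    calc |ν * τ| ≤ |ν| * c₂ := prod le_rfl hτB
      _ = |ν| * c₂ * 1 := by ring
      _ ≤ _ := by gcongr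
  refine (abs_add_le _ _).trans ?_
  have t4 := prod (le_refl |μ|) ((abs_add_le _ _).trans (add_le_add t1 t2))
  refine (add_le_add t4 t3).trans (le_of_eq ?_)
  ring

/-- Needed only for the integrability of the density at the unperturbed curve. -/
theorem abs_density_le {p m M : ℝ} (hp : 1 < p) (hm : 0 < m) (hM : 1 ≤ M) (μ ν : ℝ) :
    ∃ C, 0 ≤ C ∧ ∀ X Y X₂ Y₂ B : ℝ, |X| ≤ M → |Y| ≤ M →
      1 ≤ B → |X₂| ≤ M * B → |Y₂| ≤ M * B → m ≤ Real.sqrt (X ^ 2 + Y ^ 2) →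
      |density p μ ν X Y X₂ Y₂| ≤ C * B ^ p := by
  set c₁ := 2 * M ^ 2 / m ^ 3 with hc₁
  have h1 : 0 ≤ c₁ := by positivity
  refine ⟨|μ| * (c₁ ^ p * (2 * M)) + |ν| * (2 * M), by positivity, ?_⟩
  intro X Y X₂ Y₂ B hX hY hB hX₂ hY₂ hu
  simp only [density]
  set u := Real.sqrt (X ^ 2 + Y ^ 2) with hu'
  have hu0 : 0 < u := hm.trans_le hu
  have hM0 : 0 ≤ M := zero_le_one.trans hM
  have hB0 : 0 ≤ B := zero_le_one.trans hB
  set k := (X * Y₂ - Y * X₂) / u ^ 3 with hk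
  have prod : ∀ {a b s t : ℝ}, |a| ≤ s → |b| ≤ t → |a * b| ≤ s * t := fun {a b s t} ha hb => by
    rw [abs_mul]; exact mul_le_mul ha hb (abs_nonneg _) ((abs_nonneg _).trans ha)
  have hkB : |k| ≤ c₁ * B := by
    rw [hk, abs_div, abs_of_pos (by positivity : 0 < u ^ 3)]
    calc |X * Y₂ - Y * X₂| / u ^ 3 ≤ (M * (M * B) + M * (M * B)) / m ^ 3 := by
          gcongr
          exact (abs_sub _ _).trans (add_le_add (prod hX hY₂) (prod hY hX₂))
      _ = c₁ * B := by rw [hc₁]; ring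
  have hu2 : |u| ≤ 2 * M := by
    rw [abs_of_pos hu0, hu', Real.sqrt_le_left (by positivity)]
    nlinarith [sq_le_sq' (abs_le.1 hX).1 (abs_le.1 hX).2, sq_le_sq' (abs_le.1 hY).1 (abs_le.1 hY).2]
  have hBp : 1 ≤ B ^ p := Real.one_le_rpow hB (by linarith)
  have hkp : |(|k| ^ p)| ≤ c₁ ^ p * B ^ p := by
    rw [← Real.mul_rpow h1 hB0, abs_of_nonneg (by positivity)]
    exact Real.rpow_le_rpow (abs_nonneg _) hkB (by linarith)
  have t1 := prod (le_refl |μ|) (prod hkp hu2)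
  have t3 : |ν * u| ≤ |ν| * (2 * M) * B ^ p := by
    calc |ν * u| ≤ |ν| * (2 * M) := prod le_rfl hu2
      _ = |ν| * (2 * M) * 1 := by ring
      _ ≤ _ := by gcongr
  exact (abs_add_le _ _).trans ((add_le_add t1 t3).trans (le_of_eq (by ring)))

theorem IsRegularRepr.hasDerivAt {p : ℝ} {γ : ℝ → Plane} {x y : ℝ → ℝ} (h : IsRegularRepr p γ x y)
    {t : ℝ} (ht : t ∈ Ioo (0 : ℝ) 1) : HasDerivAt γ !₂[deriv x t, deriv y t] t := by
  have h1 := hasDerivWithinAt_plane (c := γ)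
    ((h.contDiff_fst.differentiable one_ne_zero t).hasDerivAt.hasDerivWithinAt)
    ((h.contDiff_snd.differentiable one_ne_zero t).hasDerivAt.hasDerivWithinAt)
    (fun r hr => h.eq_fst r hr) (fun r hr => h.eq_snd r hr) (Ioo_subset_Icc_self ht)
  exact h1.hasDerivAt (Icc_mem_nhds ht.1 ht.2)

theorem IsRegularRepr.ae_deriv {p : ℝ} {γ : ℝ → Plane} {x y : ℝ → ℝ} (h : IsRegularRepr p γ x y) :
    ∀ᵐ t ∂unitMeasure, t ∈ Ioo (0 : ℝ) 1 ∧ HasDerivAt (deriv x) (deriv (deriv x) t) t ∧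
      HasDerivAt (deriv y) (deriv (deriv y) t) t := by
  filter_upwards [ae_unit_hasDerivAt_deriv h.ac_fst, ae_unit_hasDerivAt_deriv h.ac_snd,
    ae_restrict_mem measurableSet_Ioo] with t h1 h2 h3
  exact ⟨h3, h1, h2⟩

theorem IsTestFunction.coord {η : ℝ → Plane} (hη : IsTestFunction η) (i : Fin 2) :
    IsTestFunction (fun t => η t i) := hη.comp_clm (EuclideanSpace.proj i)

theorem IsTestFunction.deriv_coord {η : ℝ → Plane} (hη : IsTestFunction η) (i : Fin 2) (t : ℝ) :
    _root_.deriv η t i = _root_.deriv (fun t => η t i) t := by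
  have := hasDerivAt_plane_iff.1 (hη.hasDerivAt t)
  fin_cases i
  · exact this.1.deriv.symm
  · exact this.2.deriv.symm

theorem IsRegularRepr.deriv_add_smul {p : ℝ} {γ η : ℝ → Plane} {x y : ℝ → ℝ}
    (h : IsRegularRepr p γ x y) (hη : IsTestFunction η) (ε : ℝ) {t : ℝ} (ht : t ∈ Ioo (0 : ℝ) 1) :
    deriv (γ + ε • η) t = !₂[deriv x t + ε * deriv (fun t => η t 0) t,
      deriv y t + ε * deriv (fun t => η t 1) t] := by
  have h1 := ((h.hasDerivAt ht).add ((hη.hasDerivAt t).const_smul ε)).deriv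
  rw [h1]
  ext i
  fin_cases i
  · simp [hη.deriv_coord]
  · simp [hη.deriv_coord]

/-- The formula for the first derivative holds on the open interval and can therefore be
differentiated again, but only where `x'` and `y'` are differentiable, that is, almost everywhere.
-/
theorem IsRegularRepr.ae_density {p : ℝ} {γ η : ℝ → Plane} {x y : ℝ → ℝ}
    (h : IsRegularRepr p γ x y) (hη : IsTestFunction η) (ε : ℝ) :
    ∀ᵐ t ∂unitMeasure,
      ‖deriv (γ + ε • η) t‖ = Real.sqrt ((deriv x t + ε * deriv (fun t => η t 0) t) ^ 2
        + (deriv y t + ε * deriv (fun t => η t 1) t) ^ 2) ∧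
      |signedCurvature (γ + ε • η) t| ^ p * ‖deriv (γ + ε • η) t‖ =
        density p 1 0 (deriv x t + ε * deriv (fun t => η t 0) t)
          (deriv y t + ε * deriv (fun t => η t 1) t)
          (deriv (deriv x) t + ε * deriv (deriv fun t => η t 0) t)
          (deriv (deriv y) t + ε * deriv (deriv fun t => η t 1) t) := by
  filter_upwards [h.ae_deriv] with t ⟨ht, hx, hy⟩
  have h1 := h.deriv_add_smul hη ε ht
  have hn : ‖deriv (γ + ε • η) t‖ = Real.sqrt ((deriv x t + ε * deriv (fun t => η t 0) t) ^ 2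
        + (deriv y t + ε * deriv (fun t => η t 1) t) ^ 2) := by
    rw [plane_norm, h1]; simp
  refine ⟨hn, ?_⟩
  have h2 : HasDerivAt (deriv (γ + ε • η))
      !₂[deriv (deriv x) t + ε * deriv (deriv fun t => η t 0) t,
        deriv (deriv y) t + ε * deriv (deriv fun t => η t 1) t] t := by
    have hx' := hx.add (((hη.coord 0).deriv.hasDerivAt t).const_mul ε)
    have hy' := hy.add (((hη.coord 1).deriv.hasDerivAt t).const_mul ε)
    have h3 : HasDerivAt (fun t => (!₂[deriv x t + ε * deriv (fun t => η t 0) t,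
      deriv y t + ε * deriv (fun t => η t 1) t] : Plane))
      !₂[deriv (deriv x) t + ε * deriv (deriv fun t => η t 0) t,
        deriv (deriv y) t + ε * deriv (deriv fun t => η t 1) t] t := by
      rw [hasDerivAt_plane_iff]
      exact ⟨by simpa using! hx', by simpa using! hy'⟩
    refine h3.congr_of_eventuallyEq ?_
    filter_upwards [isOpen_Ioo.mem_nhds ht] with s hs
    exact h.deriv_add_smul hη ε hs
  rw [density, signedCurvature, h2.deriv, hn, h1]
  simp

/-- Dominated differentiation in `ε` on a ball on which the perturbed curves stay uniformly
immersed. The dominating function is a multiple of `B^p`, which is integrable because the second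
derivatives lie in `L^p`. -/
theorem hasDerivAt_integral_density {p : ℝ} (hp : 1 < p) {γ η : ℝ → Plane} {x y : ℝ → ℝ}
    (h : IsRegularRepr p γ x y) (hη : IsTestFunction η) (μ ν : ℝ) :
    Integrable (fun t => densityDeriv p μ ν (deriv x t) (deriv y t) (deriv (deriv x) t)
      (deriv (deriv y) t) (deriv (fun t => η t 0) t) (deriv (fun t => η t 1) t)
      (deriv (deriv fun t => η t 0) t) (deriv (deriv fun t => η t 1) t)) unitMeasure ∧
    HasDerivAt (fun ε : ℝ => ∫ t in Ioo (0 : ℝ) 1, density p μ ν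
          (deriv x t + ε * deriv (fun t => η t 0) t) (deriv y t + ε * deriv (fun t => η t 1) t)
          (deriv (deriv x) t + ε * deriv (deriv fun t => η t 0) t)
          (deriv (deriv y) t + ε * deriv (deriv fun t => η t 1) t))
      (∫ t in Ioo (0 : ℝ) 1, densityDeriv p μ ν (deriv x t) (deriv y t) (deriv (deriv x) t)
      (deriv (deriv y) t) (deriv (fun t => η t 0) t) (deriv (fun t => η t 1) t)
      (deriv (deriv fun t => η t 0) t) (deriv (deriv fun t => η t 1) t)) 0 := by
  set e := fun t => η t 0 with he
  set f := fun t => η t 1 with hf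
  have hte : IsTestFunction e := hη.coord 0
  have htf : IsTestFunction f := hη.coord 1
  have cx : Continuous (deriv x) := h.contDiff_fst.continuous_deriv le_rfl
  have cy : Continuous (deriv y) := h.contDiff_snd.continuous_deriv le_rfl
  -- uniform bounds
  obtain ⟨M₁, hM₁⟩ := isCompact_Icc.exists_bound_of_continuousOn (cx.continuousOn (s := Icc 0 1))
  obtain ⟨M₂, hM₂⟩ := isCompact_Icc.exists_bound_of_continuousOn (cy.continuousOn (s := Icc 0 1))
  obtain ⟨M₃, hM₃⟩ := hte.deriv.exists_bound
  obtain ⟨M₄, hM₄⟩ := htf.deriv.exists_bound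
  obtain ⟨M₅, hM₅⟩ := hte.deriv.deriv.exists_bound
  obtain ⟨M₆, hM₆⟩ := htf.deriv.deriv.exists_bound
  set N := 1 + |M₁| + |M₂| + |M₃| + |M₄| + |M₅| + |M₆| with hN
  have n1 := abs_nonneg M₁
  have n2 := abs_nonneg M₂
  have n3 := abs_nonneg M₃
  have n4 := abs_nonneg M₄
  have n5 := abs_nonneg M₅
  have n6 := abs_nonneg M₆
  have bx : ∀ t ∈ Icc (0 : ℝ) 1, |deriv x t| ≤ N := fun t ht => by
    have := hM₁ t ht; rw [Real.norm_eq_abs] at this; linarith [le_abs_self M₁]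
  have by' : ∀ t ∈ Icc (0 : ℝ) 1, |deriv y t| ≤ N := fun t ht => by
    have := hM₂ t ht; rw [Real.norm_eq_abs] at this; linarith [le_abs_self M₂]
  have be : ∀ t, |deriv e t| ≤ N := fun t => by
    have := hM₃ t; rw [Real.norm_eq_abs] at this; linarith [le_abs_self M₃]
  have bf : ∀ t, |deriv f t| ≤ N := fun t => by
    have := hM₄ t; rw [Real.norm_eq_abs] at this; linarith [le_abs_self M₄]
  have be₂ : ∀ t, |deriv (deriv e) t| ≤ N := fun t => by
    have := hM₅ t; rw [Real.norm_eq_abs] at this; linarith [le_abs_self M₅]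
  have bf₂ : ∀ t, |deriv (deriv f) t| ≤ N := fun t => by
    have := hM₆ t; rw [Real.norm_eq_abs] at this; linarith [le_abs_self M₆]
  have hN1 : 1 ≤ N := by rw [hN]; linarith
  obtain ⟨t₀, -, hmin⟩ := isCompact_Icc.exists_isMinOn (nonempty_Icc.2 zero_le_one)
    (((cx.pow 2).add (cy.pow 2)).continuousOn (s := Icc (0 : ℝ) 1))
  set q := deriv x t₀ ^ 2 + deriv y t₀ ^ 2 with hq
  have hq0 : 0 < q := h.immersed t₀
  have hqmin : ∀ t ∈ Icc (0 : ℝ) 1, q ≤ deriv x t ^ 2 + deriv y t ^ 2 := fun t ht => hmin ht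
  -- The term linear in `ε` in the squared speed is at most `4 |ε| N²`, so this choice keeps the
  -- squared speed above `q / 2`.
  set δ := min 1 (q / (8 * N ^ 2)) with hδ
  have hδ0 : 0 < δ := lt_min one_pos (by positivity)
  have hεN : ∀ ε ∈ Metric.ball (0 : ℝ) δ, |ε| ≤ 1 ∧ |ε| * (8 * N ^ 2) ≤ q := by
    intro ε hε
    rw [mem_ball_zero_iff, Real.norm_eq_abs] at hε
    refine ⟨(hε.trans_le (min_le_left _ _)).le, ?_⟩
    have := (hε.trans_le (min_le_right _ _)).le
    rwa [le_div_iff₀ (by positivity)] at this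
  have addb : ∀ {ε a b s t : ℝ}, |ε| ≤ 1 → |a| ≤ s → |b| ≤ t → |a + ε * b| ≤ s + t := by
    intro ε a b s t hε ha hb
    refine (abs_add_le _ _).trans (add_le_add ha ?_)
    rw [abs_mul]
    calc |ε| * |b| ≤ 1 * t := mul_le_mul hε hb (abs_nonneg _) zero_le_one
      _ = t := one_mul t
  have hspeed : ∀ ε ∈ Metric.ball (0 : ℝ) δ, ∀ t ∈ Icc (0 : ℝ) 1,
      q / 2 ≤ (deriv x t + ε * deriv e t) ^ 2 + (deriv y t + ε * deriv f t) ^ 2 := by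
    intro ε hε t ht
    obtain ⟨-, h2⟩ := hεN ε hε
    have h3 : |ε * (deriv x t * deriv e t + deriv y t * deriv f t)| ≤ |ε| * (2 * N ^ 2) := by
      rw [abs_mul]
      gcongr
      refine (abs_add_le _ _).trans ?_
      rw [abs_mul, abs_mul]
      have := mul_le_mul (bx t ht) (be t) (abs_nonneg _) (by linarith)
      have := mul_le_mul (by' t ht) (bf t) (abs_nonneg _) (by linarith)
      nlinarith
    have h4 := (abs_le.1 h3).1
    have h5 := hqmin t ht
    nlinarith [sq_nonneg (ε * deriv e t), sq_nonneg (ε * deriv f t)]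
  set m := Real.sqrt (q / 2) with hm
  have hm0 : 0 < m := Real.sqrt_pos.2 (by positivity)
  set B := fun t => 1 + |deriv (deriv x) t| + |deriv (deriv y) t| with hB
  have hB1 : ∀ t, 1 ≤ B t := fun t => by
    simp only [hB]; linarith [abs_nonneg (deriv (deriv x) t), abs_nonneg (deriv (deriv y) t)]
  have hBp : Integrable (fun t => B t ^ p) unitMeasure := by
    have hB' : MemLp B (ENNReal.ofReal p) unitMeasure :=
      ((memLp_const (1 : ℝ)).add h.memLp_fst.abs).add h.memLp_snd.abs
    have := hB'.integrable_norm_rpow (by simp; linarith) ENNReal.ofReal_ne_top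
    refine this.congr (Eventually.of_forall fun t => ?_)
    simp only
    rw [ENNReal.toReal_ofReal (by linarith), Real.norm_of_nonneg (zero_le_one.trans (hB1 t))]
  have hpre : ∀ ε ∈ Metric.ball (0 : ℝ) δ, ∀ t ∈ Icc (0 : ℝ) 1,
      |deriv x t + ε * deriv e t| ≤ 2 * N ∧ |deriv y t + ε * deriv f t| ≤ 2 * N ∧
      |deriv (deriv x) t + ε * deriv (deriv e) t| ≤ 2 * N * B t ∧
      |deriv (deriv y) t + ε * deriv (deriv f) t| ≤ 2 * N * B t ∧
      m ≤ Real.sqrt ((deriv x t + ε * deriv e t) ^ 2 + (deriv y t + ε * deriv f t) ^ 2) := by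
    intro ε hε t ht
    have h1 := (hεN ε hε).1
    refine ⟨(addb h1 (bx t ht) (be t)).trans (by linarith),
      (addb h1 (by' t ht) (bf t)).trans (by linarith),
      (addb h1 le_rfl (be₂ t)).trans ?_, (addb h1 le_rfl (bf₂ t)).trans ?_,
      Real.sqrt_le_sqrt (hspeed ε hε t ht)⟩
    · simp only [hB]
      nlinarith [abs_nonneg (deriv (deriv x) t), abs_nonneg (deriv (deriv y) t)]
    · simp only [hB]
      nlinarith [abs_nonneg (deriv (deriv x) t), abs_nonneg (deriv (deriv y) t)]
  obtain ⟨C, hC0, hC⟩ := abs_densityDeriv_le hp hm0 (show 1 ≤ 2 * N by linarith) μ ν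
  obtain ⟨C', hC'0, hC'⟩ := abs_density_le hp hm0 (show 1 ≤ 2 * N by linarith) μ ν
  have mx := measurable_deriv x
  have my := measurable_deriv y
  have mx₂ := measurable_deriv (deriv x)
  have my₂ := measurable_deriv (deriv y)
  have me := measurable_deriv e
  have mf := measurable_deriv f
  have me₂ := measurable_deriv (deriv e)
  have mf₂ := measurable_deriv (deriv f)
  have meas : ∀ ε : ℝ, AEStronglyMeasurable (fun t => density p μ ν
          (deriv x t + ε * deriv e t) (deriv y t + ε * deriv f t)
          (deriv (deriv x) t + ε * deriv (deriv e) t)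
          (deriv (deriv y) t + ε * deriv (deriv f) t)) unitMeasure := by
    intro ε
    simp only [density]
    exact Measurable.aestronglyMeasurable (by fun_prop)
  have zero_mem : (0 : ℝ) ∈ Metric.ball (0 : ℝ) δ := Metric.mem_ball_self hδ0
  have key := hasDerivAt_integral_of_dominated_loc_of_deriv_le (μ := unitMeasure) (𝕜 := ℝ)
    (F := fun ε t => density p μ ν
          (deriv x t + ε * deriv e t) (deriv y t + ε * deriv f t)
          (deriv (deriv x) t + ε * deriv (deriv e) t)
          (deriv (deriv y) t + ε * deriv (deriv f) t))
    (F' := fun ε t => densityDeriv p μ ν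
          (deriv x t + ε * deriv e t) (deriv y t + ε * deriv f t)
          (deriv (deriv x) t + ε * deriv (deriv e) t)
          (deriv (deriv y) t + ε * deriv (deriv f) t) (deriv e t) (deriv f t)
          (deriv (deriv e) t) (deriv (deriv f) t))
    (x₀ := (0 : ℝ)) (s := Metric.ball 0 δ) (bound := fun t => C * B t ^ p)
    (Metric.ball_mem_nhds _ hδ0) (Eventually.of_forall meas) ?_ ?_ ?_ (hBp.const_mul C) ?_
  · simpa only [zero_mul, add_zero] using! key
  · refine Integrable.mono' (hBp.const_mul C') (meas 0) ?_
    filter_upwards [ae_restrict_mem measurableSet_Ioo] with t ht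
    obtain ⟨h1, h2, h3, h4, h5⟩ := hpre 0 zero_mem t (Ioo_subset_Icc_self ht)
    exact hC' _ _ _ _ _ h1 h2 (hB1 t) h3 h4 h5
  · simp only [densityDeriv]
    exact Measurable.aestronglyMeasurable (by fun_prop)
  · filter_upwards [ae_restrict_mem measurableSet_Ioo] with t ht ε hε
    obtain ⟨h1, h2, h3, h4, h5⟩ := hpre ε hε t (Ioo_subset_Icc_self ht)
    exact hC _ _ _ _ _ _ _ _ _ h1 h2 ((be t).trans (by linarith)) ((bf t).trans (by linarith))
      ((be₂ t).trans (by linarith)) ((bf₂ t).trans (by linarith)) (hB1 t) h3 h4 h5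
  · filter_upwards [ae_restrict_mem measurableSet_Ioo] with t ht ε hε
    refine hasDerivAt_density hp μ ν _ _ _ _ _ _ _ _ ε ?_
    exact lt_of_lt_of_le (by positivity) (hspeed ε hε t (Ioo_subset_Icc_self ht))

/-- The integrand of the first variation of `bendingEnergy p + lam * curveLength` at the curve
`(x, y)` in the direction `(e, f)`. -/
def firstVariation (p lam : ℝ) (x y e f : ℝ → ℝ) (t : ℝ) : ℝ :=
  p * |curv x y t| ^ (p - 2) * curv x y t * (deriv e t * deriv (deriv y) t
    + deriv x t * deriv (deriv f) t - (deriv f t * deriv (deriv x) t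
    + deriv y t * deriv (deriv e) t)) / speed x y t ^ 2
  + ((1 - 3 * p) * |curv x y t| ^ p + lam) * (deriv x t * deriv e t + deriv y t * deriv f t)
    / speed x y t

theorem rpow_sub_two_mul_self_mul_self {p : ℝ} (hp : p ≠ 0) (k : ℝ) :
    |k| ^ (p - 2) * k * k = |k| ^ p := by
  rcases eq_or_ne k 0 with h | h
  · simp [h, Real.zero_rpow hp]
  · have h1 : |k| ≠ 0 := abs_ne_zero.2 h
    rw [mul_assoc, ← abs_mul_abs_self, ← mul_assoc, ← Real.rpow_add_one h1, ← Real.rpow_add_one h1]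
    congr 1; ring

theorem densityDeriv_add {p : ℝ} (hp : 1 < p) (lam : ℝ) {x y : ℝ → ℝ} (e f : ℝ → ℝ) {t : ℝ}
    (hpos : 0 < deriv x t ^ 2 + deriv y t ^ 2) :
    densityDeriv p 1 0 (deriv x t) (deriv y t) (deriv (deriv x) t)
      (deriv (deriv y) t) (deriv e t) (deriv f t) (deriv (deriv e) t) (deriv (deriv f) t)
    + lam * densityDeriv p 0 1 (deriv x t) (deriv y t) (deriv (deriv x) t)
      (deriv (deriv y) t) (deriv e t) (deriv f t) (deriv (deriv e) t) (deriv (deriv f) t)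
    = firstVariation p lam x y e f t := by
  simp only [densityDeriv, firstVariation]
  have hu : 0 < speed x y t := Real.sqrt_pos.2 hpos
  have hu' : Real.sqrt (deriv x t ^ 2 + deriv y t ^ 2) = speed x y t := rfl
  rw [hu']
  have hk' : (deriv x t * deriv (deriv y) t - deriv y t * deriv (deriv x) t) / speed x y t ^ 3
    = curv x y t := rfl
  rw [hk', ← rpow_sub_two_mul_self_mul_self (by linarith : p ≠ 0)]
  set u := speed x y t
  set k := curv x y t
  field_simp
  ring

/-- Bending energy and length are the integrals of `density` for `(μ, ν) = (1, 0)` and `(0, 1)`. -/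
theorem hasDerivAt_energy {p : ℝ} (hp : 1 < p) {γ η : ℝ → Plane} {x y : ℝ → ℝ}
    (h : IsRegularRepr p γ x y) (hη : IsTestFunction η) (lam : ℝ) :
    HasDerivAt (fun ε : ℝ => bendingEnergy p (γ + ε • η) + lam * curveLength (γ + ε • η))
      (∫ t in Ioo (0 : ℝ) 1, firstVariation p lam x y (fun t => η t 0) (fun t => η t 1) t) 0 := by
  obtain ⟨i1, d1⟩ := hasDerivAt_integral_density hp h hη 1 0
  obtain ⟨i2, d2⟩ := hasDerivAt_integral_density hp h hη 0 1
  have d := d1.add (d2.const_mul lam)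
  rw [← integral_const_mul, ← integral_add i1 (i2.const_mul lam)] at d
  refine (d.congr_of_eventuallyEq (Eventually.of_forall fun ε => ?_)).congr_deriv ?_
  · simp only [bendingEnergy, curveLength, arclength, Pi.add_apply]
    rw [intervalIntegral.integral_of_le zero_le_one, intervalIntegral.integral_of_le zero_le_one,
      integral_Ioc_eq_integral_Ioo, integral_Ioc_eq_integral_Ioo]
    congr 1
    · refine integral_congr_ae ?_
      filter_upwards [h.ae_density hη ε] with t ht
      exact ht.2
    · congr 1
      refine integral_congr_ae ?_
      filter_upwards [h.ae_density hη ε] with t ht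
      rw [ht.1]
      simp [density]
  · congr 1
    ext t
    exact densityDeriv_add hp lam _ _ (h.immersed t)

/-- The weak Euler-Lagrange equation. -/
theorem isPElastica_iff_integral_eq_zero {p : ℝ} (hp : 1 < p) {γ : ℝ → Plane} {x y : ℝ → ℝ}
    (himm : IsImmersedW2p p γ) (h : IsRegularRepr p γ x y) :
    IsPElastica p γ ↔ ∃ lam : ℝ, ∀ e f : ℝ → ℝ, IsTestFunction e → IsTestFunction f →
      ∫ t in Ioo (0 : ℝ) 1, firstVariation p lam x y e f t = 0 := by
  constructor
  · rintro ⟨-, lam, hlam⟩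
    refine ⟨lam, fun e f he hf => ?_⟩
    have hη : IsTestFunction (fun t => (!₂[e t, f t] : Plane)) := by
      have h1 := (he.comp_clm (ContinuousLinearMap.toSpanSingleton ℝ (!₂[1, 0] : Plane))).sub
        ((hf.const_smul (-1)).comp_clm (ContinuousLinearMap.toSpanSingleton ℝ (!₂[0, 1] : Plane)))
      convert h1 using 2 with t
      ext i
      fin_cases i <;> simp
    have h1 := (hasDerivAt_energy hp h hη lam).unique (hlam _ hη)
    simpa using h1
  · rintro ⟨lam, hlam⟩
    refine ⟨himm, lam, fun η hη => ?_⟩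
    have := hasDerivAt_energy hp h hη lam
    rwa [hlam _ _ (hη.coord 0) (hη.coord 1)] at this

/-! ### Signed powers -/

/-- The signed power `|z|^r sign z`. -/
def spow (r z : ℝ) : ℝ := |z| ^ (r - 1) * z

theorem spow_zero_right (r : ℝ) : spow r 0 = 0 := by simp [spow]

theorem spow_of_pos {r z : ℝ} (hz : 0 < z) : spow r z = z ^ r := by
  rw [spow, abs_of_pos hz, ← Real.rpow_add_one hz.ne']; congr 1; ring

theorem spow_neg (r z : ℝ) : spow r (-z) = -spow r z := by simp [spow]

theorem spow_of_neg {r z : ℝ} (hz : z < 0) : spow r z = -(-z) ^ r := by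
  rw [← spow_of_pos (neg_pos.2 hz), spow_neg, neg_neg]

/-- Neither term contains a negative power, so this form shows continuity at the origin also for `0
< r < 1`, where `|z|^(r-1)` is singular. -/
theorem spow_eq_sub {r : ℝ} (hr : 0 < r) (z : ℝ) : spow r z = max z 0 ^ r - max (-z) 0 ^ r := by
  rcases lt_trichotomy z 0 with h | h | h
  · rw [spow_of_neg h, max_eq_right h.le, max_eq_left (by linarith), Real.zero_rpow hr.ne', zero_sub]
  · simp [h, spow_zero_right]
  · rw [spow_of_pos h, max_eq_left h.le, max_eq_right (by linarith), Real.zero_rpow hr.ne', sub_zero]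

theorem continuous_spow {r : ℝ} (hr : 0 < r) : Continuous (spow r) := by
  have : spow r = fun z => max z 0 ^ r - max (-z) 0 ^ r := funext (spow_eq_sub hr)
  rw [this]
  have h1 : Continuous fun z : ℝ => max z 0 ^ r :=
    (continuous_id.max continuous_const).rpow_const fun _ => Or.inr hr.le
  have h2 : Continuous fun z : ℝ => max (-z) 0 ^ r :=
    (continuous_neg.max continuous_const).rpow_const fun _ => Or.inr hr.le
  exact h1.sub h2

theorem spow_pos {r z : ℝ} (hz : 0 < z) : 0 < spow r z := by
  rw [spow_of_pos hz]; exact Real.rpow_pos_of_pos hz r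

theorem spow_lt_zero {r z : ℝ} (hz : z < 0) : spow r z < 0 := by
  rw [spow_of_neg hz, neg_lt_zero]; exact Real.rpow_pos_of_pos (neg_pos.2 hz) r

theorem spow_eq_zero_iff {r z : ℝ} : spow r z = 0 ↔ z = 0 := by
  refine ⟨fun h => ?_, fun h => by rw [h, spow_zero_right]⟩
  rcases lt_trichotomy z 0 with h' | h' | h'
  · exact absurd h (spow_lt_zero h').ne
  · exact h'
  · exact absurd h (spow_pos h').ne'

theorem abs_spow {r : ℝ} (hr : r ≠ 0) (z : ℝ) : |spow r z| = |z| ^ r := by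
  rcases eq_or_ne z 0 with h | h
  · simp [h, spow_zero_right, Real.zero_rpow hr]
  · rw [spow, abs_mul, abs_of_nonneg (by positivity), ← Real.rpow_add_one (abs_ne_zero.2 h)]
    congr 1; ring

theorem spow_spow (r s z : ℝ) : spow s (spow r z) = spow (r * s) z := by
  rcases lt_trichotomy z 0 with h | h | h
  · have h' := neg_pos.2 h
    rw [spow_of_neg h, spow_neg, spow_of_pos (Real.rpow_pos_of_pos h' r), ← Real.rpow_mul h'.le,
      spow_of_neg h]
  · simp [h, spow_zero_right]
  · rw [spow_of_pos h, spow_of_pos (Real.rpow_pos_of_pos h r), ← Real.rpow_mul h.le, spow_of_pos h]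

theorem spow_one (z : ℝ) : spow 1 z = z := by simp [spow]

theorem spow_mul (r y z : ℝ) : spow r (y * z) = spow r y * spow r z := by
  rw [spow, spow, spow, abs_mul, Real.mul_rpow (abs_nonneg _) (abs_nonneg _)]; ring

theorem spow_mul_self {r : ℝ} (hr : r + 1 ≠ 0) (z : ℝ) : spow r z * z = |z| ^ (r + 1) := by
  have := rpow_sub_two_mul_self_mul_self hr z
  rw [spow, ← this]; congr 3; ring

/-- The equation is affine in `w = |k|^(p-2) k`; this inverse pair passes between `w` and `k`. -/
theorem spow_inv_spow {p : ℝ} (hp : 1 < p) (z : ℝ) : spow (p - 1) (spow (1 / (p - 1)) z) = z := by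
  rw [spow_spow, one_div_mul_cancel (by linarith), spow_one]

theorem spow_spow_inv {p : ℝ} (hp : 1 < p) (z : ℝ) : spow (1 / (p - 1)) (spow (p - 1) z) = z := by
  rw [spow_spow, mul_one_div_cancel (by linarith), spow_one]

theorem hasDerivAt_abs_rpow_spow {r : ℝ} (hr : 1 < r) (z : ℝ) :
    HasDerivAt (fun z => |z| ^ r) (r * spow (r - 1) z) z := by
  refine (hasDerivAt_abs_rpow z hr).congr_deriv ?_
  rw [spow, show r - 1 - 1 = r - 2 by ring]; ring

/-! ### The Euler-Lagrange equation in integrated form -/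

/-- First component of the unit tangent. -/
def tanX (x y : ℝ → ℝ) (t : ℝ) : ℝ := deriv x t / speed x y t

/-- Second component of the unit tangent. -/
def tanY (x y : ℝ → ℝ) (t : ℝ) : ℝ := deriv y t / speed x y t

/-- The curve `(x, y)` has on `(0,1)` the curvature `k` with
`|k|^(p-2) k = C + c₀ x + c₁ y`. -/
structure HasAffineCurvature (p C c₀ c₁ : ℝ) (x y : ℝ → ℝ) : Prop where
  deriv_tanX : ∀ t ∈ Ioo (0 : ℝ) 1,
    HasDerivAt (tanX x y) (-(spow (1 / (p - 1)) (C + c₀ * x t + c₁ * y t) * deriv y t)) t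
  deriv_tanY : ∀ t ∈ Ioo (0 : ℝ) 1,
    HasDerivAt (tanY x y) (spow (1 / (p - 1)) (C + c₀ * x t + c₁ * y t) * deriv x t) t

/-! ### Unit tangent and Frenet equations of a regular representative -/

section Repr

variable {p : ℝ} {γ : ℝ → Plane} {x y : ℝ → ℝ}

theorem IsRegularRepr.speed_pos (h : IsRegularRepr p γ x y) (t : ℝ) : 0 < speed x y t :=
  Real.sqrt_pos.2 (h.immersed t)

theorem IsRegularRepr.speed_sq (h : IsRegularRepr p γ x y) (t : ℝ) :
    speed x y t ^ 2 = deriv x t ^ 2 + deriv y t ^ 2 := Real.sq_sqrt (h.immersed t).le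

theorem IsRegularRepr.continuous_derivX (h : IsRegularRepr p γ x y) : Continuous (deriv x) :=
  h.contDiff_fst.continuous_deriv le_rfl

theorem IsRegularRepr.continuous_derivY (h : IsRegularRepr p γ x y) : Continuous (deriv y) :=
  h.contDiff_snd.continuous_deriv le_rfl

theorem IsRegularRepr.hasDerivAt_fst (h : IsRegularRepr p γ x y) (t : ℝ) :
    HasDerivAt x (deriv x t) t := (h.contDiff_fst.differentiable one_ne_zero t).hasDerivAt

theorem IsRegularRepr.hasDerivAt_snd (h : IsRegularRepr p γ x y) (t : ℝ) :
    HasDerivAt y (deriv y t) t := (h.contDiff_snd.differentiable one_ne_zero t).hasDerivAt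

theorem IsRegularRepr.continuous_speed (h : IsRegularRepr p γ x y) : Continuous (speed x y) :=
  ((h.continuous_derivX.pow 2).add (h.continuous_derivY.pow 2)).sqrt

theorem IsRegularRepr.continuous_tanX (h : IsRegularRepr p γ x y) : Continuous (tanX x y) :=
  h.continuous_derivX.div h.continuous_speed fun t => (h.speed_pos t).ne'

theorem IsRegularRepr.continuous_tanY (h : IsRegularRepr p γ x y) : Continuous (tanY x y) :=
  h.continuous_derivY.div h.continuous_speed fun t => (h.speed_pos t).ne'

theorem IsRegularRepr.tan_sq_add (h : IsRegularRepr p γ x y) (t : ℝ) :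
    tanX x y t ^ 2 + tanY x y t ^ 2 = 1 := by
  rw [tanX, tanY, div_pow, div_pow, ← add_div, ← h.speed_sq, div_self (pow_pos (h.speed_pos t) 2).ne']

theorem IsRegularRepr.speed_mul_tanX (h : IsRegularRepr p γ x y) (t : ℝ) :
    speed x y t * tanX x y t = deriv x t := mul_div_cancel₀ _ (h.speed_pos t).ne'

theorem IsRegularRepr.speed_mul_tanY (h : IsRegularRepr p γ x y) (t : ℝ) :
    speed x y t * tanY x y t = deriv y t := mul_div_cancel₀ _ (h.speed_pos t).ne'

theorem IsRegularRepr.ac_inv_speed (h : IsRegularRepr p γ x y) :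
    AbsolutelyContinuousOnInterval (fun t => (speed x y t)⁻¹) 0 1 := by
  have h1 := (h.ac_fst.fun_mul h.ac_fst).fun_add (h.ac_snd.fun_mul h.ac_snd)
  refine absolutelyContinuousOnInterval_congr
    (absolutelyContinuousOnInterval_inv_sqrt h1 fun t _ => ?_) fun t _ => ?_
  · nlinarith [h.immersed t]
  · simp only [speed]; rw [pow_two, pow_two]

theorem IsRegularRepr.ac_tanX (h : IsRegularRepr p γ x y) :
    AbsolutelyContinuousOnInterval (tanX x y) 0 1 := h.ac_fst.fun_mul h.ac_inv_speed

theorem IsRegularRepr.ac_tanY (h : IsRegularRepr p γ x y) :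
    AbsolutelyContinuousOnInterval (tanY x y) 0 1 := h.ac_snd.fun_mul h.ac_inv_speed

/-- Frenet's equations with respect to the parameter `t`; the factor `speed` is absorbed into `deriv
x` and `deriv y`. -/
theorem IsRegularRepr.ae_deriv_tan (h : IsRegularRepr p γ x y) :
    ∀ᵐ t ∂unitMeasure, t ∈ Ioo (0 : ℝ) 1 ∧ HasDerivAt (deriv x) (deriv (deriv x) t) t ∧
      HasDerivAt (deriv y) (deriv (deriv y) t) t ∧
      HasDerivAt (tanX x y) (-(curv x y t * deriv y t)) t ∧
      HasDerivAt (tanY x y) (curv x y t * deriv x t) t := by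
  filter_upwards [h.ae_deriv] with t ⟨ht, hx, hy⟩
  have hu := h.speed_pos t
  have hs : HasDerivAt (speed x y) _ t := ((hx.fun_pow 2).fun_add (hy.fun_pow 2)).sqrt
    (h.immersed t).ne'
  have hs' : Real.sqrt (deriv x t ^ 2 + deriv y t ^ 2) = speed x y t := rfl
  rw [hs'] at hs
  have h2 := h.speed_sq t
  refine ⟨ht, hx, hy, (hx.div hs hu.ne').congr_deriv ?_, (hy.div hs hu.ne').congr_deriv ?_⟩
  · rw [curv]
    field_simp
    norm_num
    rw [h2]; ring
  · rw [curv]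
    field_simp
    norm_num
    rw [h2]; ring

/-- An absolutely continuous function with a continuous derivative almost everywhere is
differentiable. -/
theorem hasDerivAt_of_ac_of_continuous {f g : ℝ → ℝ} (hf : AbsolutelyContinuousOnInterval f 0 1)
    (hg : Continuous g) (h : ∀ᵐ t ∂unitMeasure, HasDerivAt f (g t) t) :
    ∀ t ∈ Ioo (0 : ℝ) 1, HasDerivAt f (g t) t := by
  set G := fun t => ∫ s in (0 : ℝ)..t, g s with hG
  have hGd : ∀ t, HasDerivAt G (g t) t := fun t =>
    intervalIntegral.integral_hasDerivAt_right (hg.intervalIntegrable _ _)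
      (hg.stronglyMeasurableAtFilter _ _) hg.continuousAt
  have hGac : AbsolutelyContinuousOnInterval G 0 1 :=
    (hg.intervalIntegrable 0 1).absolutelyContinuousOnInterval_intervalIntegral (by simp)
  obtain ⟨c, hc⟩ := (hf.fun_sub hGac).const_of_ae_hasDerivAt_zero (by
    rw [ae_restrict_iff' measurableSet_Ioo] at h
    filter_upwards [h, (countable_singleton (0 : ℝ)).ae_notMem volume,
      (countable_singleton (1 : ℝ)).ae_notMem volume] with t ht h0 h1 ht'
    rw [uIcc_of_le zero_le_one] at ht'
    have := (ht ⟨lt_of_le_of_ne ht'.1 (Ne.symm h0), lt_of_le_of_ne ht'.2 h1⟩).sub (hGd t)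
    rwa [sub_self] at this)
  intro t ht
  refine ((hGd t).add_const c).congr_of_eventuallyEq ?_
  filter_upwards [isOpen_Ioo.mem_nhds ht] with s hs
  have := hc s (by rw [uIcc_of_le zero_le_one]; exact Ioo_subset_Icc_self hs)
  linarith

/-- For constant directions these functions are the coefficients of the derivatives of the test
functions in the first variation, to which the du Bois-Reymond lemma will be applied. -/
theorem IsRegularRepr.integrable_densityDeriv (hp : 1 < p) (h : IsRegularRepr p γ x y)
    (μ ν e f e₂ f₂ : ℝ) :
    Integrable (fun t => densityDeriv p μ ν (deriv x t) (deriv y t) (deriv (deriv x) t)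
      (deriv (deriv y) t) e f e₂ f₂) unitMeasure := by
  obtain ⟨M₁, hM₁⟩ := isCompact_Icc.exists_bound_of_continuousOn
    (h.continuous_derivX.continuousOn (s := Icc 0 1))
  obtain ⟨M₂, hM₂⟩ := isCompact_Icc.exists_bound_of_continuousOn
    (h.continuous_derivY.continuousOn (s := Icc 0 1))
  set N := 1 + |M₁| + |M₂| + |e| + |f| + |e₂| + |f₂| with hN
  have n1 := abs_nonneg M₁
  have n2 := abs_nonneg M₂
  have n3 := abs_nonneg e
  have n4 := abs_nonneg f
  have n5 := abs_nonneg e₂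
  have n6 := abs_nonneg f₂
  obtain ⟨t₀, -, hmin⟩ := isCompact_Icc.exists_isMinOn (nonempty_Icc.2 zero_le_one)
    (h.continuous_speed.continuousOn (s := Icc (0 : ℝ) 1))
  set B := fun t => 1 + |deriv (deriv x) t| + |deriv (deriv y) t| with hB
  have hB1 : ∀ t, 1 ≤ B t := fun t => by
    simp only [hB]; linarith [abs_nonneg (deriv (deriv x) t), abs_nonneg (deriv (deriv y) t)]
  have hBp : Integrable (fun t => B t ^ p) unitMeasure := by
    have hB' : MemLp B (ENNReal.ofReal p) unitMeasure :=
      ((memLp_const (1 : ℝ)).add h.memLp_fst.abs).add h.memLp_snd.abs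
    have := hB'.integrable_norm_rpow (by simp; linarith) ENNReal.ofReal_ne_top
    refine this.congr (Eventually.of_forall fun t => ?_)
    simp only
    rw [ENNReal.toReal_ofReal (by linarith), Real.norm_of_nonneg (zero_le_one.trans (hB1 t))]
  obtain ⟨C, hC0, hC⟩ := abs_densityDeriv_le hp (h.speed_pos t₀) (show 1 ≤ N by linarith) μ ν
  have mx := measurable_deriv x
  have my := measurable_deriv y
  have mx₂ := measurable_deriv (deriv x)
  have my₂ := measurable_deriv (deriv y)
  refine Integrable.mono' (hBp.const_mul C) ?_ ?_
  · simp only [densityDeriv]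
    exact Measurable.aestronglyMeasurable (by fun_prop)
  · filter_upwards [ae_restrict_mem measurableSet_Ioo] with t ht
    have ht' := Ioo_subset_Icc_self ht
    have b1 := hM₁ t ht'
    have b2 := hM₂ t ht'
    rw [Real.norm_eq_abs] at b1 b2
    have le1 := le_abs_self M₁
    have le2 := le_abs_self M₂
    have hNB : B t ≤ N * B t := le_mul_of_one_le_left (by linarith [hB1 t]) (by linarith)
    refine hC _ _ _ _ _ _ _ _ (B t) (by linarith) (by linarith) (by linarith) (by linarith)
      (by linarith) (by linarith) (hB1 t) (le_trans ?_ hNB) (le_trans ?_ hNB) (hmin ht')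
    · simp only [hB]; linarith [abs_nonneg (deriv (deriv y) t)]
    · simp only [hB]; linarith [abs_nonneg (deriv (deriv x) t)]

end Repr

theorem firstVariation_eq_densityDeriv {p : ℝ} (hp : 1 < p) (lam : ℝ) {x y : ℝ → ℝ} (e f : ℝ → ℝ)
    {t : ℝ} (hpos : 0 < deriv x t ^ 2 + deriv y t ^ 2) :
    firstVariation p lam x y e f t
      = densityDeriv p 1 lam (deriv x t) (deriv y t) (deriv (deriv x) t)
      (deriv (deriv y) t) (deriv e t) (deriv f t) (deriv (deriv e) t) (deriv (deriv f) t) := by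
  rw [← densityDeriv_add hp lam e f hpos]
  simp only [densityDeriv]
  ring

/-- Linearity in the direction, written so as to exhibit the four coefficients. -/
theorem densityDeriv_linear (p μ ν X Y X₂ Y₂ e f e₂ f₂ : ℝ) :
    densityDeriv p μ ν X Y X₂ Y₂ e f e₂ f₂ =
      e₂ * densityDeriv p μ ν X Y X₂ Y₂ 0 0 1 0 + e * densityDeriv p μ ν X Y X₂ Y₂ 1 0 0 0
      + (f₂ * densityDeriv p μ ν X Y X₂ Y₂ 0 0 0 1 + f * densityDeriv p μ ν X Y X₂ Y₂ 0 1 0 0) := by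
  simp only [densityDeriv]
  ring

/-! ### Criticality is equivalent to affine curvature -/

section Repr

variable {p : ℝ} {γ : ℝ → Plane} {x y : ℝ → ℝ}

/-- Let `A` and `A'` be the coefficients of `e''` and `f''`. Testing the two directions separately
shows that they are primitives of the coefficients of `e'` and `f'` up to constants `c` and `c'`.
The combination `A' x' - A y'` equals `p |k|^(p-2) k`, and its derivative is `c' x' - c y'`, because
the remaining terms are the variation of the density under an infinitesimal rotation, which is zero.
-/
theorem IsRegularRepr.hasAffineCurvature (hp : 1 < p) (h : IsRegularRepr p γ x y) {lam : ℝ}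
    (hlam : ∀ e f : ℝ → ℝ, IsTestFunction e → IsTestFunction f →
      ∫ t in Ioo (0 : ℝ) 1, firstVariation p lam x y e f t = 0) :
    ∃ C c₀ c₁ : ℝ, HasAffineCurvature p C c₀ c₁ x y := by
  set D : ℝ → ℝ → ℝ → ℝ → ℝ → ℝ := fun e f e₂ f₂ t => densityDeriv p 1 lam (deriv x t) (deriv y t)
    (deriv (deriv x) t) (deriv (deriv y) t) e f e₂ f₂ with hD
  have Dint : ∀ e f e₂ f₂, Integrable (D e f e₂ f₂) unitMeasure := fun e f e₂ f₂ =>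
    h.integrable_densityDeriv hp 1 lam e f e₂ f₂
  have zero_test : IsTestFunction (fun _ : ℝ => (0 : ℝ)) :=
    ⟨contDiff_const, HasCompactSupport.zero, by simp [tsupport]⟩
  have dz : deriv (fun _ : ℝ => (0 : ℝ)) = fun _ => 0 := by ext; simp
  obtain ⟨c, d, hA⟩ := ae_eq_primitive_of_integral_deriv_deriv (Dint 0 0 1 0) (Dint 1 0 0 0) (by
    intro e he
    refine Eq.trans ?_ (hlam e _ he zero_test)
    congr 1
    ext t
    rw [firstVariation_eq_densityDeriv hp lam _ _ (h.immersed t), densityDeriv_linear, dz, dz]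
    simp only [hD]; ring)
  obtain ⟨c', d', hA'⟩ := ae_eq_primitive_of_integral_deriv_deriv (Dint 0 0 0 1) (Dint 0 1 0 0) (by
    intro f hf
    refine Eq.trans ?_ (hlam _ f zero_test hf)
    congr 1
    ext t
    rw [firstVariation_eq_densityDeriv hp lam _ _ (h.immersed t), densityDeriv_linear, dz, dz]
    simp only [hD]; ring)
  set A := fun t => d + ∫ s in (0 : ℝ)..t, (D 1 0 0 0 s + c) with hAdef
  set A' := fun t => d' + ∫ s in (0 : ℝ)..t, (D 0 1 0 0 s + c') with hAdef'
  have prim : ∀ (g : ℝ → ℝ) (c d : ℝ), Integrable g unitMeasure →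
      AbsolutelyContinuousOnInterval (fun t => d + ∫ s in (0 : ℝ)..t, (g s + c)) 0 1 ∧
      ∀ᵐ t ∂unitMeasure, HasDerivAt (fun t => d + ∫ s in (0 : ℝ)..t, (g s + c)) (g t + c) t := by
    intro g c d hg
    have hgi : IntervalIntegrable (fun s => g s + c) volume 0 1 := by
      rw [intervalIntegrable_iff_integrableOn_Ioo_of_le zero_le_one]
      exact hg.add (integrable_const c)
    refine ⟨(contDiff_const (c := d)).contDiffOn.absolutelyContinuousOnInterval.fun_add
      (hgi.absolutelyContinuousOnInterval_intervalIntegral (by simp)), ?_⟩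
    rw [ae_restrict_iff' measurableSet_Ioo]
    filter_upwards [hgi.ae_hasDerivAt_integral] with t ht ht'
    exact (ht (by rw [uIcc_of_le zero_le_one]; exact Ioo_subset_Icc_self ht') 0 (by simp)).const_add d
  obtain ⟨acA, dA⟩ := prim _ c d (Dint 1 0 0 0)
  obtain ⟨acA', dA'⟩ := prim _ c' d' (Dint 0 1 0 0)
  have lin_ac : AbsolutelyContinuousOnInterval (fun t => c' * x t - c * y t) 0 1 :=
    ((contDiff_const.mul h.contDiff_fst).sub
      (contDiff_const.mul h.contDiff_snd)).contDiffOn.absolutelyContinuousOnInterval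
  -- This function has zero derivative almost everywhere; absolute continuity is what makes it
  -- constant.
  have V_ac := ((acA'.fun_mul h.ac_fst).fun_sub (acA.fun_mul h.ac_snd)).fun_sub lin_ac
  obtain ⟨C, hC⟩ := V_ac.const_of_ae_hasDerivAt_zero (by
    have key : ∀ᵐ t ∂unitMeasure, HasDerivAt (fun t => A' t * deriv x t - A t * deriv y t
        - (c' * x t - c * y t)) 0 t := by
      filter_upwards [h.ae_deriv, dA, dA', hA, hA'] with t ⟨ht, hx, hy⟩ h1 h2 h3 h4
      have := ((h2.fun_mul hx).fun_sub (h1.fun_mul hy)).fun_sub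
        (((h.hasDerivAt_fst t).const_mul c').fun_sub ((h.hasDerivAt_snd t).const_mul c))
      refine this.congr_deriv ?_
      rw [← h3, ← h4]
      simp only [hD, densityDeriv]
      have hu := h.speed_pos t
      have hu' : Real.sqrt (deriv x t ^ 2 + deriv y t ^ 2) = speed x y t := rfl
      rw [hu']
      field_simp
      ring
    rw [ae_restrict_iff' measurableSet_Ioo] at key
    filter_upwards [key, (countable_singleton (0 : ℝ)).ae_notMem volume,
      (countable_singleton (1 : ℝ)).ae_notMem volume] with t ht h0 h1 ht'
    rw [uIcc_of_le zero_le_one] at ht'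
    exact ht ⟨lt_of_le_of_ne ht'.1 (Ne.symm h0), lt_of_le_of_ne ht'.2 h1⟩)
  have hk : ∀ᵐ t ∂unitMeasure, curv x y t
      = spow (1 / (p - 1)) (C / p + c' / p * x t + -c / p * y t) := by
    filter_upwards [h.ae_deriv, hA, hA'] with t ⟨ht, hx, hy⟩ h3 h4
    have h5 := hC t (by rw [uIcc_of_le zero_le_one]; exact Ioo_subset_Icc_self ht)
    rw [← h3, ← h4] at h5
    have hu := h.speed_pos t
    have hp0 : p ≠ 0 := by linarith
    -- The vector of coefficients of the second derivatives is `p |k|^(p-2) k / speed²` times the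
    -- rotated velocity `(-y', x')`.
    have h6 : D 0 0 0 1 t * deriv x t - D 0 0 1 0 t * deriv y t
        = p * spow (p - 1) (curv x y t) := by
      simp only [hD, densityDeriv, spow]
      have hu' : Real.sqrt (deriv x t ^ 2 + deriv y t ^ 2) = speed x y t := rfl
      have hk' : (deriv x t * deriv (deriv y) t - deriv y t * deriv (deriv x) t) / speed x y t ^ 3
        = curv x y t := rfl
      rw [hu', hk', show p - 1 - 1 = p - 2 by ring]
      have h2 := h.speed_sq t
      field_simp
      rw [h2]
      ring
    have h7 : C / p + c' / p * x t + -c / p * y t = spow (p - 1) (curv x y t) := by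
      rw [h6] at h5
      field_simp
      linarith
    rw [h7, spow_spow_inv hp]
  -- The curvature agrees almost everywhere with a continuous function, which upgrades Frenet's
  -- equations from almost every to every interior point.
  have hKc : Continuous fun t => spow (1 / (p - 1)) (C / p + c' / p * x t + -c / p * y t) := by
    have h1 := h.contDiff_fst.continuous
    have h2 := h.contDiff_snd.continuous
    exact (continuous_spow (one_div_pos.2 (by linarith))).comp (by fun_prop)
  refine ⟨C / p, c' / p, -c / p, ⟨?_, ?_⟩⟩
  · refine hasDerivAt_of_ac_of_continuous h.ac_tanX (hKc.mul h.continuous_derivY).neg ?_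
    filter_upwards [h.ae_deriv_tan, hk] with t ⟨_, _, _, h1, _⟩ h2
    rwa [h2] at h1
  · refine hasDerivAt_of_ac_of_continuous h.ac_tanY (hKc.mul h.continuous_derivX) ?_
    filter_upwards [h.ae_deriv_tan, hk] with t ⟨_, _, _, _, h1⟩ h2
    rwa [h2] at h1

/-- The first integral of the Euler-Lagrange equation. -/
theorem HasAffineCurvature.exists_const (hp : 1 < p) (h : IsRegularRepr p γ x y) {C c₀ c₁ : ℝ}
    (hc : HasAffineCurvature p C c₀ c₁ x y) :
    ∃ lam, ∀ t ∈ Icc (0 : ℝ) 1, (p - 1) * |spow (1 / (p - 1)) (C + c₀ * x t + c₁ * y t)| ^ p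
      - p * (c₀ * tanY x y t - c₁ * tanX x y t) = lam := by
  set H := fun t => (p - 1) * |C + c₀ * x t + c₁ * y t| ^ (p / (p - 1))
      - p * (c₀ * tanY x y t - c₁ * tanX x y t) with hH
  have hp1 : 0 < p - 1 := by linarith
  have hr : 1 < p / (p - 1) := by rw [lt_div_iff₀ hp1]; linarith
  have hHd : ∀ t ∈ Ioo (0 : ℝ) 1, HasDerivAt H 0 t := by
    intro t ht
    have hw : HasDerivAt (fun t => C + c₀ * x t + c₁ * y t) (c₀ * deriv x t + c₁ * deriv y t) t :=
      (((h.hasDerivAt_fst t).const_mul c₀).const_add C).add ((h.hasDerivAt_snd t).const_mul c₁)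
    have h1 := ((hasDerivAt_abs_rpow_spow hr _).comp t hw).const_mul (p - 1)
    have h2 := (((hc.deriv_tanY t ht).const_mul c₀).sub ((hc.deriv_tanX t ht).const_mul c₁)).const_mul p
    refine (h1.sub h2).congr_deriv ?_
    have e1 : p / (p - 1) - 1 = 1 / (p - 1) := by field_simp; ring
    rw [e1]
    field_simp
    ring
  have hHc : ContinuousOn H (Icc 0 1) := by
    have h1 := h.contDiff_fst.continuous
    have h2 := h.contDiff_snd.continuous
    have h3 := h.continuous_tanX
    have h4 := h.continuous_tanY
    have h5 : Continuous fun t => |C + c₀ * x t + c₁ * y t| ^ (p / (p - 1)) :=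
      Continuous.rpow_const (by fun_prop) fun _ => Or.inr (by linarith)
    exact Continuous.continuousOn (by fun_prop)
  refine ⟨H 0, fun t ht => ?_⟩
  have h1 : H t = H 0 := by
    refine constant_of_has_deriv_right_zero hHc ?_ t ht
    intro s hs
    rcases eq_or_lt_of_le hs.1 with h0 | h0
    · rw [← h0]
      -- Frenet's equations are assumed in the open interval only; the one-sided derivative at `0`
      -- is obtained as a limit of interior derivatives.
      refine hasDerivWithinAt_Ici_of_tendsto_deriv (s := Ioo 0 1)
        (fun s hs => (hHd s hs).differentiableAt.differentiableWithinAt)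
        ((hHc 0 (by simp)).mono Ioo_subset_Icc_self) (Ioo_mem_nhdsGT zero_lt_one) ?_
      refine tendsto_const_nhds.congr' ?_
      filter_upwards [Ioo_mem_nhdsGT zero_lt_one] with s hs
      exact (hHd s hs).deriv.symm
    · exact (hHd s ⟨h0, hs.2⟩).hasDerivWithinAt
  rw [← h1]
  simp only [hH]
  rw [abs_spow (one_div_pos.2 hp1).ne', ← Real.rpow_mul (abs_nonneg _)]
  congr 3
  field_simp

/-- The multiplier is the constant of the first integral. With this value the integrand of the first
variation is almost everywhere the derivative of an absolutely continuous function that vanishes at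
both ends. -/
theorem HasAffineCurvature.integral_firstVariation (hp : 1 < p) (h : IsRegularRepr p γ x y)
    {C c₀ c₁ : ℝ} (hc : HasAffineCurvature p C c₀ c₁ x y) :
    ∃ lam : ℝ, ∀ e f : ℝ → ℝ, IsTestFunction e → IsTestFunction f →
      ∫ t in Ioo (0 : ℝ) 1, firstVariation p lam x y e f t = 0 := by
  obtain ⟨lam, hlam⟩ := hc.exists_const hp h
  refine ⟨lam, fun e f he hf => ?_⟩
  -- The boundary terms of the integrations by parts. They are linear in the test functions and
  -- their first derivatives, hence zero at `0` and `1`.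
  set Q := fun t => p * (C + c₀ * x t + c₁ * y t)
      * ((deriv x t * deriv f t - deriv y t * deriv e t) * ((speed x y t)⁻¹ * (speed x y t)⁻¹))
      - p * (c₀ * f t - c₁ * e t) with hQ
  have cdac : ∀ {g : ℝ → ℝ}, ContDiff ℝ 1 g → AbsolutelyContinuousOnInterval g 0 1 := fun hg =>
    hg.contDiffOn.absolutelyContinuousOnInterval
  have cd : ∀ {g : ℝ → ℝ}, IsTestFunction g → ContDiff ℝ 1 g := fun hg =>
    hg.1.of_le (by exact_mod_cast le_top)
  have hQac : AbsolutelyContinuousOnInterval Q 0 1 := by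
    refine AbsolutelyContinuousOnInterval.fun_sub (AbsolutelyContinuousOnInterval.fun_mul (cdac ?_)
      (AbsolutelyContinuousOnInterval.fun_mul (AbsolutelyContinuousOnInterval.fun_sub
        (h.ac_fst.fun_mul (cdac (cd hf.deriv))) (h.ac_snd.fun_mul (cdac (cd he.deriv))))
        (h.ac_inv_speed.fun_mul h.ac_inv_speed))) (cdac ?_)
    · exact contDiff_const.mul ((contDiff_const.add (contDiff_const.mul h.contDiff_fst)).add
        (contDiff_const.mul h.contDiff_snd))
    · exact contDiff_const.mul ((contDiff_const.mul (cd hf)).sub (contDiff_const.mul (cd he)))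
  have hQd : ∀ᵐ t ∂unitMeasure, firstVariation p lam x y e f t = deriv Q t := by
    filter_upwards [h.ae_deriv_tan] with t ⟨ht, hx, hy, h1, h2⟩
    set w := C + c₀ * x t + c₁ * y t with hw
    have hu := h.speed_pos t
    -- The two expressions for the derivative of the unit tangent are compared along the normal.
    have hk : spow (1 / (p - 1)) w = curv x y t := by
      have e1 := h1.unique (hc.deriv_tanX t ht)
      have e2 := h2.unique (hc.deriv_tanY t ht)
      have e3 := h.immersed t
      have e4 : (curv x y t - spow (1 / (p - 1)) w) * (deriv x t ^ 2 + deriv y t ^ 2) = 0 := by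
        linear_combination (-deriv y t) * e1 + deriv x t * e2
      rcases mul_eq_zero.1 e4 with e5 | e5
      · linarith
      · exact absurd e5 e3.ne'
    have hwk : w = spow (p - 1) (curv x y t) := by rw [← hk, spow_inv_spow hp]
    have hwd : HasDerivAt (fun t => C + c₀ * x t + c₁ * y t) (c₀ * deriv x t + c₁ * deriv y t) t :=
      (((h.hasDerivAt_fst t).const_mul c₀).const_add C).add ((h.hasDerivAt_snd t).const_mul c₁)
    have hN := (hx.fun_mul (hf.deriv.hasDerivAt t)).fun_sub (hy.fun_mul (he.deriv.hasDerivAt t))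
    have hs := (hx.fun_pow 2).fun_add (hy.fun_pow 2)
    have hs' : HasDerivAt (fun t => (speed x y t)⁻¹ * (speed x y t)⁻¹) _ t :=
      (hs.inv (h.immersed t).ne').congr_of_eventuallyEq (Eventually.of_forall fun t => by
        simp only [Pi.inv_apply]; rw [← h.speed_sq, pow_two, mul_inv])
    have hQ' := ((hwd.const_mul p).fun_mul (hN.fun_mul hs')).fun_sub
      ((((hf.hasDerivAt t).const_mul c₀).fun_sub ((he.hasDerivAt t).const_mul c₁)).const_mul p)
    rw [hQ'.deriv]
    have hl := hlam t (Ioo_subset_Icc_self ht)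
    rw [← hw, hk] at hl
    have hkp : |curv x y t| ^ p = w * curv x y t := by
      rw [hwk, spow_mul_self (by linarith)]; congr 1; ring
    have hkp' : p * |curv x y t| ^ (p - 2) * curv x y t = p * w := by
      rw [hwk, spow, show p - 1 - 1 = p - 2 by ring]; ring
    rw [firstVariation, hkp', ← hl, hkp, ← hw, tanX, tanY]
    have hu2 := h.speed_sq t
    have hinv : (speed x y t)⁻¹ * (speed x y t)⁻¹ = (deriv x t ^ 2 + deriv y t ^ 2)⁻¹ := by
      rw [← hu2, pow_two, mul_inv]
    rw [hinv]
    have hcv : curv x y t = (deriv x t * deriv (deriv y) t - deriv y t * deriv (deriv x) t)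
      / ((deriv x t ^ 2 + deriv y t ^ 2) * speed x y t) := by
      rw [curv, ← hu2]; rfl
    have e5 : ∀ A B E : ℝ, ((1 - 3 * p) * (w * (A / ((deriv x t ^ 2 + deriv y t ^ 2) * speed x y t)))
        + ((p - 1) * (w * (A / ((deriv x t ^ 2 + deriv y t ^ 2) * speed x y t)))
        - p * (c₀ * (deriv y t / speed x y t) - c₁ * (deriv x t / speed x y t)))) * B / speed x y t
        = (-2 * p * w * A / (deriv x t ^ 2 + deriv y t ^ 2) ^ 2
          - p * (c₀ * deriv y t - c₁ * deriv x t) / (deriv x t ^ 2 + deriv y t ^ 2)) * B := by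
      intro A B E
      rw [← hu2]
      field_simp
      ring
    rw [hcv, e5 _ _ 0, hu2]
    have hne := (h.immersed t).ne'
    field_simp
    norm_num
    ring
  rw [integral_congr_ae hQd, ← integral_Ioc_eq_integral_Ioo,
    ← intervalIntegral.integral_of_le zero_le_one, hQac.integral_deriv_eq_sub]
  simp only [hQ]
  have z0 : (0 : ℝ) ∉ Ioo (0 : ℝ) 1 := by simp
  have z1 : (1 : ℝ) ∉ Ioo (0 : ℝ) 1 := by simp
  rw [he.eq_zero_of_notMem z0, he.eq_zero_of_notMem z1, hf.eq_zero_of_notMem z0,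
    hf.eq_zero_of_notMem z1, he.deriv.eq_zero_of_notMem z0, he.deriv.eq_zero_of_notMem z1,
    hf.deriv.eq_zero_of_notMem z0, hf.deriv.eq_zero_of_notMem z1]
  ring

/-- A curve is a `p`-elastica if and only if `|k|^(p-2) k` is an affine function of position. -/
theorem isPElastica_iff_hasAffineCurvature (hp : 1 < p) (himm : IsImmersedW2p p γ)
    (h : IsRegularRepr p γ x y) :
    IsPElastica p γ ↔ ∃ C c₀ c₁ : ℝ, HasAffineCurvature p C c₀ c₁ x y := by
  rw [isPElastica_iff_integral_eq_zero hp himm h]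
  constructor
  · rintro ⟨lam, hlam⟩
    exact h.hasAffineCurvature hp hlam
  · rintro ⟨C, c₀, c₁, hc⟩
    exact hc.integral_firstVariation hp h

end Repr

/-! ### Arclength, closed curves and represented curves -/

/-- No continuity of `g` is assumed: a global left inverse coincides near `f t` with the local
inverse given by the inverse function theorem. -/
theorem hasDerivAt_leftInverse {f g : ℝ → ℝ} (hg : Function.LeftInverse g f) {f' t : ℝ}
    (hf : HasStrictDerivAt f f' t) (hf' : f' ≠ 0) : HasDerivAt g f'⁻¹ (f t) := by
  refine (hf.to_localInverse hf').hasDerivAt.congr_of_eventuallyEq ?_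
  filter_upwards [hf.hasStrictFDerivAt_equiv hf' |>.eventually_right_inverse] with s hs
  rw [← hg (hf.localInverse f f' t hf' s)]
  congr 1
  exact hs.symm

/-- The arclength of the curve `(x, y)`. -/
def arc (x y : ℝ → ℝ) (t : ℝ) : ℝ := ∫ s in (0 : ℝ)..t, speed x y s

section Repr

variable {p : ℝ} {γ : ℝ → Plane} {x y : ℝ → ℝ}

theorem IsRegularRepr.eq_mk (h : IsRegularRepr p γ x y) {t : ℝ} (ht : t ∈ Icc (0 : ℝ) 1) :
    γ t = !₂[x t, y t] := by
  ext i
  fin_cases i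
  · simpa using h.eq_fst t ht
  · simpa using h.eq_snd t ht

theorem arc_zero : arc x y 0 = 0 := intervalIntegral.integral_same

theorem IsRegularRepr.hasDerivAt_arc (h : IsRegularRepr p γ x y) (t : ℝ) :
    HasDerivAt (arc x y) (speed x y t) t :=
  intervalIntegral.integral_hasDerivAt_right (h.continuous_speed.intervalIntegrable _ _)
    (h.continuous_speed.stronglyMeasurableAtFilter _ _) h.continuous_speed.continuousAt

theorem IsRegularRepr.hasStrictDerivAt_arc (h : IsRegularRepr p γ x y) (t : ℝ) :
    HasStrictDerivAt (arc x y) (speed x y t) t :=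
  hasStrictDerivAt_of_hasDerivAt_of_continuousAt (Eventually.of_forall h.hasDerivAt_arc)
    h.continuous_speed.continuousAt

theorem IsRegularRepr.contDiff_arc (h : IsRegularRepr p γ x y) : ContDiff ℝ 1 (arc x y) := by
  rw [contDiff_one_iff_deriv]
  refine ⟨fun t => (h.hasDerivAt_arc t).differentiableAt, ?_⟩
  rw [show deriv (arc x y) = speed x y from funext fun t => (h.hasDerivAt_arc t).deriv]
  exact h.continuous_speed

theorem IsRegularRepr.strictMono_arc (h : IsRegularRepr p γ x y) : StrictMono (arc x y) :=
  strictMono_of_hasDerivAt_pos h.hasDerivAt_arc h.speed_pos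

theorem IsRegularRepr.arclength_eq (h : IsRegularRepr p γ x y) {t : ℝ} (ht : t ∈ Icc (0 : ℝ) 1) :
    arclength γ t = arc x y t := by
  refine intervalIntegral.integral_congr_ae ?_
  filter_upwards [(countable_singleton (1 : ℝ)).ae_notMem volume] with s hs hs'
  rw [uIoc_of_le ht.1] at hs'
  rw [(h.hasDerivAt ⟨hs'.1, lt_of_le_of_ne (hs'.2.trans ht.2) hs⟩).deriv, plane_norm]
  simp [speed]

/-- The arclength of the representative is strictly increasing on the whole line, so it has an
inverse that is differentiable also at the end points of `[0, L]`. There the one-sided derivatives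
of the arclength parametrization are the unit tangents. -/
theorem IsRegularRepr.isClosedCurve_iff (h : IsRegularRepr p γ x y) :
    IsClosedCurve γ ↔ (x 0 = x 1 ∧ y 0 = y 1) ∧ tanX x y 0 = tanX x y 1 ∧
      tanY x y 0 = tanY x y 1 := by
  set L := arc x y 1 with hL
  have m0 : (0 : ℝ) ∈ Icc (0 : ℝ) 1 := by simp
  have m1 : (1 : ℝ) ∈ Icc (0 : ℝ) 1 := by simp
  have hcl : curveLength γ = L := h.arclength_eq m1
  have hL0 : 0 < L := by rw [← arc_zero (x := x) (y := y)]; exact h.strictMono_arc zero_lt_one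
  set g := Function.invFun (arc x y) with hg
  have hgl : Function.LeftInverse g (arc x y) :=
    Function.leftInverse_invFun h.strictMono_arc.injective
  have hinv : ∀ t ∈ Icc (0 : ℝ) 1,
      Function.invFunOn (arclength γ) (Icc (0 : ℝ) 1) (arc x y t) = t := by
    intro t ht
    have hex : ∃ r ∈ Icc (0 : ℝ) 1, arclength γ r = arc x y t := ⟨t, ht, h.arclength_eq ht⟩
    have h1 := Function.invFunOn_mem hex
    have h2 := Function.invFunOn_eq hex
    rw [h.arclength_eq h1] at h2
    exact h.strictMono_arc.injective h2
  have himage : ∀ s ∈ Icc 0 L, ∃ t ∈ Icc (0 : ℝ) 1, arc x y t = s := by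
    intro s hs
    have := intermediate_value_Icc zero_le_one (h.contDiff_arc.continuous.continuousOn (s := Icc 0 1))
    rw [arc_zero] at this
    exact this hs
  have hparam : ∀ t ∈ Icc (0 : ℝ) 1, arclengthParam γ (arc x y t) = !₂[x t, y t] := by
    intro t ht
    rw [arclengthParam, hinv t ht, h.eq_mk ht]
  have hder : ∀ t ∈ Icc (0 : ℝ) 1, derivWithin (arclengthParam γ) (Icc 0 L) (arc x y t)
      = !₂[tanX x y t, tanY x y t] := by
    intro t ht
    have htL : arc x y t ∈ Icc 0 L := by
      rw [← arc_zero (x := x) (y := y)]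
      exact ⟨h.strictMono_arc.monotone ht.1, h.strictMono_arc.monotone ht.2⟩
    have hgd := hasDerivAt_leftInverse hgl (h.hasStrictDerivAt_arc t) (h.speed_pos t).ne'
    have hx : HasDerivAt (fun s => x (g s)) (deriv x t * (speed x y t)⁻¹) (arc x y t) := by
      refine HasDerivAt.comp (h₂ := x) (arc x y t) ?_ hgd
      rw [hgl t]; exact h.hasDerivAt_fst t
    have hy : HasDerivAt (fun s => y (g s)) (deriv y t * (speed x y t)⁻¹) (arc x y t) := by
      refine HasDerivAt.comp (h₂ := y) (arc x y t) ?_ hgd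
      rw [hgl t]; exact h.hasDerivAt_snd t
    refine (hasDerivWithinAt_plane hx.hasDerivWithinAt hy.hasDerivWithinAt ?_ ?_ htL).derivWithin
      (uniqueDiffOn_Icc hL0 _ htL)
    · intro s hs
      obtain ⟨r, hr, rfl⟩ := himage s hs
      rw [hparam r hr, hgl r]; simp
    · intro s hs
      obtain ⟨r, hr, rfl⟩ := himage s hs
      rw [hparam r hr, hgl r]; simp
  have ext2 : ∀ a b c d : ℝ, (!₂[a, b] : Plane) = !₂[c, d] ↔ a = c ∧ b = d := by
    intro a b c d
    refine ⟨fun h => ⟨by simpa using congrArg (fun z : Plane => z 0) h,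
      by simpa using congrArg (fun z : Plane => z 1) h⟩, ?_⟩
    rintro ⟨rfl, rfl⟩; rfl
  have q0 := hparam 0 m0
  have d0 := hder 0 m0
  rw [arc_zero] at q0 d0
  rw [IsClosedCurve, hcl, q0, hparam 1 m1, d0, hder 1 m1, ext2, ext2]

/-- The unit tangent. -/
def unitTangent (x y : ℝ → ℝ) (t : ℝ) : Plane := !₂[tanX x y t, tanY x y t]

theorem IsRegularRepr.isClosedCurve_iff' (h : IsRegularRepr p γ x y) :
    IsClosedCurve γ ↔ γ 0 = γ 1 ∧ unitTangent x y 0 = unitTangent x y 1 := by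
  have ext2 : ∀ a b c d : ℝ, (!₂[a, b] : Plane) = !₂[c, d] ↔ a = c ∧ b = d := by
    intro a b c d
    refine ⟨fun h => ⟨by simpa using congrArg (fun z : Plane => z 0) h,
      by simpa using congrArg (fun z : Plane => z 1) h⟩, ?_⟩
    rintro ⟨rfl, rfl⟩; rfl
  rw [h.isClosedCurve_iff, h.eq_mk (by simp), h.eq_mk (t := 1) (by simp), unitTangent,
    unitTangent, ext2, ext2]

/-- Unit tangents of represented curves. -/
theorem IsRegularRepr.exists_of_isRepresentedBy (h : IsRegularRepr p γ x y) {c T : ℝ → Plane}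
    {ℓ : ℝ} (hrep : IsRepresentedBy γ c ℓ)
    (hc : ∀ s ∈ Icc 0 ℓ, HasDerivWithinAt c (T s) (Icc 0 ℓ) s) (hT : ∀ s ∈ Icc 0 ℓ, ‖T s‖ = 1) :
    ∃ (r : ℝ) (A : Plane ≃ₗᵢ[ℝ] Plane) (v : Plane) (φ : ℝ → ℝ), 0 < r ∧ 0 < ℓ ∧
      φ 0 = 0 ∧ φ 1 = ℓ ∧ ∀ t ∈ Icc (0 : ℝ) 1, φ t ∈ Icc 0 ℓ ∧ γ t = r • A (c (φ t)) + v ∧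
        HasDerivWithinAt φ (speed x y t / r) (Icc 0 1) t ∧ unitTangent x y t = A (T (φ t)) := by
  obtain ⟨r, A, v, φ, hr, hφ, hφ', h0, h1, hγ⟩ := hrep
  have hd : ∀ t ∈ Icc (0 : ℝ) 1,
      HasDerivWithinAt φ (derivWithin φ (Icc (0 : ℝ) 1) t) (Icc (0 : ℝ) 1) t := fun t ht =>
    (hφ.differentiableOn one_ne_zero t ht).hasDerivWithinAt
  have hmono : StrictMonoOn φ (Icc 0 1) := by
    refine strictMonoOn_of_hasDerivWithinAt_pos (convex_Icc 0 1) hφ.continuousOn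
      (f' := fun t => derivWithin φ (Icc (0 : ℝ) 1) t) ?_ ?_
    · intro t ht; rw [interior_Icc] at ht ⊢
      exact (hd t (Ioo_subset_Icc_self ht)).mono Ioo_subset_Icc_self
    · intro t ht; rw [interior_Icc] at ht; exact hφ' t (Ioo_subset_Icc_self ht)
  have hmap : MapsTo φ (Icc 0 1) (Icc 0 ℓ) := by
    intro t ht
    rw [← h0, ← h1]
    exact ⟨hmono.monotoneOn (by simp) ht ht.1, hmono.monotoneOn ht (by simp) ht.2⟩
  have hℓ : 0 < ℓ := by rw [← h0, ← h1]; exact hmono (by simp) (by simp) zero_lt_one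
  refine ⟨r, A, v, φ, hr, hℓ, h0, h1, fun t ht => ?_⟩
  have hud := uniqueDiffOn_Icc zero_lt_one t ht
  set φ' := derivWithin φ (Icc (0 : ℝ) 1) t with hφ'def
  have hφ'pos : 0 < φ' := hφ' t ht
  have e1 : HasDerivWithinAt γ (r • A (φ' • T (φ t))) (Icc 0 1) t := by
    have := (hc (φ t) (hmap ht)).scomp t (hd t ht) hmap
    have h2 := ((A.toContinuousLinearEquiv.toContinuousLinearMap.hasFDerivAt.comp_hasDerivWithinAt t
      this).const_smul r).add_const v
    refine h2.congr_of_mem (fun s hs => ?_) ht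
    rw [hγ s hs]; rfl
  have e2 : HasDerivWithinAt γ !₂[deriv x t, deriv y t] (Icc 0 1) t :=
    hasDerivWithinAt_plane (h.hasDerivAt_fst t).hasDerivWithinAt
      (h.hasDerivAt_snd t).hasDerivWithinAt h.eq_fst h.eq_snd ht
  have e3 : (!₂[deriv x t, deriv y t] : Plane) = (r * φ') • A (T (φ t)) := by
    rw [← e2.derivWithin hud, e1.derivWithin hud, map_smul, smul_smul]
  -- Taking norms: the model has unit speed and `A` is isometric, so `φ` has derivative equal to the
  -- speed divided by `r`.
  have e4 : speed x y t = r * φ' := by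
    have := congrArg norm e3
    rw [norm_smul, A.norm_map, hT _ (hmap ht), mul_one, Real.norm_of_nonneg (by positivity),
      plane_norm] at this
    simpa [speed] using this
  refine ⟨hmap ht, hγ t ht, ?_, ?_⟩
  · rw [e4, mul_div_cancel_left₀ _ hr.ne']; exact hd t ht
  · have : unitTangent x y t = (speed x y t)⁻¹ • !₂[deriv x t, deriv y t] := by
      ext i; fin_cases i <;> simp [unitTangent, tanX, tanY, div_eq_inv_mul]
    rw [this, e3, e4, smul_smul, inv_mul_cancel₀ (by positivity), one_smul]

/-- A represented curve is closed if and only if its model has equal end points and tangents. -/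
theorem IsRegularRepr.isClosedCurve_iff_of_isRepresentedBy (h : IsRegularRepr p γ x y)
    {c T : ℝ → Plane} {ℓ : ℝ} (hrep : IsRepresentedBy γ c ℓ)
    (hc : ∀ s ∈ Icc 0 ℓ, HasDerivWithinAt c (T s) (Icc 0 ℓ) s) (hT : ∀ s ∈ Icc 0 ℓ, ‖T s‖ = 1) :
    0 < ℓ ∧ (IsClosedCurve γ ↔ c 0 = c ℓ ∧ T 0 = T ℓ) := by
  obtain ⟨r, A, v, φ, hr, hℓ, h0, h1, H⟩ := h.exists_of_isRepresentedBy hrep hc hT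
  refine ⟨hℓ, ?_⟩
  obtain ⟨-, g0, -, t0⟩ := H 0 (by simp)
  obtain ⟨-, g1, -, t1⟩ := H 1 (by simp)
  rw [h.isClosedCurve_iff', g0, g1, t0, t1, h0, h1, add_left_inj, smul_right_inj hr.ne',
    A.injective.eq_iff, A.injective.eq_iff]

/-- A curve is determined up to translation by its unit tangent as a function of arclength; the
translation vector matches the initial points. -/
theorem IsRegularRepr.isRepresentedBy (h : IsRegularRepr p γ x y) {r : ℝ} (hr : 0 < r)
    (A : Plane ≃ₗᵢ[ℝ] Plane) {c T : ℝ → Plane} (hc : ∀ s, HasDerivAt c (T s) s)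
    (hT : ∀ t ∈ Icc (0 : ℝ) 1, unitTangent x y t = A (T (arc x y t / r))) :
    IsRepresentedBy γ c (arc x y 1 / r) := by
  have hφd : ∀ t, HasDerivAt (fun t => arc x y t / r) (speed x y t / r) t := fun t =>
    (h.hasDerivAt_arc t).div_const r
  set G : ℝ → Plane := fun t => r • A (c (arc x y t / r)) with hG
  have hGd : ∀ t, HasDerivAt G (r • A ((speed x y t / r) • T (arc x y t / r))) t := by
    intro t
    exact (A.toContinuousLinearEquiv.toContinuousLinearMap.hasFDerivAt.comp_hasDerivAt t
      ((hc (arc x y t / r)).scomp t (hφd t))).const_smul r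
  refine ⟨r, A, γ 0 - G 0, fun t => arc x y t / r, hr, (h.contDiff_arc.div_const r).contDiffOn,
    fun t ht => ?_, by simp [arc_zero], rfl, ?_⟩
  · rw [(hφd t).hasDerivWithinAt.derivWithin (uniqueDiffOn_Icc zero_lt_one t ht)]
    exact div_pos (h.speed_pos t) hr
  · intro t ht
    have hd : ∀ s ∈ Icc (0 : ℝ) 1, HasDerivWithinAt (fun s => γ s - G s) 0 (Icc 0 1) s := by
      intro s hs
      have e2 : HasDerivWithinAt γ !₂[deriv x s, deriv y s] (Icc 0 1) s :=
        hasDerivWithinAt_plane (h.hasDerivAt_fst s).hasDerivWithinAt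
          (h.hasDerivAt_snd s).hasDerivWithinAt h.eq_fst h.eq_snd hs
      have e3 := e2.sub (hGd s).hasDerivWithinAt
      refine e3.congr_deriv ?_
      rw [map_smul, ← hT s hs, smul_smul, mul_div_cancel₀ _ hr.ne', sub_eq_zero]
      have hu := (h.speed_pos s).ne'
      ext i
      fin_cases i
      · simp [unitTangent, h.speed_mul_tanX]
      · simp [unitTangent, h.speed_mul_tanY]
    have key := (convex_Icc (0 : ℝ) 1).is_const_of_fderivWithin_eq_zero (𝕜 := ℝ)
      (f := fun s => γ s - G s) (fun s hs => (hd s hs).differentiableWithinAt)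
      (fun s hs => by
        have := (hd s hs).hasFDerivWithinAt.fderivWithin (uniqueDiffOn_Icc zero_lt_one s hs)
        rw [this]; ext; simp) ht (show (0 : ℝ) ∈ Icc (0 : ℝ) 1 by simp)
    rw [← key]
    simp [hG]

end Repr

/-! ### Inverses of periodic integrals -/

/-- Amplitudes need not be differentiable where the cosine vanishes. Formulas for the model curves
are computed off that countable set and extended by this lemma, as their right-hand sides are
continuous. -/
theorem hasDerivAt_of_off_countable {E : Type*} [NormedAddCommGroup E] [NormedSpace ℝ E]
    [CompleteSpace E] {f g : ℝ → E} {s : Set ℝ} (hs : s.Countable) (hf : Continuous f)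
    (hg : Continuous g) (h : ∀ t, t ∉ s → HasDerivAt f (g t) t) (t : ℝ) : HasDerivAt f (g t) t := by
  have h1 : ∀ r, f r = f 0 + ∫ u in (0 : ℝ)..r, g u := by
    intro r
    rw [integral_eq_of_hasDerivAt_off_countable f g hs hf.continuousOn
      (fun x hx => h x hx.2) (hg.intervalIntegrable _ _)]
    abel
  have h2 := (intervalIntegral.integral_hasDerivAt_right (hg.intervalIntegrable 0 t)
    (hg.stronglyMeasurableAtFilter _ _) hg.continuousAt).const_add (f 0)
  exact h2.congr_of_eventuallyEq (Eventually.of_forall h1)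

theorem countable_cos_eq_zero : {x : ℝ | Real.cos x = 0}.Countable := by
  refine (countable_range fun k : ℤ => (2 * (k : ℝ) + 1) * Real.pi / 2).mono fun x hx => ?_
  obtain ⟨k, hk⟩ := Real.cos_eq_zero_iff.1 hx
  exact ⟨k, hk.symm⟩

/-- After a shift the only singularity within half a period is that of `|sin θ|^r` at `0`. Jordan's
inequality `2θ/π ≤ sin θ` compares it with `θ^r`, integrable for `r > -1`; evenness and periodicity
do the rest. -/
theorem intervalIntegrable_abs_cos_rpow {r : ℝ} (hr : -1 < r) (a b : ℝ) :
    IntervalIntegrable (fun θ => |Real.cos θ| ^ r) volume a b := by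
  have hpi := Real.pi_pos
  have hmeas : Measurable fun θ => |Real.sin θ| ^ r := by fun_prop
  have h0 : IntervalIntegrable (fun θ => |Real.sin θ| ^ r) volume 0 (Real.pi / 2) := by
    rcases le_or_gt 0 r with h | h
    · exact (Continuous.rpow_const (by fun_prop) fun _ => Or.inr h).intervalIntegrable _ _
    · have hint : IntervalIntegrable (fun θ : ℝ => (2 / Real.pi) ^ r * θ ^ r) volume 0 (Real.pi / 2) :=
        (intervalIntegral.intervalIntegrable_rpow' hr).const_mul _
      refine hint.mono_fun' hmeas.aestronglyMeasurable ?_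
      rw [uIoc_of_le (by positivity)]
      filter_upwards [ae_restrict_mem measurableSet_Ioc] with θ hθ
      have h2 : 2 / Real.pi * θ ≤ Real.sin θ := Real.mul_le_sin hθ.1.le hθ.2
      have h3 : 0 < 2 / Real.pi * θ := mul_pos (by positivity) hθ.1
      rw [Real.norm_of_nonneg (by positivity), abs_of_pos (h3.trans_le h2),
        ← Real.mul_rpow (by positivity) hθ.1.le]
      exact Real.rpow_le_rpow_of_nonpos h3 h2 h.le
  have h1 : IntervalIntegrable (fun θ => |Real.sin θ| ^ r) volume (-(Real.pi / 2)) 0 := by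
    have := ((IntervalIntegrable.iff_comp_neg (enorm_ne_top)).1 h0).symm
    simpa only [Real.sin_neg, abs_neg, neg_zero] using this
  have hper : Function.Periodic (fun θ => |Real.sin θ| ^ r) Real.pi := by
    intro θ
    simp only [Real.sin_add_pi, abs_neg]
  have h2 := hper.intervalIntegrable (t := -(Real.pi / 2)) hpi.ne'
    (by
      rw [show -(Real.pi / 2) + Real.pi = Real.pi / 2 by ring]
      exact h1.trans h0) (a + Real.pi / 2) (b + Real.pi / 2)
  have h3 := h2.comp_add_right (Real.pi / 2)
  simpa [Real.sin_add_pi_div_two] using h3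

/-- Nonnegative even `π`-periodic functions which are positive and continuous where the cosine does
not vanish. -/
structure IsAmplitudeKernel (g : ℝ → ℝ) : Prop where
  integrable : ∀ a b, IntervalIntegrable g volume a b
  periodic : Function.Periodic g Real.pi
  even : ∀ x, g (-x) = g x
  nonneg : ∀ x, 0 ≤ g x
  pos : ∀ x, Real.cos x ≠ 0 → 0 < g x
  continuousAt : ∀ x, Real.cos x ≠ 0 → ContinuousAt g x

section Kernel

variable {g : ℝ → ℝ}

/-- The integral of `g` from `0` to `x`. -/
def primitive (g : ℝ → ℝ) (x : ℝ) : ℝ := ∫ θ in (0 : ℝ)..x, g θ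

/-- The inverse of the integral of `g`. -/
def amplitude (g : ℝ → ℝ) : ℝ → ℝ := Function.invFunOn (primitive g) univ

theorem primitive_zero : primitive g 0 = 0 := intervalIntegral.integral_same

theorem continuous_primitive_of_integrable (h : ∀ a b, IntervalIntegrable g volume a b) :
    Continuous (primitive g) :=
  intervalIntegral.continuous_primitive h 0

theorem hasDerivAt_primitive (h : ∀ a b, IntervalIntegrable g volume a b) (hm : Measurable g)
    {x : ℝ} (hx : ContinuousAt g x) : HasDerivAt (primitive g) (g x) x :=
  intervalIntegral.integral_hasDerivAt_right (h 0 x)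
    (hm.stronglyMeasurable.stronglyMeasurableAtFilter) hx

theorem IsAmplitudeKernel.hasDerivAt (h : IsAmplitudeKernel g) (hm : Measurable g) {x : ℝ}
    (hx : Real.cos x ≠ 0) : HasDerivAt (primitive g) (g x) x :=
  hasDerivAt_primitive h.integrable hm (h.continuousAt x hx)

theorem IsAmplitudeKernel.sub_eq (h : IsAmplitudeKernel g) (a b : ℝ) :
    primitive g b - primitive g a = ∫ θ in a..b, g θ :=
  intervalIntegral.integral_interval_sub_left (h.integrable _ _) (h.integrable _ _)

/-- A monotone primitive with equal values at two points is constant between them, yet in between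
lies a point with nonzero cosine, where its derivative is positive. -/
theorem IsAmplitudeKernel.strictMono (h : IsAmplitudeKernel g) (hm : Measurable g) :
    StrictMono (primitive g) := by
  have hmono : Monotone (primitive g) := by
    intro a b hab
    have := intervalIntegral.integral_nonneg (μ := volume) hab fun x _ => h.nonneg x
    rw [← h.sub_eq] at this
    linarith
  intro a b hab
  refine lt_of_le_of_ne (hmono hab.le) fun heq => ?_
  obtain ⟨x, hx1, hx2⟩ := (countable_cos_eq_zero.dense_compl ℝ).exists_mem_open isOpen_Ioo
    (nonempty_Ioo.2 hab)
  have hd := h.hasDerivAt hm hx1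
  have hc : HasDerivAt (primitive g) 0 x := by
    refine (hasDerivAt_const x (primitive g a)).congr_of_eventuallyEq ?_
    filter_upwards [isOpen_Ioo.mem_nhds hx2] with y hy
    exact le_antisymm ((hmono hy.2.le).trans heq.ge) (hmono hy.1.le)
  exact (h.pos x hx1).ne' (hd.unique hc)

theorem IsAmplitudeKernel.primitive_neg (h : IsAmplitudeKernel g) (x : ℝ) :
    primitive g (-x) = -primitive g x := by
  have := intervalIntegral.integral_comp_neg (a := 0) (b := x) g
  simp only [h.even] at this
  rw [primitive, primitive, this, neg_zero, intervalIntegral.integral_symm]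

theorem IsAmplitudeKernel.primitive_add_pi (h : IsAmplitudeKernel g) (x : ℝ) :
    primitive g (x + Real.pi) = primitive g x + 2 * primitive g (Real.pi / 2) := by
  have h1 := h.sub_eq x (x + Real.pi)
  rw [h.periodic.intervalIntegral_add_eq x (-(Real.pi / 2)),
    show -(Real.pi / 2) + Real.pi = Real.pi / 2 by ring, ← h.sub_eq, h.primitive_neg] at h1
  linarith

theorem IsAmplitudeKernel.primitive_add_int_mul (h : IsAmplitudeKernel g) (x : ℝ) (n : ℤ) :
    primitive g (x + n * Real.pi) = primitive g x + n * (2 * primitive g (Real.pi / 2)) := by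
  induction n using Int.induction_on with
  | zero => simp
  | succ n ih =>
    have := h.primitive_add_pi (x + n * Real.pi)
    push_cast at ih ⊢
    rw [add_mul, one_mul, ← add_assoc, this, ih]; ring
  | pred n ih =>
    have := h.primitive_add_pi (x + (-n - 1 : ℤ) * Real.pi)
    push_cast at ih this ⊢
    rw [show x + (-(n : ℝ) - 1) * Real.pi + Real.pi = x + -n * Real.pi by ring, ih] at this
    linarith

theorem IsAmplitudeKernel.primitive_pi_div_two_pos (h : IsAmplitudeKernel g) (hm : Measurable g) :
    0 < primitive g (Real.pi / 2) := by
  rw [← primitive_zero (g := g)]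
  exact h.strictMono hm (by have := Real.pi_pos; positivity)

/-- Each half turn adds the same positive amount to the primitive, so it is unbounded in both
directions. -/
theorem IsAmplitudeKernel.surjective (h : IsAmplitudeKernel g) (hm : Measurable g) :
    Function.Surjective (primitive g) := by
  have hc := continuous_primitive_of_integrable h.integrable
  have hK := h.primitive_pi_div_two_pos hm
  intro s
  obtain ⟨n, hn⟩ := exists_nat_ge (|s| / (2 * primitive g (Real.pi / 2)))
  rw [div_le_iff₀ (by positivity)] at hn
  have hup := h.primitive_add_int_mul 0 n
  have hlo := h.primitive_add_int_mul 0 (-n)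
  rw [primitive_zero, zero_add, zero_add] at hup hlo
  push_cast at hup hlo
  have := abs_le.1 hn
  exact mem_range_of_exists_le_of_exists_ge hc ⟨_, by rw [hlo]; linarith [this.1]⟩
    ⟨_, by rw [hup]; exact this.2⟩

theorem IsAmplitudeKernel.primitive_amplitude (h : IsAmplitudeKernel g) (hm : Measurable g)
    (s : ℝ) : primitive g (amplitude g s) = s := by
  obtain ⟨x, hx⟩ := h.surjective hm s
  exact Function.invFunOn_eq ⟨x, mem_univ x, hx⟩

theorem IsAmplitudeKernel.amplitude_primitive (h : IsAmplitudeKernel g) (hm : Measurable g)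
    (x : ℝ) : amplitude g (primitive g x) = x :=
  (h.strictMono hm).injective (h.primitive_amplitude hm _)

theorem IsAmplitudeKernel.strictMono_amplitude (h : IsAmplitudeKernel g) (hm : Measurable g) :
    StrictMono (amplitude g) := by
  intro a b hab
  rw [← (h.strictMono hm).lt_iff_lt, h.primitive_amplitude hm, h.primitive_amplitude hm]
  exact hab

theorem IsAmplitudeKernel.continuous_amplitude (h : IsAmplitudeKernel g) (hm : Measurable g) :
    Continuous (amplitude g) :=
  (h.strictMono_amplitude hm).monotone.continuous_of_surjective
    fun x => ⟨_, h.amplitude_primitive hm x⟩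

theorem IsAmplitudeKernel.hasDerivAt_amplitude (h : IsAmplitudeKernel g) (hm : Measurable g)
    {s : ℝ} (hs : ContinuousAt g (amplitude g s)) (hpos : 0 < g (amplitude g s)) :
    HasDerivAt (amplitude g) (g (amplitude g s))⁻¹ s :=
  HasDerivAt.of_local_left_inverse (h.continuous_amplitude hm).continuousAt
    (hasDerivAt_primitive h.integrable hm hs) hpos.ne'
    (Eventually.of_forall (h.primitive_amplitude hm))

theorem IsAmplitudeKernel.countable_cos_amplitude (h : IsAmplitudeKernel g) (hm : Measurable g) :
    {s | Real.cos (amplitude g s) = 0}.Countable :=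
  countable_cos_eq_zero.preimage (h.strictMono_amplitude hm).injective

end Kernel

/-! ### The kernels of the integrals of the first kind -/

/-- The integrand of `F1`. -/
def kernel1 (p q θ : ℝ) : ℝ :=
  |Real.cos θ| ^ (1 - 2 / p) / Real.sqrt (1 - q ^ 2 * Real.sin θ ^ 2)

/-- The integrand of `F2`. -/
def kernel2 (p q θ : ℝ) : ℝ := 1 / (1 - q ^ 2 * Real.sin θ ^ 2) ^ (1 / p)

/-- The integrand of `E1`. -/
def kernelE1 (p q θ : ℝ) : ℝ :=
  Real.sqrt (1 - q ^ 2 * Real.sin θ ^ 2) * |Real.cos θ| ^ (1 - 2 / p)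

theorem measurable_kernel1 (p q : ℝ) : Measurable (kernel1 p q) := by
  unfold kernel1; fun_prop

theorem measurable_kernel2 (p q : ℝ) : Measurable (kernel2 p q) := by
  unfold kernel2; fun_prop

theorem measurable_kernelE1 (p q : ℝ) : Measurable (kernelE1 p q) := by
  unfold kernelE1; fun_prop

theorem one_sub_sq_mul_sin_sq_pos {q : ℝ} (hq0 : 0 ≤ q) (hq1 : q < 1) (θ : ℝ) :
    0 < 1 - q ^ 2 * Real.sin θ ^ 2 := by
  have h1 : q ^ 2 < 1 := by nlinarith
  nlinarith [Real.sin_sq_le_one θ, sq_nonneg (Real.sin θ), sq_nonneg q]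

theorem isAmplitudeKernel_kernel1 {p q : ℝ} (hp : 1 < p) (hq0 : 0 ≤ q) (hq1 : q < 1) :
    IsAmplitudeKernel (kernel1 p q) where
  integrable a b := by
    have h1 := intervalIntegrable_abs_cos_rpow (r := 1 - 2 / p)
      (by have : 2 / p < 2 := by rw [div_lt_iff₀] <;> linarith
          linarith) a b
    have h2 : Continuous fun θ => (Real.sqrt (1 - q ^ 2 * Real.sin θ ^ 2))⁻¹ :=
      Continuous.inv₀ (by fun_prop) fun θ => (Real.sqrt_pos.2 (one_sub_sq_mul_sin_sq_pos hq0 hq1 θ)).ne'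
    exact h1.mul_continuousOn h2.continuousOn
  periodic θ := by simp [kernel1, Real.cos_add_pi, Real.sin_add_pi]
  even θ := by simp [kernel1]
  nonneg θ := by unfold kernel1; positivity
  pos θ h := div_pos (Real.rpow_pos_of_pos (abs_pos.2 h) _)
    (Real.sqrt_pos.2 (one_sub_sq_mul_sin_sq_pos hq0 hq1 θ))
  continuousAt θ h := by
    refine ContinuousAt.div ?_ (by fun_prop) (Real.sqrt_pos.2 (one_sub_sq_mul_sin_sq_pos hq0 hq1 θ)).ne'
    exact ContinuousAt.rpow_const (by fun_prop) (Or.inl (abs_ne_zero.2 h))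

/-- At the zeros of the cosine both sides are zero, by the conventions for division by zero and for
powers of zero. -/
theorem kernel1_one {p : ℝ} (hp : 1 < p) (θ : ℝ) : kernel1 p 1 θ = |Real.cos θ| ^ (-2 / p) := by
  have h1 : Real.sqrt (1 - 1 ^ 2 * Real.sin θ ^ 2) = |Real.cos θ| := by
    rw [← Real.sqrt_sq_eq_abs, Real.cos_sq']; norm_num
  rw [kernel1, h1]
  rcases eq_or_ne (Real.cos θ) 0 with h | h
  · rw [h, abs_zero, div_zero, Real.zero_rpow]
    exact div_ne_zero (by norm_num) (by linarith)
  · rw [show 1 - 2 / p = -2 / p + 1 by ring, Real.rpow_add_one (abs_ne_zero.2 h),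
      mul_div_cancel_right₀ _ (abs_ne_zero.2 h)]

/-- The exponent `-2/p` exceeds `-1` precisely when `p > 2`. -/
theorem isAmplitudeKernel_kernel1_one {p : ℝ} (hp : 2 < p) : IsAmplitudeKernel (kernel1 p 1) := by
  have he : kernel1 p 1 = fun θ => |Real.cos θ| ^ (-2 / p) := funext (kernel1_one (by linarith))
  rw [he]
  refine ⟨fun a b => intervalIntegrable_abs_cos_rpow ?_ a b, fun θ => by simp [Real.cos_add_pi],
    fun θ => by simp, fun θ => by positivity,
    fun θ h => Real.rpow_pos_of_pos (abs_pos.2 h) _, fun θ h => ?_⟩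
  · rw [neg_div, neg_lt_neg_iff, div_lt_one] <;> linarith
  · exact ContinuousAt.rpow_const (by fun_prop) (Or.inl (abs_ne_zero.2 h))

theorem continuous_kernel2 (p : ℝ) {q : ℝ} (hq0 : 0 ≤ q) (hq1 : q < 1) :
    Continuous (kernel2 p q) :=
  continuous_const.div (Continuous.rpow_const (by fun_prop) fun θ =>
    Or.inl (one_sub_sq_mul_sin_sq_pos hq0 hq1 θ).ne')
    fun θ => (Real.rpow_pos_of_pos (one_sub_sq_mul_sin_sq_pos hq0 hq1 θ) _).ne'

theorem kernel2_pos (p : ℝ) {q : ℝ} (hq0 : 0 ≤ q) (hq1 : q < 1) (θ : ℝ) : 0 < kernel2 p q θ :=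
  one_div_pos.2 (Real.rpow_pos_of_pos (one_sub_sq_mul_sin_sq_pos hq0 hq1 θ) _)

theorem isAmplitudeKernel_kernel2 (p : ℝ) {q : ℝ} (hq0 : 0 ≤ q) (hq1 : q < 1) :
    IsAmplitudeKernel (kernel2 p q) where
  integrable a b := (continuous_kernel2 p hq0 hq1).intervalIntegrable a b
  periodic θ := by simp [kernel2, Real.sin_add_pi]
  even θ := by simp [kernel2]
  nonneg θ := (kernel2_pos p hq0 hq1 θ).le
  pos θ _ := kernel2_pos p hq0 hq1 θ
  continuousAt θ _ := (continuous_kernel2 p hq0 hq1).continuousAt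

theorem am1_eq {p q : ℝ} (h : ¬ (q = 1 ∧ p ≤ 2)) (s : ℝ) : am1 p s q = amplitude (kernel1 p q) s := by
  rw [am1, amRange, if_neg h]; rfl

theorem am2_eq {p q : ℝ} (h : ¬ (q = 1 ∧ p ≤ 2)) (s : ℝ) : am2 p s q = amplitude (kernel2 p q) s := by
  rw [am2, amRange, if_neg h]; rfl

theorem K1_eq (p q : ℝ) : K1 p q = primitive (kernel1 p q) (Real.pi / 2) := rfl

theorem E1_eq (p x q : ℝ) : E1 p x q = primitive (kernelE1 p q) x := rfl

theorem cnp_eq (p s q : ℝ) : cnp p s q = spow (2 / p) (Real.cos (am1 p s q)) := rfl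

theorem isAmplitudeKernel_kernelE1 {p q : ℝ} (hp : 1 < p) (hq0 : 0 ≤ q) (hq1 : q < 1) :
    IsAmplitudeKernel (kernelE1 p q) where
  integrable a b := by
    have h1 := intervalIntegrable_abs_cos_rpow (r := 1 - 2 / p)
      (by have : 2 / p < 2 := by rw [div_lt_iff₀] <;> linarith
          linarith) a b
    have h2 : Continuous fun θ => Real.sqrt (1 - q ^ 2 * Real.sin θ ^ 2) := by fun_prop
    exact h1.continuousOn_mul h2.continuousOn
  periodic θ := by simp [kernelE1, Real.cos_add_pi, Real.sin_add_pi]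
  even θ := by simp [kernelE1]
  nonneg θ := by unfold kernelE1; positivity
  pos θ h := mul_pos (Real.sqrt_pos.2 (one_sub_sq_mul_sin_sq_pos hq0 hq1 θ))
    (Real.rpow_pos_of_pos (abs_pos.2 h) _)
  continuousAt θ h := by
    refine ContinuousAt.mul (by fun_prop) ?_
    exact ContinuousAt.rpow_const (by fun_prop) (Or.inl (abs_ne_zero.2 h))

theorem hasDerivAt_spow (r : ℝ) {z : ℝ} (hz : z ≠ 0) : HasDerivAt (spow r) (r * |z| ^ (r - 1)) z := by
  have key : ∀ w : ℝ, 0 < w → HasDerivAt (spow r) (r * |w| ^ (r - 1)) w := by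
    intro w hw
    rw [abs_of_pos hw]
    refine (Real.hasDerivAt_rpow_const (p := r) (Or.inl hw.ne')).congr_of_eventuallyEq ?_
    filter_upwards [lt_mem_nhds hw] with v hv
    exact spow_of_pos hv
  rcases lt_or_gt_of_ne hz with h | h
  · have h1 := (key (-z) (neg_pos.2 h)).comp z (hasDerivAt_neg z)
    have h2 := h1.neg
    rw [abs_neg] at h2
    refine (h2.congr_of_eventuallyEq (Eventually.of_forall fun v => ?_)).congr_deriv (by ring)
    simp [spow_neg]
  · exact key z h

/-! ### The wavelike model curve -/

section Wave

variable {p q : ℝ}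

theorem not_degenerate_of_lt_one (hq1 : q < 1) : ¬ (q = 1 ∧ p ≤ 2) := fun h => hq1.ne h.1

theorem continuous_am1 (hp : 1 < p) (hq0 : 0 ≤ q) (hq1 : q < 1) :
    Continuous fun s => am1 p s q := by
  simp only [am1_eq (not_degenerate_of_lt_one hq1)]
  exact (isAmplitudeKernel_kernel1 hp hq0 hq1).continuous_amplitude (measurable_kernel1 p q)

theorem hasDerivAt_am1 (hp : 1 < p) (hq0 : 0 ≤ q) (hq1 : q < 1) {s : ℝ}
    (hs : Real.cos (am1 p s q) ≠ 0) :
    HasDerivAt (fun s => am1 p s q) (kernel1 p q (am1 p s q))⁻¹ s := by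
  have hk := isAmplitudeKernel_kernel1 hp hq0 hq1
  simp only [am1_eq (not_degenerate_of_lt_one hq1)] at hs ⊢
  exact hk.hasDerivAt_amplitude (measurable_kernel1 p q) (hk.continuousAt _ hs) (hk.pos _ hs)

theorem countable_cos_am1 (hp : 1 < p) (hq0 : 0 ≤ q) (hq1 : q < 1) :
    {s | Real.cos (am1 p s q) = 0}.Countable := by
  simp only [am1_eq (not_degenerate_of_lt_one hq1)]
  exact (isAmplitudeKernel_kernel1 hp hq0 hq1).countable_cos_amplitude (measurable_kernel1 p q)

/-- The sine of half the tangential angle of the wavelike curve. -/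
def waveSin (p q s : ℝ) : ℝ := q * Real.sin (am1 p s q)

/-- The cosine of half the tangential angle of the wavelike curve. -/
def waveCos (p q s : ℝ) : ℝ := Real.sqrt (1 - q ^ 2 * Real.sin (am1 p s q) ^ 2)

theorem waveCos_pos (hq0 : 0 ≤ q) (hq1 : q < 1) (s : ℝ) : 0 < waveCos p q s :=
  Real.sqrt_pos.2 (one_sub_sq_mul_sin_sq_pos hq0 hq1 _)

theorem waveCos_sq (hq0 : 0 ≤ q) (hq1 : q < 1) (s : ℝ) :
    waveCos p q s ^ 2 = 1 - waveSin p q s ^ 2 := by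
  rw [waveCos, Real.sq_sqrt (one_sub_sq_mul_sin_sq_pos hq0 hq1 _).le, waveSin]; ring

theorem continuous_cnp (hp : 1 < p) (hq0 : 0 ≤ q) (hq1 : q < 1) :
    Continuous fun s => cnp p s q :=
  (continuous_spow (by positivity)).comp (Real.continuous_cos.comp (continuous_am1 hp hq0 hq1))

theorem continuous_waveSin (hp : 1 < p) (hq0 : 0 ≤ q) (hq1 : q < 1) : Continuous (waveSin p q) :=
  continuous_const.mul (Real.continuous_sin.comp (continuous_am1 hp hq0 hq1))

theorem continuous_waveCos (hp : 1 < p) (hq0 : 0 ≤ q) (hq1 : q < 1) : Continuous (waveCos p q) := by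
  have := continuous_am1 hp hq0 hq1
  unfold waveCos
  fun_prop

theorem inv_kernel1_am1 (p q s : ℝ) :
    (kernel1 p q (am1 p s q))⁻¹ = waveCos p q s * |Real.cos (am1 p s q)| ^ (2 / p - 1) := by
  rw [kernel1, inv_div, waveCos, div_eq_mul_inv, ← Real.rpow_neg (abs_nonneg _), neg_sub]

/-- The derivative of the amplitude contains `|cos|^(2/p-1)`, which is singular at the zeros of the
cosine if `p > 2`; the extra factor `cos` from differentiating the sine turns it into the continuous
function `cnp`. -/
theorem hasDerivAt_waveSin (hp : 1 < p) (hq0 : 0 ≤ q) (hq1 : q < 1) (s : ℝ) :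
    HasDerivAt (waveSin p q) (q * cnp p s q * waveCos p q s) s := by
  refine hasDerivAt_of_off_countable (g := fun s => q * cnp p s q * waveCos p q s)
    (countable_cos_am1 hp hq0 hq1) (continuous_waveSin hp hq0 hq1)
    ((continuous_const.mul (continuous_cnp hp hq0 hq1)).mul (continuous_waveCos hp hq0 hq1))
    (fun s hs => ?_) s
  refine ((hasDerivAt_am1 hp hq0 hq1 hs).sin.const_mul q).congr_deriv ?_
  rw [inv_kernel1_am1, cnp]
  ring

theorem hasDerivAt_waveCos (hp : 1 < p) (hq0 : 0 ≤ q) (hq1 : q < 1) (s : ℝ) :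
    HasDerivAt (waveCos p q) (-(q * cnp p s q * waveSin p q s)) s := by
  have h1 := hasDerivAt_waveSin hp hq0 hq1 s
  have h2 := waveCos_pos (p := p) hq0 hq1 s
  have e : waveCos p q = fun s => Real.sqrt (1 - waveSin p q s ^ 2) := by
    ext s; rw [← waveCos_sq hq0 hq1, Real.sqrt_sq (waveCos_pos hq0 hq1 s).le]
  have h3 : 1 - waveSin p q s ^ 2 ≠ 0 := by rw [← waveCos_sq hq0 hq1]; positivity
  have h4 := ((h1.fun_pow 2).const_sub 1).sqrt h3
  rw [e]
  refine h4.congr_deriv ?_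
  have e' : Real.sqrt (1 - waveSin p q s ^ 2) = waveCos p q s := (congrFun e s).symm
  rw [e']
  field_simp
  norm_num
  ring

/-- The unit tangent of the wavelike curve. -/
def waveTangent (p q s : ℝ) : Plane :=
  !₂[1 - 2 * waveSin p q s ^ 2, 2 * waveSin p q s * waveCos p q s]

theorem gammaWave_snd (hp : 1 < p) (s : ℝ) :
    gammaWave p q s 1 = -(q * (p / (p - 1)) * spow (2 - 2 / p) (Real.cos (am1 p s q))) := by
  have h1 : |cnp p s q| ^ (p - 2) * cnp p s q = spow (p - 1) (cnp p s q) := by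
    rw [spow]; congr 2; ring
  simp only [gammaWave, h1]
  rw [cnp_eq, spow_spow]
  have : 2 / p * (p - 1) = 2 - 2 / p := by field_simp
  simp [this]

/-- The tangent is `(cos θ, sin θ)` with `sin (θ/2) = q sin am`. In both coordinates the powers of
`|cos am|` cancel where the cosine does not vanish, and the resulting formula is continuous. -/
theorem hasDerivAt_gammaWave (hp : 1 < p) (hq0 : 0 ≤ q) (hq1 : q < 1) (s : ℝ) :
    HasDerivAt (gammaWave p q) (waveTangent p q s) s := by
  have hS := continuous_waveSin hp hq0 hq1
  have hC := continuous_waveCos hp hq0 hq1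
  have ham := continuous_am1 hp hq0 hq1
  have hE := isAmplitudeKernel_kernelE1 hp hq0 hq1
  have hr : 0 < 2 - 2 / p := by
    have : 2 / p < 2 := by rw [div_lt_iff₀] <;> linarith
    linarith
  rw [hasDerivAt_plane_iff]
  constructor
  · have h0 : (fun s => gammaWave p q s 0) = fun s => 2 * primitive (kernelE1 p q) (am1 p s q) - s := by
      ext s; simp [gammaWave, E1_eq]
    have h0' : waveTangent p q s 0 = 1 - 2 * waveSin p q s ^ 2 := by simp [waveTangent]
    rw [h0, h0']
    refine hasDerivAt_of_off_countable (g := fun s => 1 - 2 * waveSin p q s ^ 2)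
      (countable_cos_am1 hp hq0 hq1) ?_ (by fun_prop) (fun s hs => ?_) s
    · exact (continuous_const.mul ((continuous_primitive_of_integrable hE.integrable).comp ham)).sub
        continuous_id
    · have h1 := (hE.hasDerivAt (measurable_kernelE1 p q) hs).comp s (hasDerivAt_am1 hp hq0 hq1 hs)
      refine ((h1.const_mul 2).sub (hasDerivAt_id s)).congr_deriv ?_
      have hcs : 0 < |Real.cos (am1 p s q)| := abs_pos.2 hs
      have e1 : kernelE1 p q (am1 p s q) * (kernel1 p q (am1 p s q))⁻¹ = waveCos p q s ^ 2 := by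
        rw [inv_kernel1_am1, kernelE1, ← waveCos]
        have : |Real.cos (am1 p s q)| ^ (1 - 2 / p) * |Real.cos (am1 p s q)| ^ (2 / p - 1) = 1 := by
          rw [← Real.rpow_add hcs]; norm_num
        linear_combination waveCos p q s ^ 2 * this
      rw [e1, waveCos_sq hq0 hq1]; ring
  · have h0 : (fun s => gammaWave p q s 1)
        = fun s => -(q * (p / (p - 1)) * spow (2 - 2 / p) (Real.cos (am1 p s q))) :=
      funext fun s => gammaWave_snd hp s
    have h0' : waveTangent p q s 1 = 2 * waveSin p q s * waveCos p q s := by simp [waveTangent]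
    rw [h0, h0']
    refine hasDerivAt_of_off_countable (g := fun s => 2 * waveSin p q s * waveCos p q s)
      (countable_cos_am1 hp hq0 hq1) ?_ (by fun_prop) (fun s hs => ?_) s
    · exact (continuous_const.mul ((continuous_spow hr).comp (Real.continuous_cos.comp ham))).neg
    · have h1 := (hasDerivAt_spow (2 - 2 / p) hs).comp s (hasDerivAt_am1 hp hq0 hq1 hs).cos
      refine ((h1.const_mul (q * (p / (p - 1)))).neg).congr_deriv ?_
      have hcs : 0 < |Real.cos (am1 p s q)| := abs_pos.2 hs
      rw [inv_kernel1_am1, waveSin]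
      have : |Real.cos (am1 p s q)| ^ (2 - 2 / p - 1) * |Real.cos (am1 p s q)| ^ (2 / p - 1) = 1 := by
        rw [← Real.rpow_add hcs, show 2 - 2 / p - 1 + (2 / p - 1) = 0 by ring, Real.rpow_zero]
      have hp1 : p - 1 ≠ 0 := by linarith
      have hp0 : p ≠ 0 := by linarith
      have e2 : p / (p - 1) * (2 - 2 / p) = 2 := by field_simp
      linear_combination (q * Real.sin (am1 p s q) * waveCos p q s * (p / (p - 1) * (2 - 2 / p))) * this
        + q * Real.sin (am1 p s q) * waveCos p q s * e2

theorem norm_waveTangent (hq0 : 0 ≤ q) (hq1 : q < 1) (s : ℝ) : ‖waveTangent p q s‖ = 1 := by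
  rw [plane_norm, Real.sqrt_eq_one]
  have := waveCos_sq (p := p) hq0 hq1 s
  simp only [waveTangent, PiLp.toLp_apply, Matrix.cons_val_zero, Matrix.cons_val_one]
  rw [mul_pow, mul_pow, this]; ring

/-- Frenet's equations: the curvature of the wavelike curve is `2 q cn_p`. -/
theorem hasDerivAt_waveTangent (hp : 1 < p) (hq0 : 0 ≤ q) (hq1 : q < 1) (s : ℝ) :
    HasDerivAt (fun s => waveTangent p q s 0) (-(2 * q * cnp p s q * waveTangent p q s 1)) s ∧
    HasDerivAt (fun s => waveTangent p q s 1) (2 * q * cnp p s q * waveTangent p q s 0) s := by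
  have h1 := hasDerivAt_waveSin hp hq0 hq1 s
  have h2 := hasDerivAt_waveCos hp hq0 hq1 s
  have h3 := waveCos_sq (p := p) hq0 hq1 s
  simp only [waveTangent, PiLp.toLp_apply, Matrix.cons_val_zero, Matrix.cons_val_one]
  constructor
  · refine (((h1.fun_pow 2).const_mul 2).const_sub 1).congr_deriv ?_
    norm_num
    ring
  · refine ((h1.const_mul 2).fun_mul h2).congr_deriv ?_
    linear_combination 2 * q * cnp p s q * h3

/-- The affine curvature condition for the wavelike curve, with the height alone on the right-hand
side. -/
theorem spow_wave_curvature (hp : 1 < p) (hq0 : 0 < q) (s : ℝ) :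
    spow (p - 1) (2 * q * cnp p s q)
      = -((2 * q) ^ (p - 1) * ((p - 1) / (q * p))) * gammaWave p q s 1 := by
  have hp1 : p - 1 ≠ 0 := by linarith
  have hp0 : p ≠ 0 := by linarith
  rw [spow_mul, spow_of_pos (by positivity), gammaWave_snd hp, cnp_eq, spow_spow]
  have : 2 / p * (p - 1) = 2 - 2 / p := by field_simp
  rw [this]
  field_simp

end Wave

/-! ### Isometries of the plane -/

/-- Norm preservation on `e₀`, `e₁` and `e₀ + e₁` makes the columns orthonormal; `δ` is the
determinant. -/
theorem exists_coeff_of_isometry (A : Plane ≃ₗᵢ[ℝ] Plane) :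
    ∃ a b δ : ℝ, a ^ 2 + b ^ 2 = 1 ∧ (δ = 1 ∨ δ = -1) ∧
      ∀ z : Plane, A z 0 = a * z 0 - δ * b * z 1 ∧ A z 1 = b * z 0 + δ * a * z 1 := by
  set e₀ : Plane := !₂[1, 0]
  set e₁ : Plane := !₂[0, 1]
  have hsq : ∀ z : Plane, A z 0 ^ 2 + A z 1 ^ 2 = z 0 ^ 2 + z 1 ^ 2 := by
    intro z
    have := A.norm_map z
    rw [plane_norm, plane_norm, Real.sqrt_inj (by positivity) (by positivity)] at this
    exact this
  have hz : ∀ z : Plane, A z = z 0 • A e₀ + z 1 • A e₁ := by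
    intro z
    rw [← map_smul, ← map_smul, ← map_add]
    congr 1
    ext i; fin_cases i <;> simp [e₀, e₁]
  have h0 := hsq e₀
  have h1 := hsq e₁
  have h2 := hsq (e₀ + e₁)
  rw [map_add] at h2
  simp only [PiLp.add_apply] at h2
  simp only [e₀, e₁, Matrix.cons_val_zero, Matrix.cons_val_one] at h0 h1 h2
  change A e₀ 0 ^ 2 + A e₀ 1 ^ 2 = _ at h0
  change A e₁ 0 ^ 2 + A e₁ 1 ^ 2 = _ at h1
  change (A e₀ 0 + A e₁ 0) ^ 2 + (A e₀ 1 + A e₁ 1) ^ 2 = _ at h2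
  set a := A e₀ 0
  set b := A e₀ 1
  set c := A e₁ 0
  set d := A e₁ 1
  have horth : a * c + b * d = 0 := by linarith
  have hδ : (a * d - b * c) ^ 2 = 1 := by nlinarith
  refine ⟨a, b, a * d - b * c, by linarith, sq_eq_one_iff.1 hδ, fun z => ?_⟩
  rw [hz z]
  simp only [PiLp.add_apply, PiLp.smul_apply, smul_eq_mul]
  constructor
  · linear_combination (-z 1 * c) * h0 + z 1 * a * horth
  · linear_combination (-z 1 * d) * h0 + z 1 * b * horth

/-- The isometry with first column `(a, b)` and second column `δ (-b, a)`. -/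
theorem exists_isometry {a b δ : ℝ} (h : a ^ 2 + b ^ 2 = 1) (hδ : δ = 1 ∨ δ = -1) :
    ∃ A : Plane ≃ₗᵢ[ℝ] Plane, ∀ z : Plane,
      A z = !₂[a * z 0 - δ * b * z 1, b * z 0 + δ * a * z 1] := by
  have hδ2 : δ ^ 2 = 1 := by rcases hδ with h | h <;> rw [h] <;> norm_num
  let f : Plane →ₗ[ℝ] Plane :=
    { toFun := fun z => !₂[a * z 0 - δ * b * z 1, b * z 0 + δ * a * z 1]
      map_add' := fun z w => by
        ext i; fin_cases i <;> simp <;> ring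
      map_smul' := fun c z => by
        ext i; fin_cases i <;> simp <;> ring }
  have hf : ∀ z, ‖f z‖ = ‖z‖ := by
    intro z
    rw [plane_norm, plane_norm]
    congr 1
    simp only [f, LinearMap.coe_mk, AddHom.coe_mk, PiLp.toLp_apply, Matrix.cons_val_zero,
      Matrix.cons_val_one]
    linear_combination (z 0 ^ 2 + δ ^ 2 * z 1 ^ 2) * h + z 1 ^ 2 * hδ2
  exact ⟨(⟨f, hf⟩ : Plane →ₗᵢ[ℝ] Plane).toLinearIsometryEquiv rfl, fun z => rfl⟩

/-! ### Models of elasticae -/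

section Repr

variable {p : ℝ} {γ : ℝ → Plane} {x y : ℝ → ℝ}

/-- A curve represented by a model whose curvature is an affine function of position, up to the
power `p - 1`, is a `p`-elastica. -/
theorem IsRegularRepr.isPElastica_of_isRepresentedBy (hp : 1 < p) (himm : IsImmersedW2p p γ)
    (h : IsRegularRepr p γ x y) {c T : ℝ → Plane} {k : ℝ → ℝ} {ℓ C c₀ c₁ : ℝ}
    (hrep : IsRepresentedBy γ c ℓ) (hc : ∀ s, HasDerivAt c (T s) s) (hT : ∀ s, ‖T s‖ = 1)
    (hT0 : ∀ s, HasDerivAt (fun s => T s 0) (-(k s * T s 1)) s)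
    (hT1 : ∀ s, HasDerivAt (fun s => T s 1) (k s * T s 0) s)
    (hk : ∀ s, spow (p - 1) (k s) = C + c₀ * c s 0 + c₁ * c s 1) : IsPElastica p γ := by
  obtain ⟨r, A, v, φ, hr, -, -, -, H⟩ := h.exists_of_isRepresentedBy hrep
    (fun s _ => (hc s).hasDerivWithinAt) (fun s _ => hT s)
  obtain ⟨a, b, δ, hab, hδ, hA⟩ := exists_coeff_of_isometry A
  rw [isPElastica_iff_hasAffineCurvature hp himm h]
  have hδ2 : δ ^ 2 = 1 := by rcases hδ with h | h <;> rw [h] <;> norm_num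
  have hφd : ∀ t ∈ Ioo (0 : ℝ) 1, HasDerivAt φ (speed x y t / r) t := fun t ht =>
    ((H t (Ioo_subset_Icc_self ht)).2.2.1).hasDerivAt (Icc_mem_nhds ht.1 ht.2)
  set m := spow (p - 1) (δ / r) with hm
  have key : ∃ C' c₀' c₁' : ℝ, ∀ t ∈ Ioo (0 : ℝ) 1,
      C' + c₀' * x t + c₁' * y t = spow (p - 1) (δ * k (φ t) / r) := by
    -- Obtained by solving `γ = r A c + v` for the model point, the inverse of the isometry being
    -- its transpose, and inserting it into the affine relation. The curvature itself is multiplied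
    -- by `δ / r`.
    refine ⟨m * (C - c₀ * (a * v 0 + b * v 1) / r - c₁ * δ * (-b * v 0 + a * v 1) / r),
      m * (c₀ * a - c₁ * δ * b) / r, m * (c₀ * b + c₁ * δ * a) / r, fun t ht => ?_⟩
    obtain ⟨-, hγ, -, -⟩ := H t (Ioo_subset_Icc_self ht)
    have e0 := h.eq_fst t (Ioo_subset_Icc_self ht)
    have e1 := h.eq_snd t (Ioo_subset_Icc_self ht)
    rw [hγ] at e0 e1
    simp only [PiLp.add_apply, PiLp.smul_apply, smul_eq_mul] at e0 e1
    rw [(hA _).1] at e0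
    rw [(hA _).2] at e1
    rw [mul_div_right_comm δ, spow_mul, hk, ← hm, ← e0, ← e1]
    field_simp
    linear_combination (m * c₀ * r * c (φ t) 0 + m * c₁ * r * δ ^ 2 * c (φ t) 1) * hab
      + m * c₁ * r * c (φ t) 1 * hδ2
  obtain ⟨C', c₀', c₁', hkey⟩ := key
  refine ⟨C', c₀', c₁', ⟨fun t ht => ?_, fun t ht => ?_⟩⟩
  all_goals
    have htan : ∀ s ∈ Ioo (0 : ℝ) 1, tanX x y s = a * T (φ s) 0 - δ * b * T (φ s) 1 ∧
        tanY x y s = b * T (φ s) 0 + δ * a * T (φ s) 1 := by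
      intro s hs
      have := (H s (Ioo_subset_Icc_self hs)).2.2.2
      rw [← (hA _).1, ← (hA _).2, ← this]
      simp [unitTangent]
    have d0 := (hT0 (φ t)).comp t (hφd t ht)
    have d1 := (hT1 (φ t)).comp t (hφd t ht)
    rw [hkey t ht, spow_spow_inv hp]
  · refine ((d0.const_mul a).sub (d1.const_mul (δ * b))).congr_of_eventuallyEq ?_ |>.congr_deriv ?_
    · filter_upwards [isOpen_Ioo.mem_nhds ht] with s hs
      exact (htan s hs).1
    · rw [← h.speed_mul_tanY, (htan t ht).2]
      linear_combination (k (φ t) * (speed x y t / r) * a * T (φ t) 1) * hδ2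
  · refine ((d0.const_mul b).add (d1.const_mul (δ * a))).congr_of_eventuallyEq ?_ |>.congr_deriv ?_
    · filter_upwards [isOpen_Ioo.mem_nhds ht] with s hs
      exact (htan s hs).2
    · rw [← h.speed_mul_tanX, (htan t ht).1]
      linear_combination (k (φ t) * (speed x y t / r) * b * T (φ t) 1) * hδ2

end Repr

/-! ### The modulus of the figure-eight -/

section Modulus

variable {p : ℝ}

theorem cos_pos_of_mem_Ioo {θ : ℝ} (h : θ ∈ Ioo 0 (Real.pi / 2)) : 0 < Real.cos θ :=
  Real.cos_pos_of_mem_Ioo ⟨by linarith [h.1, Real.pi_pos], h.2⟩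

theorem sin_pos_of_mem_Ioo_half {θ : ℝ} (h : θ ∈ Ioo 0 (Real.pi / 2)) : 0 < Real.sin θ :=
  Real.sin_pos_of_pos_of_lt_pi h.1 (by linarith [h.2, Real.pi_pos])

theorem one_sub_pos_of_cos {q θ : ℝ} (hq0 : 0 ≤ q) (hq1 : q ≤ 1) (hθ : Real.cos θ ≠ 0) :
    0 < 1 - q ^ 2 * Real.sin θ ^ 2 := by
  have h1 : 0 < Real.cos θ ^ 2 := by positivity
  rw [Real.cos_sq'] at h1
  have h2 : q ^ 2 ≤ 1 := by nlinarith
  nlinarith [sq_nonneg (Real.sin θ)]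

theorem kernel1_mono {q q' θ : ℝ} (hq : 0 ≤ q) (hqq : q ≤ q') (hq' : q' ≤ 1)
    (hθ : Real.cos θ ≠ 0) : kernel1 p q θ ≤ kernel1 p q' θ := by
  have h1 := one_sub_pos_of_cos (hq.trans hqq) hq' hθ
  unfold kernel1
  refine div_le_div_of_nonneg_left (by positivity) (Real.sqrt_pos.2 h1) (Real.sqrt_le_sqrt ?_)
  have : q ^ 2 ≤ q' ^ 2 := by gcongr
  nlinarith [sq_nonneg (Real.sin θ)]

theorem kernel1_strictMono {q q' θ : ℝ} (hq : 0 ≤ q) (hqq : q < q') (hq' : q' ≤ 1)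
    (hθ : θ ∈ Ioo 0 (Real.pi / 2)) : kernel1 p q θ < kernel1 p q' θ := by
  have hc := cos_pos_of_mem_Ioo hθ
  have hs := sin_pos_of_mem_Ioo_half hθ
  have h1 := one_sub_pos_of_cos (hq.trans hqq.le) hq' hc.ne'
  unfold kernel1
  refine div_lt_div_of_pos_left (Real.rpow_pos_of_pos (abs_pos.2 hc.ne') _) (Real.sqrt_pos.2 h1)
    (Real.sqrt_lt_sqrt h1.le ?_)
  have : q ^ 2 < q' ^ 2 := by gcongr
  have := mul_lt_mul_of_pos_right this (pow_pos hs 2)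
  linarith

theorem kernelE1_anti {q q' θ : ℝ} (hq : 0 ≤ q) (hqq : q ≤ q') :
    kernelE1 p q' θ ≤ kernelE1 p q θ := by
  unfold kernelE1
  refine mul_le_mul_of_nonneg_right (Real.sqrt_le_sqrt ?_) (by positivity)
  have : q ^ 2 ≤ q' ^ 2 := by gcongr
  nlinarith [sq_nonneg (Real.sin θ)]

theorem intervalIntegrable_kernelE1 (hp : 1 < p) (q a b : ℝ) :
    IntervalIntegrable (kernelE1 p q) volume a b := by
  have h1 := intervalIntegrable_abs_cos_rpow (r := 1 - 2 / p)
    (by have : 2 / p < 2 := by rw [div_lt_iff₀] <;> linarith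
        linarith) a b
  have h2 : Continuous fun θ => Real.sqrt (1 - q ^ 2 * Real.sin θ ^ 2) := by fun_prop
  exact h1.continuousOn_mul h2.continuousOn

theorem K1_pos (hp : 1 < p) {q : ℝ} (hq0 : 0 ≤ q) (hq1 : q < 1) : 0 < K1 p q :=
  (isAmplitudeKernel_kernel1 hp hq0 hq1).primitive_pi_div_two_pos (measurable_kernel1 p q)

theorem K1_strictMono (hp : 1 < p) {q q' : ℝ} (hq : 0 ≤ q) (hqq : q < q') (hq' : q' < 1) :
    K1 p q < K1 p q' := by
  have i1 := (isAmplitudeKernel_kernel1 hp hq (hqq.trans hq')).integrable 0 (Real.pi / 2)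
  have i2 := (isAmplitudeKernel_kernel1 hp (hq.trans hqq.le) hq').integrable 0 (Real.pi / 2)
  have := intervalIntegral.intervalIntegral_pos_of_pos_on (i2.sub i1)
    (fun θ hθ => sub_pos.2 (kernel1_strictMono hq hqq hq'.le hθ)) (by linarith [Real.pi_pos])
  rw [intervalIntegral.integral_sub i2 i1] at this
  exact sub_pos.1 this

theorem E1c_anti (hp : 1 < p) {q q' : ℝ} (hq : 0 ≤ q) (hqq : q ≤ q') :
    E1c p q' ≤ E1c p q :=
  intervalIntegral.integral_mono_on (by linarith [Real.pi_pos])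
    (intervalIntegrable_kernelE1 hp q' _ _) (intervalIntegrable_kernelE1 hp q _ _)
    fun _ _ => kernelE1_anti hq hqq

theorem isFigureEightModulus_iff (hp : 1 < p) {q : ℝ} :
    IsFigureEightModulus p q ↔ q ∈ Ioo (0 : ℝ) 1 ∧ 2 * E1c p q = K1 p q := by
  refine and_congr_right fun hq => ?_
  have := K1_pos hp hq.1.le hq.2
  rw [← mul_div_assoc, sub_eq_zero, div_eq_one_iff_eq this.ne']

/-- As `q` grows, `2E` does not increase whereas `K` strictly increases. -/
theorem IsFigureEightModulus.unique (hp : 1 < p) {q q' : ℝ} (h : IsFigureEightModulus p q)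
    (h' : IsFigureEightModulus p q') : q = q' := by
  rw [isFigureEightModulus_iff hp] at h h'
  rcases lt_trichotomy q q' with hlt | heq | hlt
  · have h1 := K1_strictMono hp h.1.1.le hlt h'.1.2
    have h2 := E1c_anti hp h.1.1.le hlt.le
    linarith [h.2, h'.2]
  · exact heq
  · have h1 := K1_strictMono hp h'.1.1.le hlt h.1.2
    have h2 := E1c_anti hp h'.1.1.le hlt.le
    linarith [h.2, h'.2]

/-- Intermediate value theorem for `2E - K`, which is positive at `q = 0` because `E = K` there.
Continuity on `[0, q₁]` follows by domination with the kernels at `q₁` and at `0`; this only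
requires integrability at `q₁`, so `q₁ = 1` is admissible when `p > 2`. -/
theorem exists_isFigureEightModulus_of_lt (hp : 1 < p) {q₁ : ℝ} (hq0 : 0 < q₁) (hq1 : q₁ ≤ 1)
    (hint : IntervalIntegrable (kernel1 p q₁) volume 0 (Real.pi / 2))
    (hlt : 2 * E1c p q₁ < K1 p q₁) : ∃ q, IsFigureEightModulus p q := by
  have hpi := Real.pi_pos
  have hae : ∀ᵐ θ : ℝ, Real.cos θ ≠ 0 := countable_cos_eq_zero.ae_notMem volume
  have hK : ContinuousOn (K1 p) (Icc 0 q₁) := by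
    intro q hq
    refine intervalIntegral.continuousWithinAt_of_dominated_interval (bound := kernel1 p q₁)
      (F := fun q θ => kernel1 p q θ)
      (Eventually.of_forall fun r => (measurable_kernel1 p r).aestronglyMeasurable) ?_ hint ?_
    · filter_upwards [self_mem_nhdsWithin] with r hr
      filter_upwards [hae] with θ hθ _
      rw [Real.norm_of_nonneg (by unfold kernel1; positivity)]
      exact kernel1_mono hr.1 hr.2 hq1 hθ
    · filter_upwards [hae] with θ hθ _
      have := one_sub_pos_of_cos hq.1 (hq.2.trans hq1) hθ
      refine ContinuousAt.continuousWithinAt (ContinuousAt.div continuousAt_const (by fun_prop) ?_)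
      exact (Real.sqrt_pos.2 this).ne'
  have hE : ContinuousOn (E1c p) (Icc 0 q₁) := by
    intro q hq
    refine intervalIntegral.continuousWithinAt_of_dominated_interval (bound := kernelE1 p 0)
      (F := fun q θ => kernelE1 p q θ)
      (Eventually.of_forall fun r => (measurable_kernelE1 p r).aestronglyMeasurable) ?_
      (intervalIntegrable_kernelE1 hp 0 _ _) ?_
    · filter_upwards [self_mem_nhdsWithin] with r hr
      refine Eventually.of_forall fun θ _ => ?_
      rw [Real.norm_of_nonneg (by unfold kernelE1; positivity)]
      exact kernelE1_anti le_rfl hr.1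
    · refine Eventually.of_forall fun θ _ => ContinuousAt.continuousWithinAt ?_
      unfold kernelE1
      fun_prop
  have h0 : 0 < 2 * E1c p 0 - K1 p 0 := by
    have e : E1c p 0 = K1 p 0 := by
      unfold E1c K1 E1 F1; simp
    have := K1_pos hp le_rfl zero_lt_one
    rw [e]; linarith
  have hG : ContinuousOn (fun q => 2 * E1c p q - K1 p q) (Icc 0 q₁) :=
    (continuousOn_const.mul hE).sub hK
  obtain ⟨q, hq, hq'⟩ := intermediate_value_Ioo' hq0.le hG ⟨by linarith, h0⟩
  refine ⟨q, (isFigureEightModulus_iff hp).2 ⟨⟨hq.1, hq.2.trans_le hq1⟩, ?_⟩⟩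
  simp only at hq'
  linarith

/-- With `r = 1 - 2/p`, integrating the derivative of `sin · cos^r` over a quarter turn gives `(1 +
r) E = r K`, since the boundary values vanish. As `0 < r < 1`, this yields `2E < K`. -/
theorem two_mul_E1c_one_lt (hp : 2 < p) : 2 * E1c p 1 < K1 p 1 := by
  have hpi := Real.pi_pos
  have hp2 : 2 / p < 1 := by rw [div_lt_one] <;> linarith
  have hp0 : 0 < 2 / p := by positivity
  set r := 1 - 2 / p with hr
  have hr0 : 0 < r := by linarith
  have iE := intervalIntegrable_kernelE1 (show 1 < p by linarith) 1 0 (Real.pi / 2)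
  have hker := isAmplitudeKernel_kernel1_one hp
  have iK := hker.integrable 0 (Real.pi / 2)
  have hd : ∀ θ ∈ Ioo 0 (Real.pi / 2), HasDerivAt (fun θ => Real.sin θ * Real.cos θ ^ r)
      ((1 + r) * kernelE1 p 1 θ - r * kernel1 p 1 θ) θ := by
    intro θ hθ
    have hc := cos_pos_of_mem_Ioo hθ
    have h1 := (Real.hasDerivAt_sin θ).fun_mul
      ((Real.hasDerivAt_cos θ).rpow_const (p := r) (Or.inl hc.ne'))
    refine h1.congr_deriv ?_
    have hsq : Real.sqrt (1 - 1 ^ 2 * Real.sin θ ^ 2) = Real.cos θ := by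
      rw [one_pow, one_mul, ← Real.cos_sq', Real.sqrt_sq hc.le]
    rw [kernelE1, kernel1, hsq, abs_of_pos hc, ← hr, Real.rpow_sub_one hc.ne']
    have := Real.sin_sq θ
    field_simp
    rw [this]
    ring
  have hcont : ContinuousOn (fun θ => Real.sin θ * Real.cos θ ^ r) (Icc 0 (Real.pi / 2)) :=
    (Real.continuous_sin.mul (Real.continuous_cos.rpow_const fun _ => Or.inr hr0.le)).continuousOn
  have hI := intervalIntegral.integral_eq_sub_of_hasDerivAt_of_le (by linarith) hcont hd
    ((iE.const_mul _).sub (iK.const_mul _))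
  rw [intervalIntegral.integral_sub (iE.const_mul _) (iK.const_mul _),
    intervalIntegral.integral_const_mul, intervalIntegral.integral_const_mul, Real.cos_pi_div_two,
    Real.zero_rpow hr0.ne', mul_zero, Real.sin_zero, zero_mul, sub_zero] at hI
  have hE : ∫ θ in (0 : ℝ)..Real.pi / 2, kernelE1 p 1 θ = E1c p 1 := rfl
  have hK : ∫ θ in (0 : ℝ)..Real.pi / 2, kernel1 p 1 θ = K1 p 1 := rfl
  rw [hE, hK] at hI
  have hKpos : 0 < K1 p 1 := hker.primitive_pi_div_two_pos (measurable_kernel1 p 1)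
  nlinarith

/-- For `p ≤ 2` the integral `K` diverges as the modulus tends to `1`: with `q² = 1 - ε²` its
integrand is at least `1/(ε + π/2 - θ)`, whose integral grows like `-log ε`, while `E` stays below
its value at `0`. -/
theorem exists_two_mul_E1c_lt (hp : 1 < p) (hp2 : p ≤ 2) :
    ∃ q, 0 < q ∧ q < 1 ∧ 2 * E1c p q < K1 p q := by
  have hpi := Real.pi_pos
  have hE0 : 0 < E1c p 0 := by
    have e : E1c p 0 = K1 p 0 := by unfold E1c K1 E1 F1; simp
    rw [e]; exact K1_pos hp le_rfl zero_lt_one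
  -- Chosen so that `-log ε` is exactly `2 E(0)`; the remaining term `log (ε + π/2)` makes the
  -- inequality strict.
  set ε := Real.exp (-(2 * E1c p 0)) with hε
  have hε0 : 0 < ε := Real.exp_pos _
  have hε1 : ε < 1 := by rw [hε, Real.exp_lt_one_iff]; linarith
  have hε2 : 0 < 1 - ε ^ 2 := by nlinarith
  refine ⟨Real.sqrt (1 - ε ^ 2), Real.sqrt_pos.2 hε2, ?_, ?_⟩
  · rw [Real.sqrt_lt' one_pos]; nlinarith [pow_pos hε0 2]
  set q := Real.sqrt (1 - ε ^ 2) with hq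
  have hq0 : 0 < q := Real.sqrt_pos.2 hε2
  have hqsq : q ^ 2 = 1 - ε ^ 2 := Real.sq_sqrt hε2.le
  have hq1 : q < 1 := by rw [hq, Real.sqrt_lt' one_pos]; nlinarith [pow_pos hε0 2]
  have h1 : 2 * E1c p q ≤ 2 * E1c p 0 := by linarith [E1c_anti hp le_rfl hq0.le]
  refine h1.trans_lt ?_
  have hlow : Continuous fun θ : ℝ => ε + |Real.pi / 2 - θ| := by fun_prop
  have hint : IntervalIntegrable (fun θ => (ε + |Real.pi / 2 - θ|)⁻¹) volume 0 (Real.pi / 2) :=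
    (hlow.inv₀ fun θ => by positivity).intervalIntegrable _ _
  have hle : ∫ θ in (0 : ℝ)..Real.pi / 2, (ε + |Real.pi / 2 - θ|)⁻¹ ≤ K1 p q := by
    refine intervalIntegral.integral_mono_on_of_le_Ioo (by linarith) hint
      ((isAmplitudeKernel_kernel1 hp hq0.le hq1).integrable _ _) fun θ hθ => ?_
    have hc := cos_pos_of_mem_Ioo hθ
    have hs := sin_pos_of_mem_Ioo_half hθ
    have hpos := one_sub_sq_mul_sin_sq_pos hq0.le hq1 θ
    have hcle : Real.cos θ ≤ Real.pi / 2 - θ := by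
      rw [← Real.sin_pi_div_two_sub]; exact Real.sin_le (by linarith [hθ.2])
    have hc1 : 1 ≤ |Real.cos θ| ^ (1 - 2 / p) := by
      rw [abs_of_pos hc]
      refine Real.one_le_rpow_of_pos_of_le_one_of_nonpos hc (Real.cos_le_one θ) ?_
      have : 1 ≤ 2 / p := by rw [le_div_iff₀] <;> linarith
      linarith
    -- The radicand equals `cos² θ + ε² sin² θ`, which is at most `(cos θ + ε)²`.
    have hsq : Real.sqrt (1 - q ^ 2 * Real.sin θ ^ 2) ≤ ε + |Real.pi / 2 - θ| := by
      rw [Real.sqrt_le_left (by positivity), hqsq, abs_of_pos (by linarith [hθ.2])]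
      have e1 := Real.sin_sq θ
      nlinarith [Real.sin_sq_le_one θ, pow_pos hε0 2, mul_pos hε0 (sub_pos.2 hθ.2)]
    rw [← one_div]
    exact div_le_div₀ (by positivity) hc1 (Real.sqrt_pos.2 hpos) hsq
  have hval : ∫ θ in (0 : ℝ)..Real.pi / 2, (ε + |Real.pi / 2 - θ|)⁻¹
      = Real.log (ε + Real.pi / 2) - Real.log ε := by
    have hd : ∀ θ ∈ Icc 0 (Real.pi / 2), HasDerivAt (fun θ => -Real.log (ε + (Real.pi / 2 - θ)))
        ((ε + |Real.pi / 2 - θ|)⁻¹) θ := by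
      intro θ hθ
      have hpos : 0 < ε + (Real.pi / 2 - θ) := by linarith [hθ.2]
      have := ((((hasDerivAt_id θ).const_sub (Real.pi / 2)).const_add ε).log hpos.ne').neg
      refine this.congr_deriv ?_
      rw [abs_of_nonneg (by linarith [hθ.2]), id, ← neg_div, neg_neg, one_div]
    rw [intervalIntegral.integral_eq_sub_of_hasDerivAt (by rwa [uIcc_of_le (by linarith)]) hint]
    simp
    ring
  rw [hval] at hle
  refine lt_of_lt_of_le ?_ hle
  have e1 : Real.log ε = -(2 * E1c p 0) := Real.log_exp _
  have e2 : 0 < Real.log (ε + Real.pi / 2) := Real.log_pos (by linarith [Real.pi_gt_three])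
  linarith

theorem exists_isFigureEightModulus (hp : 1 < p) : ∃ q, IsFigureEightModulus p q := by
  rcases le_or_gt p 2 with h | h
  · obtain ⟨q, h0, h1, h2⟩ := exists_two_mul_E1c_lt hp h
    exact exists_isFigureEightModulus_of_lt hp h0 h1.le
      ((isAmplitudeKernel_kernel1 hp h0.le h1).integrable _ _) h2
  · exact exists_isFigureEightModulus_of_lt hp one_pos le_rfl
      ((isAmplitudeKernel_kernel1_one h).integrable _ _) (two_mul_E1c_one_lt h)

end Modulus

/-- A function with nonpositive derivative and equal values at the end points has zero
derivative. -/
theorem deriv_eq_zero_of_nonpos_of_eq {f f' : ℝ → ℝ} {a b : ℝ} (hab : a < b)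
    (hc : ContinuousOn f (Icc a b)) (hd : ∀ t ∈ Ioo a b, HasDerivAt f (f' t) t)
    (hle : ∀ t ∈ Ioo a b, f' t ≤ 0) (heq : f a = f b) : ∀ t ∈ Ioo a b, f' t = 0 := by
  have hanti : AntitoneOn f (Icc a b) := by
    refine antitoneOn_of_hasDerivWithinAt_nonpos (convex_Icc a b) hc (f' := f')
      (fun t ht => ?_) fun t ht => ?_
    · rw [interior_Icc] at ht; exact (hd t ht).hasDerivWithinAt
    · rw [interior_Icc] at ht; exact hle t ht
  intro t ht
  have hconst : f =ᶠ[𝓝 t] fun _ => f a := by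
    filter_upwards [isOpen_Ioo.mem_nhds ht] with s hs
    have hs' := Ioo_subset_Icc_self hs
    exact le_antisymm (hanti (left_mem_Icc.2 hab.le) hs' hs.1.le)
      (heq.le.trans (hanti hs' (right_mem_Icc.2 hab.le) hs.2.le))
  exact (hd t ht).unique ((hasDerivAt_const t (f a)).congr_of_eventuallyEq hconst)

/-- If a continuous function vanishes on an open interval then so does its derivative. -/
theorem deriv_eq_zero_of_eq_zero {f f' : ℝ → ℝ} {a b : ℝ} (hz : ∀ t ∈ Ioo a b, f t = 0)
    (hd : ∀ t ∈ Ioo a b, HasDerivAt f (f' t) t) : ∀ t ∈ Ioo a b, f' t = 0 := by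
  intro t ht
  refine (hd t ht).unique ((hasDerivAt_const t (0 : ℝ)).congr_of_eventuallyEq ?_)
  filter_upwards [isOpen_Ioo.mem_nhds ht] with s hs using hz s hs

/-! ### Linear curves -/

section Models

variable {p q : ℝ} {γ : ℝ → Plane} {x y : ℝ → ℝ}

theorem hasDerivAt_gammaLinear (s : ℝ) : HasDerivAt gammaLinear !₂[1, 0] s := by
  rw [hasDerivAt_plane_iff]
  exact ⟨by simpa [gammaLinear] using hasDerivAt_id' s,
    by simpa [gammaLinear] using hasDerivAt_const s (0 : ℝ)⟩

theorem IsLinear.not_isClosedCurve (h : IsRegularRepr p γ x y) (hγ : IsLinear γ) :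
    ¬ IsClosedCurve γ := by
  obtain ⟨s₀, ℓ, hrep⟩ := hγ
  obtain ⟨hℓ, hiff⟩ := h.isClosedCurve_iff_of_isRepresentedBy hrep (T := fun _ => !₂[1, 0])
    (fun s _ => ((hasDerivAt_gammaLinear (s + s₀)).comp_add_const s s₀).hasDerivWithinAt)
    (fun s _ => by rw [plane_norm]; simp)
  rw [hiff]
  rintro ⟨h1, -⟩
  have := congrArg (fun z : Plane => z 0) h1
  simp [gammaLinear] at this
  exact hℓ.ne' this

/-! ### Orbitlike curves -/

theorem hasDerivAt_am2 (hq0 : 0 ≤ q) (hq1 : q < 1) (s : ℝ) :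
    HasDerivAt (fun s => am2 p s q) (dnp p s q) s := by
  have hk := isAmplitudeKernel_kernel2 p hq0 hq1
  have := hk.hasDerivAt_amplitude (measurable_kernel2 p q) (s := s)
    (continuous_kernel2 p hq0 hq1).continuousAt (kernel2_pos p hq0 hq1 _)
  simp only [dnp, am2_eq (not_degenerate_of_lt_one hq1)]
  refine this.congr_deriv ?_
  rw [kernel2, one_div, inv_inv]

theorem gammaOrbit_fst (s : ℝ) : gammaOrbit p q s 0
    = 1 / q ^ 2 * (2 * primitive (fun θ => (1 - q ^ 2 * Real.sin θ ^ 2) ^ (1 / (p / (p - 1))))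
        (am2 p s q) + (q ^ 2 - 2) * s) := by
  simp [gammaOrbit, E2, primitive]

theorem gammaOrbit_snd (s : ℝ) : gammaOrbit p q s 1
    = 1 / q ^ 2 * -(p / (p - 1) * dnp p s q ^ (p - 1)) := by
  simp [gammaOrbit]

/-- The tangential angle is twice the amplitude. Because the exponents `p` and `p/(p-1)` are
conjugate, the integrand of `E2` times the derivative of the amplitude is `1 - q² sin²`. -/
theorem hasDerivAt_gammaOrbit (hp : 1 < p) (hq0 : 0 < q) (hq1 : q < 1) (s : ℝ) :
    HasDerivAt (gammaOrbit p q) !₂[Real.cos (2 * am2 p s q), Real.sin (2 * am2 p s q)] s := by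
  have hp1 : p - 1 ≠ 0 := by linarith
  have hp0 : p ≠ 0 := by linarith
  have ham := hasDerivAt_am2 (p := p) hq0.le hq1 s
  have hw : ∀ θ, 0 < 1 - q ^ 2 * Real.sin θ ^ 2 := one_sub_sq_mul_sin_sq_pos hq0.le hq1
  set w := 1 - q ^ 2 * Real.sin (am2 p s q) ^ 2 with hwdef
  have hws : 0 < w := hw _
  rw [hasDerivAt_plane_iff]
  simp only [gammaOrbit_fst, gammaOrbit_snd, Matrix.cons_val_zero,
    Matrix.cons_val_one]
  constructor
  · have hcont : Continuous fun θ => (1 - q ^ 2 * Real.sin θ ^ 2) ^ (1 / (p / (p - 1))) :=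
      Continuous.rpow_const (by fun_prop) fun θ => Or.inl (hw θ).ne'
    have h1 := (hasDerivAt_primitive (fun a b => hcont.intervalIntegrable a b) hcont.measurable
      hcont.continuousAt).comp s ham
    refine (((h1.const_mul 2).add ((hasDerivAt_id s).const_mul (q ^ 2 - 2))).const_mul
      (1 / q ^ 2)).congr_deriv ?_
    have e : w ^ (1 / (p / (p - 1))) * dnp p s q = w := by
      rw [dnp, ← hwdef, ← Real.rpow_add hws,
        show 1 / (p / (p - 1)) + 1 / p = 1 by field_simp; ring, Real.rpow_one]
    rw [← hwdef, e, hwdef, Real.cos_two_mul, Real.cos_sq']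
    field_simp
    ring
  · have hd : ∀ s, dnp p s q ^ (p - 1)
        = (1 - q ^ 2 * Real.sin (am2 p s q) ^ 2) ^ ((p - 1) / p) := by
      intro s
      rw [dnp, ← Real.rpow_mul (hw _).le]; congr 1; ring
    simp only [hd]
    have h1 := (((ham.sin.fun_pow 2).const_mul (q ^ 2)).const_sub 1).rpow_const
      (p := (p - 1) / p) (Or.inl hws.ne')
    refine ((h1.const_mul (p / (p - 1))).neg.const_mul (1 / q ^ 2)).congr_deriv ?_
    have e : w ^ ((p - 1) / p - 1) * dnp p s q = 1 := by
      rw [dnp, ← hwdef, ← Real.rpow_add hws,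
        show (p - 1) / p - 1 + 1 / p = 0 by field_simp; ring, Real.rpow_zero]
    rw [← hwdef, Real.sin_two_mul]
    generalize w ^ ((p - 1) / p - 1) = P at e ⊢
    norm_num
    field_simp
    linear_combination (Real.sin (am2 p s q) * Real.cos (am2 p s q)) * e

/-- Let `Θ` be the amplitude and `k` the value of `dn_p` where `cos 2Θ = 0`. Then `X - sin(2Θ)/(2k)`
has derivative `cos 2Θ · (1 - dn_p/k)`, which is nonpositive because `dn_p ≥ k` where `cos 2Θ ≥ 0`
and `dn_p ≤ k` where `cos 2Θ ≤ 0`. On a closed curve the two end values agree, so `cos 2Θ` would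
vanish identically although `Θ` has positive derivative. -/
theorem IsOrbitlike.not_isClosedCurve (hp : 1 < p) (h : IsRegularRepr p γ x y)
    (hγ : IsOrbitlike p γ) : ¬ IsClosedCurve γ := by
  obtain ⟨q, ⟨hq0, hq1⟩, s₀, ℓ, hrep⟩ := hγ
  have hder := fun s => (hasDerivAt_gammaOrbit hp hq0 hq1 (s + s₀)).comp_add_const s s₀
  obtain ⟨hℓ, hiff⟩ := h.isClosedCurve_iff_of_isRepresentedBy hrep
    (fun s _ => (hder s).hasDerivWithinAt) (fun s _ => by rw [plane_norm]; simp)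
  rw [hiff]
  rintro ⟨h1, h2⟩
  have hx := congrArg (fun z : Plane => z 0) h1
  have hs := congrArg (fun z : Plane => z 1) h2
  simp only [Matrix.cons_val_zero, Matrix.cons_val_one] at hx hs
  have hw0 : 0 < 1 - q ^ 2 / 2 := by nlinarith
  set k : ℝ := (1 - q ^ 2 / 2) ^ (1 / p) with hk
  have hkpos : 0 < k := Real.rpow_pos_of_pos hw0 _
  have hp0 : 0 < 1 / p := by positivity
  set Θ : ℝ → ℝ := fun s => am2 p (s + s₀) q with hΘ
  have hΘd : ∀ s, HasDerivAt Θ (dnp p (s + s₀) q) s := fun s =>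
    (hasDerivAt_am2 hq0.le hq1 (s + s₀)).comp_add_const s s₀
  have hdpos : ∀ s, 0 < dnp p s q := fun s =>
    Real.rpow_pos_of_pos (one_sub_sq_mul_sin_sq_pos hq0.le hq1 _) _
  have hfd : ∀ s, HasDerivAt (fun s => gammaOrbit p q (s + s₀) 0 - Real.sin (2 * Θ s) / (2 * k))
      (Real.cos (2 * Θ s) * (1 - dnp p (s + s₀) q / k)) s := by
    intro s
    have e1 := (hasDerivAt_plane_iff.1 (hder s)).1
    refine (e1.sub ((((hΘd s).const_mul 2).sin).div_const (2 * k))).congr_deriv ?_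
    simp only [Matrix.cons_val_zero, hΘ]
    field_simp
  have hsign : ∀ s, Real.cos (2 * Θ s) * (1 - dnp p (s + s₀) q / k) ≤ 0 := by
    intro s
    have e : 1 - q ^ 2 * Real.sin (am2 p (s + s₀) q) ^ 2
        = 1 - q ^ 2 / 2 + q ^ 2 / 2 * Real.cos (2 * Θ s) := by
      rw [Real.cos_two_mul, Real.cos_sq']; ring
    rcases le_total 0 (Real.cos (2 * Θ s)) with hc | hc
    · refine mul_nonpos_of_nonneg_of_nonpos hc ?_
      rw [sub_nonpos, one_le_div hkpos, hk, dnp, e]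
      exact Real.rpow_le_rpow hw0.le (by nlinarith [mul_nonneg (sq_nonneg q) hc]) hp0.le
    · refine mul_nonpos_of_nonpos_of_nonneg hc ?_
      rw [sub_nonneg, div_le_one hkpos, hk, dnp, e]
      refine Real.rpow_le_rpow ?_ (by nlinarith [mul_nonneg (sq_nonneg q) (neg_nonneg.2 hc)]) hp0.le
      rw [← e]; exact (one_sub_sq_mul_sin_sq_pos hq0.le hq1 _).le
  have hzero := deriv_eq_zero_of_nonpos_of_eq hℓ
    (fun s _ => (hfd s).continuousAt.continuousWithinAt) (fun s _ => hfd s) (fun s _ => hsign s)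
    (by simp only [hΘ]; rw [hx, hs])
  have hcos : ∀ s ∈ Ioo 0 ℓ, Real.cos (2 * Θ s) = 0 := by
    intro s hs
    rcases mul_eq_zero.1 (hzero s hs) with h0 | h0
    · exact h0
    · have e : 1 - q ^ 2 * Real.sin (am2 p (s + s₀) q) ^ 2
          = 1 - q ^ 2 / 2 + q ^ 2 / 2 * Real.cos (2 * Θ s) := by
        rw [Real.cos_two_mul, Real.cos_sq']; ring
      rw [sub_eq_zero, eq_comm, div_eq_one_iff_eq hkpos.ne', hk, dnp,
        Real.rpow_left_inj (one_sub_sq_mul_sin_sq_pos hq0.le hq1 _).le hw0.le hp0.ne', e] at h0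
      have : q ^ 2 / 2 * Real.cos (2 * Θ s) = 0 := by linarith
      exact (mul_eq_zero.1 this).resolve_left (by positivity)
  have hsin := deriv_eq_zero_of_eq_zero hcos fun s _ => ((hΘd s).const_mul 2).cos
  have hm : ℓ / 2 ∈ Ioo 0 ℓ := ⟨by linarith, by linarith⟩
  have e1 := hcos _ hm
  have e2 := hsin _ hm
  have e3 := Real.sin_sq_add_cos_sq (2 * Θ (ℓ / 2))
  have e4 : Real.sin (2 * Θ (ℓ / 2)) = 0 := by
    have := (hdpos (ℓ / 2 + s₀)).ne'
    simpa [this] using e2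
  rw [e1, e4] at e3
  norm_num at e3

end Models

/-! ### The amplitude of modulus one for `p ≤ 2` -/

section Borderline

variable {p : ℝ}

theorem kernel1_one_of_mem (hp : 1 < p) {θ : ℝ}
    (h : θ ∈ Ioo (-(Real.pi / 2)) (Real.pi / 2)) : kernel1 p 1 θ = Real.cos θ ^ (-2 / p) := by
  rw [kernel1_one hp, abs_of_pos (Real.cos_pos_of_mem_Ioo h)]

theorem continuousAt_kernel1_one (hp : 1 < p) {θ : ℝ} (h : Real.cos θ ≠ 0) :
    ContinuousAt (kernel1 p 1) θ := by
  rw [funext (kernel1_one hp)]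
  exact ContinuousAt.rpow_const (by fun_prop) (Or.inl (abs_ne_zero.2 h))

theorem hasDerivAt_F1_one (hp : 1 < p) {θ : ℝ} (h : θ ∈ Ioo (-(Real.pi / 2)) (Real.pi / 2)) :
    HasDerivAt (fun θ => F1 p θ 1) (kernel1 p 1 θ) θ := by
  have h0 : (0 : ℝ) ∈ Ioo (-(Real.pi / 2)) (Real.pi / 2) := ⟨by linarith [Real.pi_pos],
    by linarith [Real.pi_pos]⟩
  refine intervalIntegral.integral_hasDerivAt_right (ContinuousOn.intervalIntegrable ?_)
    ((measurable_kernel1 p 1).stronglyMeasurable.stronglyMeasurableAtFilter)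
    (continuousAt_kernel1_one hp (Real.cos_pos_of_mem_Ioo h).ne')
  intro z hz
  exact (continuousAt_kernel1_one hp
    (Real.cos_pos_of_mem_Ioo (ordConnected_Ioo.uIcc_subset h0 h hz)).ne').continuousWithinAt

theorem F1_one_neg (θ : ℝ) : F1 p (-θ) 1 = -F1 p θ 1 := by
  have := intervalIntegral.integral_comp_neg (a := 0) (b := θ) (kernel1 p 1)
  have he : ∀ θ, kernel1 p 1 (-θ) = kernel1 p 1 θ := fun θ => by simp [kernel1]
  simp only [he] at this
  change (∫ θ in (0 : ℝ)..-θ, kernel1 p 1 θ) = -∫ θ in (0 : ℝ)..θ, kernel1 p 1 θ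
  rw [this, neg_zero, intervalIntegral.integral_symm]

theorem strictMonoOn_F1_one (hp : 1 < p) :
    StrictMonoOn (fun θ => F1 p θ 1) (Ioo (-(Real.pi / 2)) (Real.pi / 2)) := by
  refine strictMonoOn_of_hasDerivWithinAt_pos (convex_Ioo _ _)
    (fun θ hθ => (hasDerivAt_F1_one hp hθ).continuousAt.continuousWithinAt) (f' := kernel1 p 1)
    (fun θ hθ => ?_) fun θ hθ => ?_
  · rw [interior_Ioo] at hθ; exact (hasDerivAt_F1_one hp hθ).hasDerivWithinAt
  · rw [interior_Ioo] at hθ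
    rw [kernel1_one_of_mem hp hθ]
    exact Real.rpow_pos_of_pos (Real.cos_pos_of_mem_Ioo hθ) _

/-- For `p ≤ 2` the kernel `cos^(-2/p)` is at least `1/cos t ≥ 1/(π/2 - t)`, so the integral
diverges at `π/2` and its inverse is defined on the whole line. -/
theorem log_le_F1_one (hp : 1 < p) (hp2 : p ≤ 2) {θ : ℝ} (h0 : 0 ≤ θ) (h1 : θ < Real.pi / 2) :
    Real.log (Real.pi / 2) - Real.log (Real.pi / 2 - θ) ≤ F1 p θ 1 := by
  have hpi := Real.pi_pos
  have hmem : ∀ t ∈ Ico 0 (Real.pi / 2), t ∈ Ioo (-(Real.pi / 2)) (Real.pi / 2) := fun t ht =>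
    ⟨by linarith [ht.1], ht.2⟩
  have hd : ∀ t ∈ Ico 0 (Real.pi / 2), HasDerivAt
      (fun t => F1 p t 1 + Real.log (Real.pi / 2 - t))
      (kernel1 p 1 t + -1 / (Real.pi / 2 - t)) t := fun t ht =>
    (hasDerivAt_F1_one hp (hmem t ht)).add
      (((hasDerivAt_id t).const_sub _).log (by have := ht.2; simp only [id]; linarith))
  have hmono : MonotoneOn (fun t => F1 p t 1 + Real.log (Real.pi / 2 - t))
      (Ico 0 (Real.pi / 2)) := by
    refine monotoneOn_of_hasDerivWithinAt_nonneg (convex_Ico _ _)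
      (fun t ht => (hd t ht).continuousAt.continuousWithinAt)
      (f' := fun t => kernel1 p 1 t + -1 / (Real.pi / 2 - t)) (fun t ht => ?_) fun t ht => ?_
    · rw [interior_Ico] at ht; exact (hd t (Ioo_subset_Ico_self ht)).hasDerivWithinAt
    · rw [interior_Ico] at ht
      have hc := cos_pos_of_mem_Ioo ht
      have hle : Real.cos t ≤ Real.pi / 2 - t := by
        rw [← Real.sin_pi_div_two_sub]; exact Real.sin_le (by linarith [ht.2])
      rw [kernel1_one_of_mem hp (hmem t (Ioo_subset_Ico_self ht)), neg_div (Real.pi / 2 - t), ← sub_eq_add_neg,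
        sub_nonneg]
      calc 1 / (Real.pi / 2 - t) ≤ (Real.cos t)⁻¹ := by
            rw [one_div]; exact inv_anti₀ hc hle
        _ = Real.cos t ^ (-1 : ℝ) := (Real.rpow_neg_one _).symm
        _ ≤ Real.cos t ^ (-2 / p) := by
            refine Real.rpow_le_rpow_of_exponent_ge hc (Real.cos_le_one t) ?_
            rw [div_le_iff₀] <;> linarith
  have := hmono ⟨le_rfl, by linarith⟩ ⟨h0, h1⟩ h0
  simp only [F1, intervalIntegral.integral_same, sub_zero, zero_add] at this
  rw [F1]
  linarith

theorem surjOn_F1_one (hp : 1 < p) (hp2 : p ≤ 2) :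
    SurjOn (fun θ => F1 p θ 1) (Ioo (-(Real.pi / 2)) (Real.pi / 2)) univ := by
  have hpi := Real.pi_pos
  have key : ∀ s, 0 ≤ s → ∃ θ ∈ Ioo (-(Real.pi / 2)) (Real.pi / 2), F1 p θ 1 = s := by
    intro s hs
    -- The point at which the logarithmic lower bound equals `s`.
    set b := Real.pi / 2 - Real.pi / 2 * Real.exp (-s) with hb
    have he : Real.exp (-s) ≤ 1 := Real.exp_le_one_iff.2 (by linarith)
    have he0 := Real.exp_pos (-s)
    have hb0 : 0 ≤ b := by nlinarith
    have hb1 : b < Real.pi / 2 := by have := mul_pos (half_pos hpi) he0; linarith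
    have hFb : s ≤ F1 p b 1 := by
      refine le_trans (le_of_eq ?_) (log_le_F1_one hp hp2 hb0 hb1)
      rw [hb, sub_sub_cancel, Real.log_mul (by positivity) he0.ne', Real.log_exp]; ring
    have hsub : Icc 0 b ⊆ Ioo (-(Real.pi / 2)) (Real.pi / 2) := fun t ht =>
      ⟨by linarith [ht.1], by linarith [ht.2]⟩
    have hivt := intermediate_value_Icc hb0 (f := fun θ => F1 p θ 1)
      (fun t ht => (hasDerivAt_F1_one hp (hsub ht)).continuousAt.continuousWithinAt)
    obtain ⟨θ, hθ, hθs⟩ := hivt ⟨by simpa [F1] using hs, hFb⟩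
    exact ⟨θ, hsub hθ, hθs⟩
  intro s _
  rcases le_total 0 s with hs | hs
  · exact key s hs
  · obtain ⟨θ, hθ, hθs⟩ := key (-s) (by linarith)
    refine ⟨-θ, ⟨by linarith [hθ.2], by linarith [hθ.1]⟩, ?_⟩
    change F1 p (-θ) 1 = s
    rw [F1_one_neg, hθs, neg_neg]

theorem am1_one_mem (hp : 1 < p) (hp2 : p ≤ 2) (s : ℝ) :
    am1 p s 1 ∈ Ioo (-(Real.pi / 2)) (Real.pi / 2) ∧ F1 p (am1 p s 1) 1 = s := by
  have hr : amRange p 1 = Ioo (-(Real.pi / 2)) (Real.pi / 2) := if_pos ⟨rfl, hp2⟩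
  have hex := surjOn_F1_one hp hp2 (mem_univ s)
  rw [am1, hr]
  exact ⟨Function.invFunOn_mem hex, Function.invFunOn_eq hex⟩

theorem continuous_am1_one_of_le_two (hp : 1 < p) (hp2 : p ≤ 2) :
    Continuous fun s => am1 p s 1 := by
  have h := am1_one_mem hp hp2
  let f : ℝ → Ioo (-(Real.pi / 2)) (Real.pi / 2) := fun s => ⟨am1 p s 1, (h s).1⟩
  have hmono : Monotone f := by
    intro s t hst
    have := (strictMonoOn_F1_one hp).le_iff_le (h s).1 (h t).1
    simp only [(h s).2, (h t).2] at this
    exact this.1 hst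
  have hsurj : Function.Surjective f := fun θ =>
    ⟨F1 p θ 1, Subtype.ext ((strictMonoOn_F1_one hp).injOn (h _).1 θ.2 (h _).2)⟩
  exact continuous_subtype_val.comp (hmono.continuous_of_surjective hsurj)

/-! ### The amplitude of modulus one -/

theorem continuous_am1_one (hp : 1 < p) : Continuous fun s => am1 p s 1 := by
  rcases le_or_gt p 2 with hp2 | hp2
  · exact continuous_am1_one_of_le_two hp hp2
  · simp only [am1_eq fun h : (1 : ℝ) = 1 ∧ p ≤ 2 => h.2.not_gt hp2]
    exact (isAmplitudeKernel_kernel1_one hp2).continuous_amplitude (measurable_kernel1 p 1)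

theorem hasDerivAt_am1_one (hp : 1 < p) {s : ℝ} (hs : Real.cos (am1 p s 1) ≠ 0) :
    HasDerivAt (fun s => am1 p s 1) (|Real.cos (am1 p s 1)| ^ (2 / p)) s := by
  have e : |Real.cos (am1 p s 1)| ^ (2 / p) = (kernel1 p 1 (am1 p s 1))⁻¹ := by
    rw [kernel1_one hp, ← Real.rpow_neg (abs_nonneg _), neg_div, neg_neg]
  rw [e]
  have hpos : 0 < kernel1 p 1 (am1 p s 1) := by
    rw [kernel1_one hp]; exact Real.rpow_pos_of_pos (abs_pos.2 hs) _
  rcases le_or_gt p 2 with hp2 | hp2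
  · exact HasDerivAt.of_local_left_inverse (continuous_am1_one hp).continuousAt
      (hasDerivAt_F1_one hp (am1_one_mem hp hp2 s).1) hpos.ne'
      (Eventually.of_forall fun t => (am1_one_mem hp hp2 t).2)
  · have hk := isAmplitudeKernel_kernel1_one hp2
    simp only [am1_eq fun h : (1 : ℝ) = 1 ∧ p ≤ 2 => h.2.not_gt hp2] at hs hpos ⊢
    exact hk.hasDerivAt_amplitude (measurable_kernel1 p 1) (hk.continuousAt _ hs) hpos

theorem countable_cos_am1_one (hp : 1 < p) : {s | Real.cos (am1 p s 1) = 0}.Countable := by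
  rcases le_or_gt p 2 with hp2 | hp2
  · convert countable_empty
    ext s
    simpa using (Real.cos_pos_of_mem_Ioo (am1_one_mem hp hp2 s).1).ne'
  · simp only [am1_eq fun h : (1 : ℝ) = 1 ∧ p ≤ 2 => h.2.not_gt hp2]
    exact (isAmplitudeKernel_kernel1_one hp2).countable_cos_amplitude (measurable_kernel1 p 1)

/-- Where the truncation in `sechp` is inactive, the amplitude of modulus one lies in
`[-π/2, π/2]`. -/
theorem cos_am1_one_nonneg (hp : 1 < p) {s : ℝ} (hs : p ≤ 2 ∨ |s| ≤ K1 p 1) :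
    0 ≤ Real.cos (am1 p s 1) := by
  rcases le_or_gt p 2 with hp2 | hp2
  · exact (Real.cos_pos_of_mem_Ioo (am1_one_mem hp hp2 s).1).le
  · have hk := isAmplitudeKernel_kernel1_one hp2
    have hm := measurable_kernel1 p 1
    have hs' := abs_le.1 (hs.resolve_left (not_le.2 hp2))
    rw [am1_eq fun h : (1 : ℝ) = 1 ∧ p ≤ 2 => h.2.not_gt hp2]
    rw [K1_eq, ← hk.primitive_neg] at hs'
    refine Real.cos_nonneg_of_mem_Icc ⟨?_, ?_⟩
    · rw [← hk.amplitude_primitive hm (-(Real.pi / 2))]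
      exact (hk.strictMono_amplitude hm).monotone hs'.1
    · rw [← hk.amplitude_primitive hm (Real.pi / 2)]
      exact (hk.strictMono_amplitude hm).monotone hs'.2

theorem am1_one_K1 (hp : 2 < p) : am1 p (K1 p 1) 1 = Real.pi / 2 := by
  rw [am1_eq fun h : (1 : ℝ) = 1 ∧ p ≤ 2 => h.2.not_gt hp, K1_eq,
    (isAmplitudeKernel_kernel1_one hp).amplitude_primitive (measurable_kernel1 p 1)]

theorem am1_one_neg_K1 (hp : 2 < p) : am1 p (-K1 p 1) 1 = -(Real.pi / 2) := by
  have hk := isAmplitudeKernel_kernel1_one hp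
  rw [am1_eq fun h : (1 : ℝ) = 1 ∧ p ≤ 2 => h.2.not_gt hp, K1_eq, ← hk.primitive_neg,
    hk.amplitude_primitive (measurable_kernel1 p 1)]

theorem K1_one_pos (hp : 2 < p) : 0 < K1 p 1 :=
  (isAmplitudeKernel_kernel1_one hp).primitive_pi_div_two_pos (measurable_kernel1 p 1)

/-- The formula includes the end points `|s| = K_p(1)`, where the truncated definition gives `0` and
the cosine of the amplitude vanishes as well. -/
theorem sechp_eq (hp : 1 < p) {s : ℝ} (hs : p ≤ 2 ∨ |s| ≤ K1 p 1) :
    sechp p s = |Real.cos (am1 p s 1)| ^ (2 / p) := by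
  have h0 := cos_am1_one_nonneg hp hs
  have e : cnp p s 1 = |Real.cos (am1 p s 1)| ^ (2 / p) := by
    rw [cnp_eq, ← abs_spow (by positivity)]
    refine (abs_of_nonneg ?_).symm
    rw [spow]; positivity
  rw [sechp, ← e]
  split_ifs with h
  · rfl
  · rw [not_or, not_le, not_lt] at h
    have hs' : |s| = K1 p 1 := le_antisymm (hs.resolve_left (not_le.2 h.1)) h.2
    have hc : Real.cos (am1 p s 1) = 0 := by
      rcases abs_choice s with h' | h' <;> rw [h'] at hs'
      · rw [hs', am1_one_K1 h.1, Real.cos_pi_div_two]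
      · rw [show s = -K1 p 1 by linarith, am1_one_neg_K1 h.1, Real.cos_neg, Real.cos_pi_div_two]
    rw [e, hc, abs_zero, Real.zero_rpow (by positivity)]

/-! ### Borderline arcs -/

/-- The smooth extension of the borderline curve, without truncation. -/
def borderExt (p σ s : ℝ) : Plane :=
  !₂[2 * (∫ t in (0 : ℝ)..s, Real.cos (am1 p t 1) ^ 2) - s,
    -(σ * (p / (p - 1)) * |Real.cos (am1 p s 1)| ^ (2 - 2 / p))]

/-- On the closed range where no truncation is felt, `sech_p ^ p` is the squared cosine of the
amplitude. The extension has a tangent on the whole line, which avoids one-sided derivatives at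
`±K_p(1)`. -/
theorem gammaBorder_eq_borderExt (hp : 1 < p) (σ : ℝ) {s : ℝ} (hs : p ≤ 2 ∨ |s| ≤ K1 p 1) :
    gammaBorder p σ s = borderExt p σ s := by
  have hp0 : p ≠ 0 := by linarith
  have e1 : tanhp p s = ∫ t in (0 : ℝ)..s, Real.cos (am1 p t 1) ^ 2 := by
    refine intervalIntegral.integral_congr fun t ht => ?_
    have ht' : p ≤ 2 ∨ |t| ≤ K1 p 1 := by
      refine hs.imp id fun h => le_trans ?_ h
      rcases le_total 0 s with h0 | h0
      · rw [uIcc_of_le h0] at ht; rw [abs_of_nonneg ht.1, abs_of_nonneg h0]; exact ht.2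
      · rw [uIcc_of_ge h0] at ht; rw [abs_of_nonpos ht.2, abs_of_nonpos h0]; linarith [ht.1]
    rw [sechp_eq hp ht', ← Real.rpow_mul (abs_nonneg _), div_mul_cancel₀ _ hp0, Real.rpow_two,
      sq_abs]
  rw [gammaBorder, borderExt, e1, sechp_eq hp hs, ← Real.rpow_mul (abs_nonneg _),
    show 2 / p * (p - 1) = 2 - 2 / p by field_simp]

/-- The unit tangent of the borderline curve. -/
def borderTangent (p σ s : ℝ) : Plane :=
  !₂[Real.cos (2 * am1 p s 1), σ * Real.sin (2 * am1 p s 1)]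

theorem norm_borderTangent {σ : ℝ} (hσ : σ = 1 ∨ σ = -1) (s : ℝ) : ‖borderTangent p σ s‖ = 1 := by
  rw [plane_norm]
  rcases hσ with rfl | rfl <;> simp [borderTangent]

theorem hasDerivAt_abs_rpow (r : ℝ) {z : ℝ} (hr : r ≠ 0) (hz : z ≠ 0) :
    HasDerivAt (fun z => |z| ^ r) (r * spow (r - 1) z) z := by
  have h := (hasDerivAt_spow (r - 1) hz).fun_mul (hasDerivAt_id' z)
  refine (h.congr_of_eventuallyEq (Eventually.of_forall fun w => ?_)).congr_deriv ?_
  · simp only [spow_mul_self (r := r - 1) (by simpa using hr), sub_add_cancel]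
  · rw [spow]; ring

theorem hasDerivAt_borderExt (hp : 1 < p) (σ s : ℝ) :
    HasDerivAt (borderExt p σ) (borderTangent p σ s) s := by
  have hp1 : p - 1 ≠ 0 := by linarith
  have hp0 : p ≠ 0 := by linarith
  have ham := continuous_am1_one hp
  have hr : 0 < 2 - 2 / p := by
    have : 2 / p < 2 := by rw [div_lt_iff₀] <;> linarith
    linarith
  rw [hasDerivAt_plane_iff]
  simp only [borderExt, borderTangent, Matrix.cons_val_zero, Matrix.cons_val_one]
  constructor
  · have hcont : Continuous fun s => Real.cos (am1 p s 1) ^ 2 := by fun_prop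
    refine (((intervalIntegral.integral_hasDerivAt_right (hcont.intervalIntegrable 0 s)
      (hcont.stronglyMeasurableAtFilter _ _) hcont.continuousAt).const_mul 2).sub
      (hasDerivAt_id s)).congr_deriv ?_
    rw [Real.cos_two_mul]
  · refine hasDerivAt_of_off_countable (g := fun s => σ * Real.sin (2 * am1 p s 1))
      (countable_cos_am1_one hp) ?_ (by fun_prop) (fun s hs => ?_) s
    · refine (continuous_const.mul (Continuous.rpow_const (by fun_prop) fun s => Or.inr hr.le)).neg
    · have h1 := (hasDerivAt_abs_rpow (2 - 2 / p) hr.ne' hs).comp s (hasDerivAt_am1_one hp hs).cos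
      refine ((h1.const_mul (σ * (p / (p - 1)))).neg).congr_deriv ?_
      have hcs : 0 < |Real.cos (am1 p s 1)| := abs_pos.2 hs
      have e : |Real.cos (am1 p s 1)| ^ (2 - 2 / p - 1 - 1) * |Real.cos (am1 p s 1)| ^ (2 / p)
          = 1 := by
        rw [← Real.rpow_add hcs, show 2 - 2 / p - 1 - 1 + 2 / p = 0 by ring, Real.rpow_zero]
      have e2 : p / (p - 1) * (2 - 2 / p) = 2 := by field_simp
      rw [spow, Real.sin_two_mul]
      linear_combination (σ * Real.sin (am1 p s 1) * Real.cos (am1 p s 1)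
        * (p / (p - 1) * (2 - 2 / p))) * e
        + σ * Real.sin (am1 p s 1) * Real.cos (am1 p s 1) * e2

/-- The abscissa of `z`, corrected by its height times the tangent of half the angle of the unit
vector `T`; along borderline arcs it is an affine function of arclength. -/
def tangentAbscissa (z T : Plane) : ℝ := z 0 + z 1 * (T 1 / (1 + T 0))

/-- The correction equals `-(p/(p-1)) sin am · spow (1-2/p) (cos am)`. Its derivative combines with
that of the abscissa to the constant `-1/(p-1)` wherever the cosine is nonzero; this extends by
continuity, since either the cosine never vanishes (`p ≤ 2`) or the exponent `1 - 2/p` is positive.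
-/
theorem tangentAbscissa_borderExt (hp : 1 < p) {σ : ℝ} (hσ : σ = 1 ∨ σ = -1) (s : ℝ) :
    tangentAbscissa (borderExt p σ s) (borderTangent p σ s)
      = tangentAbscissa (borderExt p σ 0) (borderTangent p σ 0) - s / (p - 1) := by
  have hp1 : p - 1 ≠ 0 := by linarith
  have hp0 : p ≠ 0 := by linarith
  have ham := continuous_am1_one hp
  have hσ2 : σ ^ 2 = 1 := by rcases hσ with h | h <;> rw [h] <;> norm_num
  have hr : 0 < 2 - 2 / p := by
    have : 2 / p < 2 := by rw [div_lt_iff₀] <;> linarith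
    linarith
  have e0 : ∀ s, tangentAbscissa (borderExt p σ s) (borderTangent p σ s) = borderExt p σ s 0
      - p / (p - 1) * (Real.sin (am1 p s 1) * spow (1 - 2 / p) (Real.cos (am1 p s 1))) := by
    intro s
    rcases eq_or_ne (Real.cos (am1 p s 1)) 0 with hc | hc
    · rw [tangentAbscissa, hc]
      -- Here the quotient in `tangentAbscissa` degenerates, but the height is zero, so the
      -- correction vanishes on both sides.
      simp [borderExt, borderTangent, hc, Real.zero_rpow hr.ne', spow_zero_right]
    · have e : |Real.cos (am1 p s 1)| ^ (2 - 2 / p)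
          = spow (1 - 2 / p) (Real.cos (am1 p s 1)) * Real.cos (am1 p s 1) := by
        rw [spow_mul_self (by linarith)]; congr 1; ring
      simp only [tangentAbscissa, borderExt, borderTangent, Matrix.cons_val_zero,
        Matrix.cons_val_one]
      rw [e, Real.cos_two_mul, Real.sin_two_mul,
        show 1 + (2 * Real.cos (am1 p s 1) ^ 2 - 1) = 2 * Real.cos (am1 p s 1) ^ 2 by ring]
      field_simp
      rw [hσ2]
      ring
  have hd : ∀ s, HasDerivAt (fun s => borderExt p σ s 0
      - p / (p - 1) * (Real.sin (am1 p s 1) * spow (1 - 2 / p) (Real.cos (am1 p s 1))))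
      (-1 / (p - 1)) s := by
    intro s
    have hx := fun s => (hasDerivAt_plane_iff.1 (hasDerivAt_borderExt hp σ s)).1
    refine hasDerivAt_of_off_countable (g := fun _ => -1 / (p - 1))
      (countable_cos_am1_one hp) ?_ continuous_const (fun s hs => ?_) s
    · refine (continuous_iff_continuousAt.2 fun s => (hx s).continuousAt).sub
        (continuous_const.mul ((Real.continuous_sin.comp ham).mul ?_))
      rcases le_or_gt p 2 with hp2 | hp2
      · refine continuous_iff_continuousAt.2 fun s => ?_
        have hc := (Real.cos_pos_of_mem_Ioo (am1_one_mem hp hp2 s).1).ne'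
        exact ContinuousAt.comp (f := fun s => Real.cos (am1 p s 1))
          (hasDerivAt_spow _ hc).continuousAt (Real.continuous_cos.comp ham).continuousAt
      · have : 0 < 1 - 2 / p := by
          have : 2 / p < 1 := by rw [div_lt_one] <;> linarith
          linarith
        exact (continuous_spow this).comp (Real.continuous_cos.comp ham)
    · have h1 := (hasDerivAt_am1_one hp hs)
      have h2 := h1.sin.mul ((hasDerivAt_spow (1 - 2 / p) hs).comp s h1.cos)
      refine ((hx s).sub (h2.const_mul (p / (p - 1)))).congr_deriv ?_
      have hcs : 0 < |Real.cos (am1 p s 1)| := abs_pos.2 hs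
      have a1 : |Real.cos (am1 p s 1)| ^ (1 - 2 / p - 1) * |Real.cos (am1 p s 1)| ^ (2 / p)
          = 1 := by
        rw [← Real.rpow_add hcs, show 1 - 2 / p - 1 + 2 / p = 0 by ring, Real.rpow_zero]
      have a2 := Real.sin_sq_add_cos_sq (am1 p s 1)
      simp only [borderTangent, Matrix.cons_val_zero, Function.comp, spow]
      rw [Real.cos_two_mul]
      generalize |Real.cos (am1 p s 1)| ^ (1 - 2 / p - 1) = P at a1 ⊢
      generalize |Real.cos (am1 p s 1)| ^ (2 / p) = Q at a1 ⊢
      field_simp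
      linear_combination (-p * Real.cos (am1 p s 1) ^ 2 + (p - 2) * Real.sin (am1 p s 1) ^ 2) * a1
        + (p - 2) * a2
  simp only [e0]
  have hd' : ∀ s, HasDerivAt (fun s => borderExt p σ s 0
      - p / (p - 1) * (Real.sin (am1 p s 1) * spow (1 - 2 / p) (Real.cos (am1 p s 1)))
      + s / (p - 1)) 0 s := fun s =>
    ((hd s).add ((hasDerivAt_id s).div_const (p - 1))).congr_deriv (by ring)
  have := is_const_of_deriv_eq_zero (fun s => (hd' s).differentiableAt)
    (fun s => (hd' s).deriv) s 0
  linear_combination this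

end Borderline

/-! ### Borderline curves are not closed -/

section NotClosed

variable {p : ℝ} {γ : ℝ → Plane} {x y : ℝ → ℝ}

/-- `tangentAbscissa` depends only on the point and the tangent, yet it decreases strictly in
arclength. -/
theorem IsBorderline.not_isClosedCurve (hp : 1 < p) (h : IsRegularRepr p γ x y)
    (hγ : IsBorderline p γ) : ¬ IsClosedCurve γ := by
  obtain ⟨hp2, s₀, ℓ, hrep⟩ := hγ
  have he : gammaBorder p 1 = borderExt p 1 :=
    funext fun s => gammaBorder_eq_borderExt hp 1 (Or.inl hp2)
  rw [he] at hrep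
  obtain ⟨hℓ, hiff⟩ := h.isClosedCurve_iff_of_isRepresentedBy hrep
    (fun s _ => ((hasDerivAt_borderExt hp 1 (s + s₀)).comp_add_const s s₀).hasDerivWithinAt)
    (fun s _ => norm_borderTangent (Or.inl rfl) _)
  rw [hiff]
  rintro ⟨h1, h2⟩
  have e1 := tangentAbscissa_borderExt hp (Or.inl rfl : (1 : ℝ) = 1 ∨ (1 : ℝ) = -1) (0 + s₀)
  have e2 := tangentAbscissa_borderExt hp (Or.inl rfl : (1 : ℝ) = 1 ∨ (1 : ℝ) = -1) (ℓ + s₀)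
  rw [h1, h2, e2] at e1
  have hp1 : p - 1 ≠ 0 := by linarith
  field_simp at e1
  linarith

/-! ### Flat-core curves are not closed -/

/-- An arc with unit tangent `T` which starts and ends at the same height, in the direction
`(-1, 0)`, and along which `tangentAbscissa` is strictly decreasing. -/
structure Arc.IsDecreasing (c : Arc) (T : ℝ → Plane) : Prop where
  le : c.a ≤ c.b
  hasDerivWithinAt : ∀ s ∈ Icc c.a c.b, HasDerivWithinAt c.toFun (T s) (Icc c.a c.b) s
  norm_eq : ∀ s ∈ Icc c.a c.b, ‖T s‖ = 1
  tangent_left : T c.a = !₂[-1, 0]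
  tangent_right : T c.b = !₂[-1, 0]
  height_eq : c.toFun c.b 1 = c.toFun c.a 1
  strictAntiOn : StrictAntiOn (fun s => tangentAbscissa (c.toFun s - c.toFun c.a) (T s))
    (Icc c.a c.b)

theorem tangentAbscissa_neg_one (z : Plane) : tangentAbscissa z !₂[-1, 0] = z 0 := by
  simp [tangentAbscissa]

theorem tangentAbscissa_add (z w T : Plane) :
    tangentAbscissa (z + w) T = tangentAbscissa z T + tangentAbscissa w T := by
  simp only [tangentAbscissa, PiLp.add_apply]; ring

theorem segmentArc_isDecreasing {l : ℝ} (hl : 0 ≤ l) :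
    (segmentArc l).IsDecreasing fun _ => !₂[-1, 0] where
  le := hl
  hasDerivWithinAt s _ := by
    refine HasDerivAt.hasDerivWithinAt ?_
    rw [hasDerivAt_plane_iff]
    exact ⟨by simpa [segmentArc] using hasDerivAt_neg' s,
      by simpa [segmentArc] using hasDerivAt_const s (0 : ℝ)⟩
  norm_eq s _ := by rw [plane_norm]; simp
  tangent_left := rfl
  tangent_right := rfl
  height_eq := by simp [segmentArc]
  strictAntiOn s _ t _ hst := by
    simp only [tangentAbscissa_neg_one]
    simpa [segmentArc] using hst

/-- At `±K_p(1)` the amplitude is `±π/2`, so the loop starts and ends at height zero in the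
direction `(-1, 0)`. Subtracting a starting point of height zero does not change the correction
term. -/
theorem loopArc_isDecreasing (hp : 2 < p) {σ : ℝ} (hσ : σ = 1 ∨ σ = -1) :
    (loopArc p σ).IsDecreasing (borderTangent p σ) := by
  have hp1 : 1 < p := by linarith
  have hK := K1_one_pos hp
  have hr : 2 - 2 / p ≠ 0 := by
    have : 2 / p < 2 := by rw [div_lt_iff₀] <;> linarith
    linarith
  have heq : ∀ s ∈ Icc (-K1 p 1) (K1 p 1), gammaBorder p σ s = borderExt p σ s := fun s hs =>
    gammaBorder_eq_borderExt hp1 σ (Or.inr (abs_le.2 hs))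
  have hl : -K1 p 1 ∈ Icc (-K1 p 1) (K1 p 1) := left_mem_Icc.2 (by linarith)
  have hrr : K1 p 1 ∈ Icc (-K1 p 1) (K1 p 1) := right_mem_Icc.2 (by linarith)
  have hyl : gammaBorder p σ (-K1 p 1) 1 = 0 := by
    rw [heq _ hl]
    simp [borderExt, am1_one_neg_K1 hp, Real.zero_rpow hr]
  have hyr : gammaBorder p σ (K1 p 1) 1 = 0 := by
    rw [heq _ hrr]
    simp [borderExt, am1_one_K1 hp, Real.zero_rpow hr]
  refine ⟨by change -K1 p 1 ≤ K1 p 1; linarith, fun s hs => ?_, fun s _ => norm_borderTangent hσ s,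
    ?_, ?_, hyr.trans hyl.symm, ?_⟩
  · exact (hasDerivAt_borderExt hp1 σ s).hasDerivWithinAt.congr_of_mem heq hs
  · change borderTangent p σ (-K1 p 1) = _
    rw [borderTangent, am1_one_neg_K1 hp]
    simp [mul_neg, mul_div_cancel₀]
  · change borderTangent p σ (K1 p 1) = _
    rw [borderTangent, am1_one_K1 hp]
    simp [mul_div_cancel₀]
  · have hform : ∀ s ∈ Icc (-K1 p 1) (K1 p 1),
        tangentAbscissa (gammaBorder p σ s - gammaBorder p σ (-K1 p 1)) (borderTangent p σ s)
          = tangentAbscissa (borderExt p σ 0) (borderTangent p σ 0) - s / (p - 1)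
            - gammaBorder p σ (-K1 p 1) 0 := by
      intro s hs
      rw [← tangentAbscissa_borderExt hp1 hσ s, ← heq s hs]
      simp only [tangentAbscissa, PiLp.sub_apply, hyl]
      ring
    intro s hs t ht hst
    change tangentAbscissa (gammaBorder p σ t - gammaBorder p σ (-K1 p 1)) (borderTangent p σ t)
      < tangentAbscissa (gammaBorder p σ s - gammaBorder p σ (-K1 p 1)) (borderTangent p σ s)
    rw [hform s hs, hform t ht]
    have := div_lt_div_of_pos_right hst (show 0 < p - 1 by linarith)
    linarith

/-- The common direction `(-1, 0)` at the junction makes the concatenation differentiable there. The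
first arc returns to its initial height, so on the second arc `tangentAbscissa` is shifted only by
the constant horizontal displacement of the first. -/
theorem Arc.IsDecreasing.concat {c d : Arc} {T U : ℝ → Plane} (hc : c.IsDecreasing T)
    (hd : d.IsDecreasing U) : (c.concat d).IsDecreasing
      fun s => if s ≤ c.b - c.a then T (s + c.a) else U (s + d.a - (c.b - c.a)) := by
  set l := c.b - c.a with hl
  set m := d.b - d.a with hm
  have hl0 : 0 ≤ l := sub_nonneg.2 hc.le
  have hm0 : 0 ≤ m := sub_nonneg.2 hd.le
  set f := (c.concat d).toFun with hf
  set V : ℝ → Plane := fun s => if s ≤ l then T (s + c.a) else U (s + d.a - l) with hV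
  have hla : l + c.a = c.b := by rw [hl]; ring
  have f1 : ∀ s, s ≤ l → f s = c.toFun (s + c.a) := fun s hs => if_pos hs
  -- The two branches agree at the junction, so each formula is available on a closed interval.
  have f2 : ∀ s, l ≤ s → f s = d.toFun (s + d.a - l) + c.toFun c.b - d.toFun d.a := by
    intro s hs
    rcases hs.eq_or_lt with h | h
    · rw [f1 s h.ge, ← h, hla]; simp
    · exact if_neg h.not_ge
  have V1 : ∀ s, s ≤ l → V s = T (s + c.a) := fun s hs => if_pos hs
  have V2 : ∀ s, l ≤ s → V s = U (s + d.a - l) := by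
    intro s hs
    rcases hs.eq_or_lt with h | h
    · rw [V1 s h.ge, ← h, hla, hc.tangent_right]; simp [hd.tangent_left]
    · exact if_neg h.not_ge
  have m1 : ∀ s ∈ Icc 0 l, s + c.a ∈ Icc c.a c.b := fun s hs =>
    ⟨by linarith [hs.1], by linarith [hs.2]⟩
  have m2 : ∀ s ∈ Icc l (l + m), s + d.a - l ∈ Icc d.a d.b := fun s hs =>
    ⟨by linarith [hs.1], by linarith [hs.2]⟩
  have hunion : Icc 0 (l + m) = Icc 0 l ∪ Icc l (l + m) :=
    (Icc_union_Icc_eq_Icc hl0 (by linarith)).symm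
  have f0 : f 0 = c.toFun c.a := by rw [f1 0 hl0, zero_add]
  have fend : f (l + m) = d.toFun d.b + c.toFun c.b - d.toFun d.a := by
    rw [f2 _ (by linarith)]; congr 3; rw [hm]; ring
  have D1 : ∀ s ∈ Icc 0 l, HasDerivWithinAt f (V s) (Icc 0 l) s := by
    intro s hs
    rw [V1 s hs.2]
    have h1 := (hc.hasDerivWithinAt _ (m1 s hs)).scomp s
      ((hasDerivWithinAt_id s (Icc 0 l)).add_const c.a) m1
    rw [one_smul] at h1
    exact h1.congr_of_mem (fun t ht => f1 t ht.2) hs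
  have D2 : ∀ s ∈ Icc l (l + m), HasDerivWithinAt f (V s) (Icc l (l + m)) s := by
    intro s hs
    rw [V2 s hs.1]
    have h1 := (hd.hasDerivWithinAt _ (m2 s hs)).scomp s
      (((hasDerivWithinAt_id s (Icc l (l + m))).add_const d.a).sub_const l) m2
    rw [one_smul] at h1
    exact ((h1.add_const (c.toFun c.b)).sub_const (d.toFun d.a)).congr_of_mem
      (fun t ht => f2 t ht.1) hs
  refine ⟨by change 0 ≤ l + m; linarith, fun s hs => ?_, fun s hs => ?_, ?_, ?_, ?_, ?_⟩
  · change s ∈ Icc 0 (l + m) at hs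
    change HasDerivWithinAt f (V s) (Icc 0 (l + m)) s
    rw [hunion]
    rcases lt_trichotomy s l with h | h | h
    · refine (D1 s ⟨hs.1, h.le⟩).union ?_
      exact hasDerivWithinAt_iff_hasFDerivWithinAt.2 (.of_notMem_closure
        (by rw [closure_Icc]; exact fun h' => h.not_ge h'.1))
    · exact (D1 s ⟨hs.1, h.le⟩).union (D2 s ⟨h.ge, hs.2⟩)
    · refine HasDerivWithinAt.union ?_ (D2 s ⟨h.le, hs.2⟩)
      exact hasDerivWithinAt_iff_hasFDerivWithinAt.2 (.of_notMem_closure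
        (by rw [closure_Icc]; exact fun h' => h.not_ge h'.2))
  · change s ∈ Icc 0 (l + m) at hs
    rcases le_total s l with h | h
    · rw [V1 s h]; exact hc.norm_eq _ (m1 s ⟨hs.1, h⟩)
    · rw [V2 s h]; exact hd.norm_eq _ (m2 s ⟨h, hs.2⟩)
  · change V 0 = _
    rw [V1 0 hl0, zero_add, hc.tangent_left]
  · change V (l + m) = _
    rw [V2 _ (by linarith), ← hd.tangent_right]; congr 1; rw [hm]; ring
  · change f (l + m) 1 = f 0 1
    rw [fend, f0]
    simp only [PiLp.add_apply, PiLp.sub_apply, hd.height_eq, hc.height_eq]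
    ring
  · change StrictAntiOn (fun s => tangentAbscissa (f s - f 0) (V s)) (Icc 0 (l + m))
    rw [hunion]
    refine StrictAntiOn.union (c := l) ?_ ?_ (isGreatest_Icc hl0) (isLeast_Icc (by linarith))
    · intro s hs t ht hst
      simp only
      rw [f1 s hs.2, f1 t ht.2, V1 s hs.2, V1 t ht.2, f0]
      exact hc.strictAntiOn (m1 s hs) (m1 t ht) (by linarith)
    · intro s hs t ht hst
      simp only
      have key : ∀ s ∈ Icc l (l + m), tangentAbscissa (f s - f 0) (V s)
          = tangentAbscissa (d.toFun (s + d.a - l) - d.toFun d.a) (U (s + d.a - l))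
            + (c.toFun c.b - c.toFun c.a) 0 := by
        intro s hs
        rw [f2 s hs.1, f0, V2 s hs.1,
          show d.toFun (s + d.a - l) + c.toFun c.b - d.toFun d.a - c.toFun c.a
            = (d.toFun (s + d.a - l) - d.toFun d.a) + (c.toFun c.b - c.toFun c.a) by abel,
          tangentAbscissa_add]
        congr 1
        simp [tangentAbscissa, hc.height_eq]
      rw [key s hs, key t ht]
      exact add_lt_add_left (hd.strictAntiOn (m2 s hs) (m2 t ht) (by linarith)) _

theorem flatCoreArc_isDecreasing (hp : 2 < p) {σ l : ℕ → ℝ} (hσ : ∀ j, σ j = 1 ∨ σ j = -1)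
    (hl : ∀ j, 0 ≤ l j) (n : ℕ) :
    (flatCoreArc p n σ l).a = 0 ∧ ∃ T, (flatCoreArc p n σ l).IsDecreasing T := by
  have hj : ∀ j, ∃ T, ((segmentArc (l j)).concat (loopArc p (σ j))).IsDecreasing T := fun j =>
    ⟨_, (segmentArc_isDecreasing (hl j)).concat (loopArc_isDecreasing hp (hσ j))⟩
  induction n with
  | zero => exact ⟨rfl, hj 0⟩
  | succ n ih =>
    obtain ⟨-, T, hT⟩ := ih
    obtain ⟨U, hU⟩ := hj (n + 1)
    exact ⟨rfl, _, hT.concat hU⟩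

/-- Equal end points and tangents would give equal values of a quantity that is strictly decreasing
along the entire concatenation, hence along every nondegenerate subinterval. -/
theorem IsFlatCore.not_isClosedCurve (h : IsRegularRepr p γ x y) (hγ : IsFlatCore p γ) :
    ¬ IsClosedCurve γ := by
  obtain ⟨hp2, n, σ, l, hσ, hl, s₀, ℓ, hs₀, hsℓ, hrep⟩ := hγ
  obtain ⟨ha, T, hT⟩ := flatCoreArc_isDecreasing hp2 hσ hl n
  set c := flatCoreArc p n σ l
  have hm : ∀ s ∈ Icc 0 ℓ, s + s₀ ∈ Icc c.a c.b := fun s hs =>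
    ⟨by rw [ha]; linarith [hs.1], by linarith [hs.2]⟩
  obtain ⟨hℓ, hiff⟩ := h.isClosedCurve_iff_of_isRepresentedBy hrep (T := fun s => T (s + s₀))
    (fun s hs => by
      have := (hT.hasDerivWithinAt _ (hm s hs)).scomp s
        ((hasDerivWithinAt_id s (Icc 0 ℓ)).add_const s₀) hm
      rw [one_smul] at this
      exact this)
    (fun s hs => hT.norm_eq _ (hm s hs))
  rw [hiff]
  rintro ⟨h1, h2⟩
  have := hT.strictAntiOn (hm 0 ⟨le_rfl, hℓ.le⟩) (hm ℓ ⟨hℓ.le, le_rfl⟩) (by linarith)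
  simp only [h1, h2] at this
  exact lt_irrefl _ this

end NotClosed

/-! ### Circles and closed wavelike curves -/

theorem exists_int_of_cos_sin_eq {α β : ℝ} (hc : Real.cos α = Real.cos β)
    (hs : Real.sin α = Real.sin β) : ∃ n : ℤ, α = β + n * (2 * Real.pi) := by
  have h : Real.cos (α - β) = 1 := by
    rw [Real.cos_sub, hc, hs, ← pow_two, ← pow_two, Real.cos_sq_add_sin_sq]
  obtain ⟨n, hn⟩ := (Real.cos_eq_one_iff _).1 h
  exact ⟨n, by linarith⟩

theorem exists_nat_of_int_mul {n : ℤ} {ℓ a : ℝ} (hℓ : 0 < ℓ) (ha : 0 < a) (h : ℓ = n * a) :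
    ∃ N : ℕ, 1 ≤ N ∧ ℓ = N * a := by
  have hn : 0 < n := by
    have : (0 : ℝ) < n := pos_of_mul_pos_left (h ▸ hℓ) ha.le
    exact_mod_cast this
  lift n to ℕ using hn.le
  exact ⟨n, by exact_mod_cast hn, by simpa using h⟩

/-- The unit tangent of the circle. -/
def circTangent (s : ℝ) : Plane := !₂[-Real.sin s, Real.cos s]

theorem hasDerivAt_gammaCirc (s : ℝ) : HasDerivAt gammaCirc (circTangent s) s := by
  rw [hasDerivAt_plane_iff]
  exact ⟨by simpa [gammaCirc, circTangent] using Real.hasDerivAt_cos s,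
    by simpa [gammaCirc, circTangent] using Real.hasDerivAt_sin s⟩

theorem norm_circTangent (s : ℝ) : ‖circTangent s‖ = 1 := by
  rw [plane_norm]; simp [circTangent]

theorem spow_injective {r : ℝ} (hr : r ≠ 0) : Function.Injective (spow r) := by
  intro z w h
  have := congrArg (spow (1 / r)) h
  rwa [spow_spow, spow_spow, mul_one_div_cancel hr, spow_one, spow_one] at this

/-! ### Periods of the wavelike curve -/

section Wave

variable {p q : ℝ}

theorem am1_add_int_mul (hp : 1 < p) (hq0 : 0 ≤ q) (hq1 : q < 1) (s : ℝ) (n : ℤ) :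
    am1 p (s + n * (4 * K1 p q)) q = am1 p s q + n * (2 * Real.pi) := by
  have hk := isAmplitudeKernel_kernel1 hp hq0 hq1
  have hm := measurable_kernel1 p q
  simp only [am1_eq (not_degenerate_of_lt_one hq1)]
  rw [← hk.amplitude_primitive hm (amplitude (kernel1 p q) s + n * (2 * Real.pi))]
  congr 1
  have := hk.primitive_add_int_mul (amplitude (kernel1 p q) s) (2 * n)
  rw [hk.primitive_amplitude hm] at this
  push_cast at this
  rw [show (n : ℝ) * (2 * Real.pi) = 2 * n * Real.pi by ring, this, K1_eq]
  ring

theorem E1_add_int_mul (hp : 1 < p) (hq0 : 0 ≤ q) (hq1 : q < 1) (θ : ℝ) (n : ℤ) :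
    E1 p (θ + n * (2 * Real.pi)) q = E1 p θ q + n * (4 * E1c p q) := by
  have := (isAmplitudeKernel_kernelE1 hp hq0 hq1).primitive_add_int_mul θ (2 * n)
  push_cast at this
  rw [E1_eq, show (n : ℝ) * (2 * Real.pi) = 2 * n * Real.pi by ring, this, E1c, E1_eq, E1_eq]
  ring

/-- A full period moves the curve horizontally by `4(2E - K)` and leaves the height unchanged; this
is the origin of the equation for the modulus of the figure-eight. -/
theorem gammaWave_add_int_mul (hp : 1 < p) (hq0 : 0 ≤ q) (hq1 : q < 1) (s : ℝ) (n : ℤ) :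
    gammaWave p q (s + n * (4 * K1 p q))
      = gammaWave p q s + !₂[n * (4 * (2 * E1c p q - K1 p q)), 0] := by
  have hcn : cnp p (s + n * (4 * K1 p q)) q = cnp p s q := by
    rw [cnp_eq, am1_add_int_mul hp hq0 hq1, Real.cos_add_int_mul_two_pi, cnp_eq]
  rw [gammaWave, hcn, am1_add_int_mul hp hq0 hq1, E1_add_int_mul hp hq0 hq1, gammaWave]
  ext i
  fin_cases i
  · simp; ring
  · simp

theorem waveTangent_add_int_mul (hp : 1 < p) (hq0 : 0 ≤ q) (hq1 : q < 1) (s : ℝ) (n : ℤ) :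
    waveTangent p q (s + n * (4 * K1 p q)) = waveTangent p q s := by
  simp only [waveTangent, waveSin, waveCos, am1_add_int_mul hp hq0 hq1,
    Real.sin_add_int_mul_two_pi]

/-- Points of the wavelike curve with equal height and tangent differ by full periods. -/
theorem exists_int_of_waveTangent_eq (hp : 1 < p) (hq0 : 0 < q) (hq1 : q < 1) {s t : ℝ}
    (hy : gammaWave p q t 1 = gammaWave p q s 1) (hT : waveTangent p q t = waveTangent p q s) :
    ∃ n : ℤ, t = s + n * (4 * K1 p q) := by
  have hr : 2 - 2 / p ≠ 0 := by
    have : 2 / p < 2 := by rw [div_lt_iff₀] <;> linarith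
    linarith
  have hpp : 0 < p / (p - 1) := div_pos (by linarith) (by linarith)
  have hcos : Real.cos (am1 p t q) = Real.cos (am1 p s q) := by
    rw [gammaWave_snd hp, gammaWave_snd hp, neg_inj,
      mul_right_inj' (by positivity : q * (p / (p - 1)) ≠ 0)] at hy
    exact spow_injective hr hy
  have h0 := congrArg (fun z : Plane => z 0) hT
  have h1 := congrArg (fun z : Plane => z 1) hT
  simp only [waveTangent, Matrix.cons_val_zero, Matrix.cons_val_one] at h0 h1
  have hC : waveCos p q t = waveCos p q s := by
    rw [← sq_eq_sq₀ (waveCos_pos hq0.le hq1 t).le (waveCos_pos hq0.le hq1 s).le,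
      waveCos_sq hq0.le hq1, waveCos_sq hq0.le hq1]
    linarith
  have hS : waveSin p q t = waveSin p q s := by
    rw [hC] at h1
    have := mul_right_cancel₀ (waveCos_pos hq0.le hq1 s).ne' h1
    linarith
  have hsin : Real.sin (am1 p t q) = Real.sin (am1 p s q) := mul_left_cancel₀ hq0.ne' hS
  obtain ⟨n, hn⟩ := exists_int_of_cos_sin_eq hcos hsin
  refine ⟨n, ?_⟩
  have hk := isAmplitudeKernel_kernel1 hp hq0.le hq1
  rw [← am1_add_int_mul hp hq0.le hq1] at hn
  simp only [am1_eq (not_degenerate_of_lt_one hq1)] at hn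
  exact (hk.strictMono_amplitude (measurable_kernel1 p q)).injective hn

end Wave

/-! ### Circles and figure-eights are closed elasticae; closed wavelike curves are figure-eights -/

section Repr

variable {p q : ℝ} {γ : ℝ → Plane} {x y : ℝ → ℝ}

theorem IsNFoldCircle.isPElastica_and_isClosedCurve (hp : 1 < p) (himm : IsImmersedW2p p γ)
    (h : IsRegularRepr p γ x y) {N : ℕ} (hγ : IsNFoldCircle N γ) :
    IsPElastica p γ ∧ IsClosedCurve γ := by
  obtain ⟨s₀, hrep⟩ := hγ
  have hder := fun s => (hasDerivAt_gammaCirc (s + s₀)).comp_add_const s s₀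
  constructor
  · refine h.isPElastica_of_isRepresentedBy hp himm (k := fun _ => 1) (C := 1) (c₀ := 0) (c₁ := 0)
      hrep hder (fun s => norm_circTangent _) (fun s => ?_) (fun s => ?_) fun s => ?_
    · simpa [circTangent] using ((Real.hasDerivAt_sin (s + s₀)).comp_add_const s s₀).fun_neg
    · simpa [circTangent] using (Real.hasDerivAt_cos (s + s₀)).comp_add_const s s₀
    · simp [spow]
  · rw [(h.isClosedCurve_iff_of_isRepresentedBy hrep (fun s _ => (hder s).hasDerivWithinAt)
      fun s _ => norm_circTangent _).2]
    have e : 2 * (N : ℝ) * Real.pi + s₀ = 0 + s₀ + N * (2 * Real.pi) := by ring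
    rw [e, gammaCirc, gammaCirc, circTangent, circTangent, Real.cos_add_nat_mul_two_pi,
      Real.sin_add_nat_mul_two_pi]
    exact ⟨rfl, rfl⟩

theorem IsNFoldFigureEight.isPElastica_and_isClosedCurve (hp : 1 < p) (himm : IsImmersedW2p p γ)
    (h : IsRegularRepr p γ x y) (hq : IsFigureEightModulus p q) {N : ℕ}
    (hγ : IsNFoldFigureEight p q N γ) : IsPElastica p γ ∧ IsClosedCurve γ := by
  obtain ⟨⟨hq0, hq1⟩, hEK⟩ := (isFigureEightModulus_iff hp).1 hq
  obtain ⟨s₀, hrep⟩ := hγ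
  have hder := fun s => (hasDerivAt_gammaWave hp hq0.le hq1 (s + s₀)).comp_add_const s s₀
  constructor
  · refine h.isPElastica_of_isRepresentedBy hp himm (k := fun s => 2 * q * cnp p (s + s₀) q)
      (C := 0) (c₀ := 0) (c₁ := -((2 * q) ^ (p - 1) * ((p - 1) / (q * p))))
      hrep hder (fun s => norm_waveTangent hq0.le hq1 _) (fun s => ?_) (fun s => ?_) fun s => ?_
    · exact (hasDerivAt_waveTangent hp hq0.le hq1 (s + s₀)).1.comp_add_const s s₀
    · exact (hasDerivAt_waveTangent hp hq0.le hq1 (s + s₀)).2.comp_add_const s s₀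
    · rw [spow_wave_curvature hp hq0]; ring
  · rw [(h.isClosedCurve_iff_of_isRepresentedBy hrep (fun s _ => (hder s).hasDerivWithinAt)
      fun s _ => norm_waveTangent hq0.le hq1 _).2]
    have e : 4 * (N : ℝ) * K1 p q + s₀ = 0 + s₀ + ((N : ℤ) : ℝ) * (4 * K1 p q) := by
      push_cast; ring
    rw [e, gammaWave_add_int_mul hp hq0.le hq1, waveTangent_add_int_mul hp hq0.le hq1, hEK]
    refine ⟨?_, rfl⟩
    ext i; fin_cases i <;> simp

/-- Equality of heights and tangents makes the length a multiple of the period, and a nonzero one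
since `ℓ > 0`. Equality of abscissae then forces the displacement per period to vanish. -/
theorem IsRegularRepr.exists_isNFoldFigureEight (hp : 1 < p) (h : IsRegularRepr p γ x y)
    (hq : q ∈ Ioo (0 : ℝ) 1) {s₀ ℓ : ℝ}
    (hrep : IsRepresentedBy γ (fun s => gammaWave p q (s + s₀)) ℓ) (hcl : IsClosedCurve γ) :
    IsFigureEightModulus p q ∧ ∃ N : ℕ, 1 ≤ N ∧ IsNFoldFigureEight p q N γ := by
  obtain ⟨hq0, hq1⟩ := hq
  have hder := fun s => (hasDerivAt_gammaWave hp hq0.le hq1 (s + s₀)).comp_add_const s s₀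
  obtain ⟨hℓ, hiff⟩ := h.isClosedCurve_iff_of_isRepresentedBy hrep
    (fun s _ => (hder s).hasDerivWithinAt) fun s _ => norm_waveTangent hq0.le hq1 _
  obtain ⟨h1, h2⟩ := hiff.1 hcl
  obtain ⟨n, hn⟩ := exists_int_of_waveTangent_eq hp hq0 hq1
    (congrArg (fun z : Plane => z 1) h1).symm h2.symm
  have hK := K1_pos hp hq0.le hq1
  rw [hn, gammaWave_add_int_mul hp hq0.le hq1] at h1
  obtain ⟨N, hN, hNℓ⟩ := exists_nat_of_int_mul (n := n) hℓ (by positivity : 0 < 4 * K1 p q)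
    (by linarith)
  have hn0 : (n : ℝ) ≠ 0 := by
    intro h0
    rw [h0] at hn
    linarith
  refine ⟨(isFigureEightModulus_iff hp).2 ⟨⟨hq0, hq1⟩, ?_⟩, N, hN, s₀, ?_⟩
  · have := congrArg (fun z : Plane => z 0) h1
    simp [hn0] at this
    linarith
  · rwa [show 4 * (N : ℝ) * K1 p q = ℓ by rw [hNℓ]; ring]

end Repr

/-! ### The curvature equation in an adapted frame -/

/-- Solutions of the curvature equation in a frame in which the curvature depends on the height
only: `(X, Y)` are the coordinates of the curve, `(a, b)` is its unit tangent, `u` its speed, and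
`k` its curvature. -/
structure AdaptedSolution (p C c lam : ℝ) (u X Y a b k : ℝ → ℝ) : Prop where
  c_pos : 0 < c
  u_pos : ∀ t, 0 < u t
  deriv_X : ∀ t, HasDerivAt X (u t * a t) t
  deriv_Y : ∀ t, HasDerivAt Y (u t * b t) t
  continuous_a : Continuous a
  continuous_b : Continuous b
  sq_add : ∀ t, a t ^ 2 + b t ^ 2 = 1
  curv : ∀ t, k t = spow (1 / (p - 1)) (C - c * Y t)
  deriv_a : ∀ t ∈ Ioo (0 : ℝ) 1, HasDerivAt a (-(k t * u t * b t)) t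
  deriv_b : ∀ t ∈ Ioo (0 : ℝ) 1, HasDerivAt b (k t * u t * a t) t
  energy : ∀ t ∈ Icc (0 : ℝ) 1, (p - 1) * |k t| ^ p = lam + p * c * a t

/-- Both ends have equal positions and tangents. -/
structure ClosesUp (X Y a b : ℝ → ℝ) : Prop where
  X_eq : X 0 = X 1
  Y_eq : Y 0 = Y 1
  a_eq : a 0 = a 1
  b_eq : b 0 = b 1

/-! ### Solutions with constant tangent or of orbitlike type do not close up -/

section Adapted

variable {p C c lam : ℝ} {u X Y a b k : ℝ → ℝ}

theorem AdaptedSolution.continuous_k (hp : 1 < p) (h : AdaptedSolution p C c lam u X Y a b k) :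
    Continuous k := by
  rw [funext h.curv]
  have hY : Continuous Y := continuous_iff_continuousAt.2 fun t => (h.deriv_Y t).continuousAt
  exact (continuous_spow (one_div_pos.2 (by linarith))).comp (by fun_prop)

theorem AdaptedSolution.neg_one_le (h : AdaptedSolution p C c lam u X Y a b k) (t : ℝ) :
    -1 ≤ a t := by nlinarith [h.sq_add t, sq_nonneg (b t)]

theorem AdaptedSolution.le_one (h : AdaptedSolution p C c lam u X Y a b k) (t : ℝ) :
    a t ≤ 1 := by nlinarith [h.sq_add t, sq_nonneg (b t)]

/-- A curve whose tangent is constant and horizontal does not close up. -/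
theorem AdaptedSolution.not_closesUp_of_const (h : AdaptedSolution p C c lam u X Y a b k) {δ : ℝ}
    (hδ : δ ^ 2 = 1) (ha : ∀ t ∈ Icc (0 : ℝ) 1, a t = δ) : ¬ ClosesUp X Y a b := by
  intro hcl
  have hz := deriv_eq_zero_of_nonpos_of_eq (f := fun t => -δ * X t) zero_lt_one
    (fun t _ => ((h.deriv_X t).const_mul (-δ)).continuousAt.continuousWithinAt)
    (fun t _ => (h.deriv_X t).const_mul (-δ))
    (fun t ht => by
      rw [ha t (Ioo_subset_Icc_self ht)]
      nlinarith [h.u_pos t]) (by simp only [hcl.X_eq])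
  have hm : (1 / 2 : ℝ) ∈ Ioo (0 : ℝ) 1 := by constructor <;> norm_num
  have := hz _ hm
  rw [ha _ (Ioo_subset_Icc_self hm)] at this
  nlinarith [h.u_pos (1 / 2)]

/-- The first integral makes `lam + p c a` nonnegative, which for `lam ≤ -p c` leaves only `a = 1`.
-/
theorem AdaptedSolution.not_closesUp_of_le_neg (hp : 1 < p)
    (h : AdaptedSolution p C c lam u X Y a b k) (hlam : lam ≤ -(p * c)) : ¬ ClosesUp X Y a b := by
  refine h.not_closesUp_of_const (δ := 1) (by norm_num) fun t ht => le_antisymm (h.le_one t) ?_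
  have h1 := h.energy t ht
  have h2 : 0 ≤ (p - 1) * |k t| ^ p :=
    mul_nonneg (by linarith) (Real.rpow_nonneg (abs_nonneg _) _)
  have h3 : 0 < p * c := mul_pos (by linarith) h.c_pos
  by_contra hlt
  nlinarith [mul_pos h3 (sub_pos.2 (not_le.1 hlt))]

/-- A nonvanishing continuous function on `[0, 1]` has a constant sign. -/
theorem exists_sign_of_ne_zero {f : ℝ → ℝ} (hf : Continuous f)
    (h0 : ∀ t ∈ Icc (0 : ℝ) 1, f t ≠ 0) :
    ∃ δ : ℝ, (δ = 1 ∨ δ = -1) ∧ ∀ t ∈ Icc (0 : ℝ) 1, f t = δ * |f t| := by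
  rcases lt_or_gt_of_ne (h0 0 (by simp)) with hneg | hpos
  · refine ⟨-1, Or.inr rfl, fun t ht => ?_⟩
    have : f t ≤ 0 := by
      by_contra hcon
      obtain ⟨s, hs, hfs⟩ := intermediate_value_Icc ht.1 hf.continuousOn
        (show (0 : ℝ) ∈ Icc (f 0) (f t) from ⟨hneg.le, (not_le.1 hcon).le⟩)
      exact h0 s ⟨hs.1, hs.2.trans ht.2⟩ hfs
    rw [abs_of_nonpos this]; ring
  · refine ⟨1, Or.inl rfl, fun t ht => ?_⟩
    have : 0 ≤ f t := by
      by_contra hcon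
      obtain ⟨s, hs, hfs⟩ := intermediate_value_Icc' ht.1 hf.continuousOn
        (show (0 : ℝ) ∈ Icc (f t) (f 0) from ⟨(not_le.1 hcon).le, hpos.le⟩)
      exact h0 s ⟨hs.1, hs.2.trans ht.2⟩ hfs
    rw [abs_of_nonneg this, one_mul]

/-- Solutions of orbitlike type do not close up. -/
theorem AdaptedSolution.not_closesUp_of_lt (hp : 1 < p)
    (h : AdaptedSolution p C c lam u X Y a b k) (hlam : p * c < lam) : ¬ ClosesUp X Y a b := by
  intro hcl
  have hp0 : 0 < p := by linarith
  have hp1 : 0 < p - 1 := by linarith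
  have hR : 0 < p * c := mul_pos hp0 h.c_pos
  have hk0 : ∀ t ∈ Icc (0 : ℝ) 1, k t ≠ 0 := by
    intro t ht hkt
    have h1 := h.energy t ht
    rw [hkt, abs_zero, Real.zero_rpow hp0.ne', mul_zero] at h1
    nlinarith [h.neg_one_le t]
  obtain ⟨δ, hδ, hsign⟩ := exists_sign_of_ne_zero (h.continuous_k hp) hk0
  have hδ2 : δ ^ 2 = 1 := by rcases hδ with h | h <;> rw [h] <;> norm_num
  -- The value of `|k|` that the first integral assigns to `a = 0`; thus `|k| ≥ m` where `a ≥ 0` and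
  -- `|k| ≤ m` where `a ≤ 0`.
  set m := (lam / (p - 1)) ^ (1 / p) with hm
  have hm0 : 0 < lam / (p - 1) := div_pos (by linarith) hp1
  have hmpos : 0 < m := Real.rpow_pos_of_pos hm0 _
  have hmp : m ^ p = lam / (p - 1) := by
    rw [hm, ← Real.rpow_mul hm0.le, one_div_mul_cancel hp0.ne', Real.rpow_one]
  have hpow : ∀ t ∈ Icc (0 : ℝ) 1, |k t| ^ p = m ^ p + p * c / (p - 1) * a t := by
    intro t ht
    rw [hmp]
    have := h.energy t ht
    field_simp
    linarith
  have hsgn : ∀ t ∈ Icc (0 : ℝ) 1, a t * (1 - |k t| / m) ≤ 0 := by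
    intro t ht
    have hc : 0 < p * c / (p - 1) := by positivity
    rcases le_total 0 (a t) with ha | ha
    · refine mul_nonpos_of_nonneg_of_nonpos ha ?_
      rw [sub_nonpos, one_le_div hmpos, ← Real.rpow_le_rpow_iff hmpos.le (abs_nonneg _) hp0,
        hpow t ht]
      nlinarith [mul_nonneg hc.le ha]
    · refine mul_nonpos_of_nonpos_of_nonneg ha ?_
      rw [sub_nonneg, div_le_one hmpos, ← Real.rpow_le_rpow_iff (abs_nonneg _) hmpos.le hp0,
        hpow t ht]
      nlinarith [mul_nonneg hc.le (neg_nonneg.2 ha)]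
  have hXc : Continuous X := continuous_iff_continuousAt.2 fun t => (h.deriv_X t).continuousAt
  have hbc := h.continuous_b
  -- As for the orbitlike model curve: since `b' = k u a`, this function has the nonpositive
  -- derivative `u a (1 - |k|/m)` and equal end values.
  have hz := deriv_eq_zero_of_nonpos_of_eq (f := fun t => X t - δ * b t / m)
    (f' := fun t => u t * (a t * (1 - |k t| / m))) zero_lt_one (by fun_prop)
    (fun t ht => ((h.deriv_X t).sub (((h.deriv_b t ht).const_mul δ).div_const m)).congr_deriv (by
      linear_combination (-(u t * a t * δ / m)) * hsign t (Ioo_subset_Icc_self ht)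
        - (u t * a t * |k t| / m) * hδ2))
    (fun t ht => mul_nonpos_of_nonneg_of_nonpos (h.u_pos t).le
      (hsgn t (Ioo_subset_Icc_self ht)))
    (by simp only [hcl.X_eq, hcl.b_eq])
  have ha : ∀ t ∈ Ioo (0 : ℝ) 1, a t = 0 := by
    intro t ht
    have ht' := Ioo_subset_Icc_self ht
    rcases mul_eq_zero.1 ((mul_eq_zero.1 (hz t ht)).resolve_left (h.u_pos t).ne') with h0 | h0
    · exact h0
    · rw [sub_eq_zero, eq_comm, div_eq_one_iff_eq hmpos.ne'] at h0
      have h1 := hpow t ht'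
      rw [h0] at h1
      have : p * c / (p - 1) * a t = 0 := by linarith
      exact (mul_eq_zero.1 this).resolve_left (by positivity)
  have hb := deriv_eq_zero_of_eq_zero ha h.deriv_a
  have hmem : (1 / 2 : ℝ) ∈ Ioo (0 : ℝ) 1 := by constructor <;> norm_num
  have e1 := ha _ hmem
  have e2 := hb _ hmem
  have e3 := h.sq_add (1 / 2)
  have e4 : b (1 / 2) = 0 := (mul_eq_zero.1 (neg_eq_zero.1 e2)).resolve_left
    (mul_ne_zero (hk0 _ (Ioo_subset_Icc_self hmem)) (h.u_pos (1 / 2)).ne')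
  rw [e1, e4] at e3
  norm_num at e3

end Adapted

section Adapted

variable {p C c lam : ℝ} {u X Y a b k : ℝ → ℝ}

/-! ### Solutions of borderline type do not close up -/

theorem AdaptedSolution.continuous_coord (h : AdaptedSolution p C c lam u X Y a b k) :
    Continuous X ∧ Continuous Y :=
  ⟨continuous_iff_continuousAt.2 fun t => (h.deriv_X t).continuousAt,
    continuous_iff_continuousAt.2 fun t => (h.deriv_Y t).continuousAt⟩

theorem AdaptedSolution.mul_curv (hp : 1 < p) (h : AdaptedSolution p C c lam u X Y a b k) (t : ℝ) :
    k t * (C - c * Y t) = |k t| ^ p := by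
  have hw : C - c * Y t = spow (p - 1) (k t) := by rw [h.curv, spow_inv_spow hp]
  rw [hw, mul_comm, spow_mul_self (by linarith), sub_add_cancel]

theorem AdaptedSolution.abs_height (hp : 1 < p) (h : AdaptedSolution p C c lam u X Y a b k)
    (t : ℝ) : |C - c * Y t| = |k t| ^ (p - 1) := by
  rw [← abs_spow (by linarith : p - 1 ≠ 0), h.curv, spow_inv_spow hp]

variable {s : ℝ → ℝ}

/-- Away from the flat points, `X + s / (p - 1)` and a bounded correction are constant. -/
theorem AdaptedSolution.hasDerivAt_abscissa (hp : 1 < p)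
    (h : AdaptedSolution p C c (p * c) u X Y a b k) (hs : ∀ t, HasDerivAt s (u t) t) {t : ℝ}
    (ht : t ∈ Ioo (0 : ℝ) 1) (hk : k t ≠ 0) :
    HasDerivAt (fun t => X t - (C - c * Y t) / c * (b t / (1 + a t)) + s t / (p - 1)) 0 t := by
  have hp0 : 0 < p := by linarith
  have hp1 : p - 1 ≠ 0 := by linarith
  have hc := h.c_pos.ne'
  have hen := h.energy t (Ioo_subset_Icc_self ht)
  rw [← h.mul_curv hp] at hen
  -- For `lam = p c` the first integral reads `(p-1)|k|^p = p c (1 + a)`, so the tangent is `(-1,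
  -- 0)` only where the curvature vanishes.
  have ha : 1 + a t ≠ 0 := by
    intro h0
    have h1 := h.energy t (Ioo_subset_Icc_self ht)
    rw [show p * c + p * c * a t = p * c * (1 + a t) by ring, h0, mul_zero] at h1
    have : 0 < |k t| ^ p := Real.rpow_pos_of_pos (abs_pos.2 hk) _
    exact (mul_pos (by linarith : 0 < p - 1) this).ne' h1
  have h1 := (((h.deriv_Y t).const_mul c).const_sub C).div_const c
  have h2 := (h.deriv_b t ht).fun_div ((h.deriv_a t ht).const_add 1) ha
  have h3 := ((h.deriv_X t).fun_sub (h1.fun_mul h2)).fun_add ((hs t).div_const (p - 1))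
  refine h3.congr_deriv ?_
  have hsq := h.sq_add t
  have hb : b t ^ 2 = (1 - a t) * (1 + a t) := by linear_combination hsq
  have e1 : (k t * u t * a t * (1 + a t) - b t * -(k t * u t * b t)) / (1 + a t) ^ 2
      = k t * u t / (1 + a t) := by
    rw [div_eq_div_iff (pow_ne_zero 2 ha) ha]
    linear_combination k t * u t * (1 + a t) * hb
  have e2 : -(c * (u t * b t)) / c * (b t / (1 + a t)) = -(u t * (1 - a t)) := by
    field_simp
    linear_combination -u t * hb
  rw [e1, e2]
  field_simp
  linear_combination -u t * hen

/-- The correction is controlled by the curvature. -/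
theorem AdaptedSolution.abs_correction_le (hp : 1 < p)
    (h : AdaptedSolution p C c (p * c) u X Y a b k) {t : ℝ} (ht : t ∈ Icc (0 : ℝ) 1) :
    |b t| ≤ Real.sqrt (2 * (p - 1) / (p * c)) * |k t| ^ (p / 2) ∧
    |(C - c * Y t) / c * (b t / (1 + a t))|
      ≤ Real.sqrt (2 * (p - 1) / (p * c)) * (p / (p - 1)) * |k t| ^ (p / 2 - 1) := by
  have hp0 : 0 < p := by linarith
  have hp1 : 0 < p - 1 := by linarith
  have hc := h.c_pos
  have hen := h.energy t ht
  -- `b² = (1 - a)(1 + a) ≤ 2(1 + a)`, and `1 + a` is a multiple of `|k|^p`.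
  have hb : |b t| ≤ Real.sqrt (2 * (p - 1) / (p * c)) * |k t| ^ (p / 2) := by
    refine abs_le_of_sq_le_sq ?_ (by positivity)
    rw [mul_pow, Real.sq_sqrt (by positivity), ← Real.rpow_natCast (|k t| ^ (p / 2)) 2,
      ← Real.rpow_mul (abs_nonneg _),
      show p / 2 * ((2 : ℕ) : ℝ) = p by push_cast; ring]
    have e : 2 * (p - 1) / (p * c) * |k t| ^ p = 2 * (1 + a t) := by
      field_simp
      linear_combination hen
    rw [e]
    nlinarith [h.sq_add t, h.le_one t, h.neg_one_le t]
  refine ⟨hb, ?_⟩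
  rcases eq_or_ne (k t) 0 with hk | hk
  · have : C - c * Y t = 0 := by
      have := h.abs_height hp t
      rwa [hk, abs_zero, Real.zero_rpow hp1.ne', abs_eq_zero] at this
    rw [this, zero_div, zero_mul, abs_zero]
    positivity
  · have hkp : 0 < |k t| := abs_pos.2 hk
    have ha : 1 + a t = (p - 1) / (p * c) * |k t| ^ p := by
      field_simp
      linear_combination -hen
    have hapos : 0 < 1 + a t := by rw [ha]; positivity
    rw [abs_mul, abs_div, abs_div, abs_of_pos hc, abs_of_pos hapos, h.abs_height hp]
    calc |k t| ^ (p - 1) / c * (|b t| / (1 + a t))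
        ≤ |k t| ^ (p - 1) / c * (Real.sqrt (2 * (p - 1) / (p * c)) * |k t| ^ (p / 2) / (1 + a t)) := by
          gcongr
      _ = Real.sqrt (2 * (p - 1) / (p * c)) * (p / (p - 1)) * |k t| ^ (p / 2 - 1) := by
          have e : |k t| ^ (p / 2 - 1) * |k t| ^ p = |k t| ^ (p - 1) * |k t| ^ (p / 2) := by
            rw [← Real.rpow_add hkp, ← Real.rpow_add hkp]; congr 1; ring
          have hpp : 0 < |k t| ^ p := Real.rpow_pos_of_pos hkp _
          rw [ha]
          generalize Real.sqrt (2 * (p - 1) / (p * c)) = σ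
          generalize |k t| ^ (p / 2 - 1) = A at e ⊢
          generalize |k t| ^ (p / 2) = B at e ⊢
          field_simp
          linear_combination -σ * e

/-- Without flat points the corrected abscissa plus `s/(p-1)` is constant on the whole interval.
Closing up makes the first summand equal at both ends, whereas arclength increases. -/
theorem AdaptedSolution.not_closesUp_of_eq_of_ne_zero (hp : 1 < p)
    (h : AdaptedSolution p C c (p * c) u X Y a b k) (hs : ∀ t, HasDerivAt s (u t) t)
    (hk : ∀ t ∈ Icc (0 : ℝ) 1, k t ≠ 0) : ¬ ClosesUp X Y a b := by
  intro hcl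
  have hp1 : 0 < p - 1 := by linarith
  have hc := h.c_pos.ne'
  obtain ⟨hXc, hYc⟩ := h.continuous_coord
  have hac := h.continuous_a
  have hbc := h.continuous_b
  have hsc : Continuous s := continuous_iff_continuousAt.2 fun t => (hs t).continuousAt
  have ha : ∀ t ∈ Icc (0 : ℝ) 1, 1 + a t ≠ 0 := by
    intro t ht h0
    have h1 := h.energy t ht
    rw [show p * c + p * c * a t = p * c * (1 + a t) by ring, h0, mul_zero] at h1
    have : 0 < |k t| ^ p := Real.rpow_pos_of_pos (abs_pos.2 (hk t ht)) _
    exact (mul_pos hp1 this).ne' h1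
  have hcont : ContinuousOn (fun t => X t - (C - c * Y t) / c * (b t / (1 + a t)) + s t / (p - 1))
      (Icc 0 1) := by
    refine ContinuousOn.add (hXc.continuousOn.sub (ContinuousOn.mul (by fun_prop) ?_)) (by fun_prop)
    exact hbc.continuousOn.div (by fun_prop) ha
  have hmono : s 0 < s 1 := by
    have := strictMono_of_hasDerivAt_pos hs h.u_pos
    exact this zero_lt_one
  have hd : ∀ t ∈ Ioo (0 : ℝ) 1, HasDerivAt
      (fun t => X t - (C - c * Y t) / c * (b t / (1 + a t)) + s t / (p - 1)) 0 t := fun t ht =>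
    h.hasDerivAt_abscissa hp hs ht (hk t (Ioo_subset_Icc_self ht))
  obtain ⟨t, -, ht⟩ := exists_hasDerivAt_eq_slope _ _ zero_lt_one hcont hd
  simp only [hcl.X_eq, hcl.Y_eq, hcl.a_eq, hcl.b_eq, sub_zero, div_one] at ht
  have : (s 1 - s 0) / (p - 1) = 0 := by rw [sub_div]; linarith
  rw [div_eq_zero_iff] at this
  rcases this with h' | h' <;> linarith

/-- If the curvature vanishes somewhere, then `w = C - c Y` satisfies `|w'| ≤ B |w|`: indeed `|b|`
is of order `|k|^(p/2) = |k|^(1-p/2) |w|`, and the first factor is bounded because `p ≤ 2`. Gronwall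
gives `w = 0` throughout, and the curve is a line. -/
theorem AdaptedSolution.not_closesUp_of_eq_of_le_two (hp : 1 < p) (hp2 : p ≤ 2)
    (h : AdaptedSolution p C c (p * c) u X Y a b k) (hs : ∀ t, HasDerivAt s (u t) t)
    (hu : Continuous u) : ¬ ClosesUp X Y a b := by
  by_cases hk : ∀ t ∈ Icc (0 : ℝ) 1, k t ≠ 0
  · exact h.not_closesUp_of_eq_of_ne_zero hp hs hk
  push Not at hk
  obtain ⟨t₀, ht₀, hk0⟩ := hk
  have hp0 : 0 < p := by linarith
  have hp1 : 0 < p - 1 := by linarith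
  have hc := h.c_pos
  have hkc := h.continuous_k hp
  obtain ⟨B, hB⟩ := isCompact_Icc.exists_bound_of_continuousOn (s := Icc (0 : ℝ) 1)
    (f := fun t => c * u t * (Real.sqrt (2 * (p - 1) / (p * c)) * |k t| ^ (1 - p / 2)))
    (Continuous.continuousOn ((hu.const_mul c).mul
      (continuous_const.mul (hkc.abs.rpow_const fun t => Or.inr (by linarith)))))
  have hwd : ∀ t, HasDerivAt (fun t => C - c * Y t) (-(c * (u t * b t))) t := fun t =>
    ((h.deriv_Y t).const_mul c).const_sub C
  have hw0 : C - c * Y t₀ = 0 := by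
    have := h.abs_height hp t₀
    rwa [hk0, abs_zero, Real.zero_rpow hp1.ne', abs_eq_zero] at this
  have hbound : ∀ t ∈ Icc (0 : ℝ) 1, |(-(c * (u t * b t)))| ≤ B * |C - c * Y t| := by
    intro t ht
    have h1 := (h.abs_correction_le hp ht).1
    have h2 := hB t ht
    rw [Real.norm_of_nonneg (by have := (h.u_pos t).le; positivity)] at h2
    have hu0 := h.u_pos t
    rw [h.abs_height hp, abs_neg, abs_mul, abs_mul, abs_of_pos hc, abs_of_pos hu0]
    calc c * (u t * |b t|)
        ≤ c * (u t * (Real.sqrt (2 * (p - 1) / (p * c)) * |k t| ^ (p / 2))) := by gcongr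
      _ = c * u t * (Real.sqrt (2 * (p - 1) / (p * c)) * |k t| ^ (1 - p / 2))
            * |k t| ^ (p - 1) := by
          have e : |k t| ^ (p / 2) = |k t| ^ (1 - p / 2) * |k t| ^ (p - 1) := by
            rw [← Real.rpow_add_of_nonneg (abs_nonneg _) (by linarith) hp1.le]; congr 1; ring
          rw [e]; ring
      _ ≤ B * |k t| ^ (p - 1) := by gcongr
  have hwc : Continuous fun t => C - c * Y t :=
    continuous_iff_continuousAt.2 fun t => (hwd t).continuousAt
  have hzero : ∀ t ∈ Icc (0 : ℝ) 1, C - c * Y t = 0 := by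
    intro t ht
    rcases le_total t₀ t with hle | hle
    · exact eq_zero_of_abs_deriv_le_mul_abs_self_of_eq_zero_right (a := t₀) (b := 1) (K := B)
        (f := fun t => C - c * Y t) hwc.continuousOn (fun r _ => (hwd r).hasDerivWithinAt) hw0
        (fun r hr => hbound r ⟨ht₀.1.trans hr.1, hr.2.le⟩) t ⟨hle, ht.2⟩
    -- The uniqueness lemma runs forward in time; reversing the parameter covers the points before
    -- `t₀`.
    · have hd : ∀ r, HasDerivAt (fun r => C - c * Y (t₀ - r))
          (c * (u (t₀ - r) * b (t₀ - r))) r := fun r =>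
        ((hwd (t₀ - r)).comp_const_sub t₀ r).congr_deriv (by ring)
      have := eq_zero_of_abs_deriv_le_mul_abs_self_of_eq_zero_right (a := 0) (b := t₀) (K := B)
        (f := fun r => C - c * Y (t₀ - r)) (hwc.comp (continuous_sub_left t₀)).continuousOn
        (fun r _ => (hd r).hasDerivWithinAt) (by simpa using hw0)
        (fun r hr => by
          have := hbound (t₀ - r) ⟨by linarith [hr.2], by linarith [hr.1, ht₀.2]⟩
          rwa [abs_neg] at this) (t₀ - t) ⟨by linarith, by linarith [ht.1]⟩
      simpa using this
  refine h.not_closesUp_of_const (δ := -1) (by norm_num) fun t ht => ?_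
  have hen := h.energy t ht
  rw [h.curv, hzero t ht, spow_zero_right, abs_zero, Real.zero_rpow hp0.ne', mul_zero] at hen
  have : p * c * (1 + a t) = 0 := by linarith
  have := (mul_eq_zero.1 this).resolve_left (by positivity)
  linarith

/-- The curvature may vanish on complicated sets, so instead of decomposing the curve, continuous
induction shows `g ≤ g 0` on `[0,1]`, where `g = X - V + s/(p-1)`. To the right of a given point,
either `g` is constant for a while, or flat points accumulate there; at flat points `V = 0`, and `X
+ s/(p-1)` has negative derivative because `p > 2`. Closing up would then give `s 1 ≤ s 0`. -/
theorem AdaptedSolution.not_closesUp_of_eq_of_two_lt (hp2 : 2 < p)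
    (h : AdaptedSolution p C c (p * c) u X Y a b k) (hs : ∀ t, HasDerivAt s (u t) t) :
    ¬ ClosesUp X Y a b := by
  intro hcl
  have hp : 1 < p := by linarith
  have hp0 : 0 < p := by linarith
  have hp1 : 0 < p - 1 := by linarith
  have hc := h.c_pos
  obtain ⟨hXc, hYc⟩ := h.continuous_coord
  have hac := h.continuous_a
  have hbc := h.continuous_b
  have hkc := h.continuous_k hp
  have hsc : Continuous s := continuous_iff_continuousAt.2 fun t => (hs t).continuousAt
  set V : ℝ → ℝ := fun t => (C - c * Y t) / c * (b t / (1 + a t)) with hV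
  set g : ℝ → ℝ := fun t => X t - V t + s t / (p - 1) with hg
  have hflat : ∀ t ∈ Icc (0 : ℝ) 1, k t = 0 → a t = -1 ∧ V t = 0 := by
    intro t ht hk
    constructor
    · have hen := h.energy t ht
      rw [hk, abs_zero, Real.zero_rpow hp0.ne', mul_zero] at hen
      have : p * c * (1 + a t) = 0 := by linarith
      have := (mul_eq_zero.1 this).resolve_left (by positivity)
      linarith
    · have := h.abs_height hp t
      rw [hk, abs_zero, Real.zero_rpow hp1.ne', abs_eq_zero] at this
      simp only [hV]
      rw [this, zero_div, zero_mul]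
  have hVc : ContinuousOn V (Icc 0 1) := by
    intro t ht
    by_cases hk : k t = 0
    · have hV0 := (hflat t ht hk).2
      rw [ContinuousWithinAt, hV0]
      -- At a flat point `V` is continuous because it is bounded by a multiple of `|k|^(p/2 - 1)`,
      -- an exponent that is positive for `p > 2`.
      have hlim : Tendsto (fun t => Real.sqrt (2 * (p - 1) / (p * c)) * (p / (p - 1))
          * |k t| ^ (p / 2 - 1)) (𝓝[Icc 0 1] t) (𝓝 0) := by
        have hcont : Continuous fun t => Real.sqrt (2 * (p - 1) / (p * c)) * (p / (p - 1))
            * |k t| ^ (p / 2 - 1) :=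
          continuous_const.mul (hkc.abs.rpow_const fun t => Or.inr (by linarith))
        have := hcont.tendsto t
        rw [hk, abs_zero, Real.zero_rpow (by linarith), mul_zero] at this
        exact this.mono_left nhdsWithin_le_nhds
      refine squeeze_zero_norm' ?_ hlim
      filter_upwards [self_mem_nhdsWithin] with r hr
      exact (h.abs_correction_le hp hr).2
    · have ha : 1 + a t ≠ 0 := by
        intro h0
        have h1 := h.energy t ht
        rw [show p * c + p * c * a t = p * c * (1 + a t) by ring, h0, mul_zero] at h1
        exact (mul_pos hp1 (Real.rpow_pos_of_pos (abs_pos.2 hk) p)).ne' h1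
      refine ContinuousAt.continuousWithinAt (ContinuousAt.mul (by fun_prop) ?_)
      exact hbc.continuousAt.div (by fun_prop) ha
  have hgc : ContinuousOn g (Icc 0 1) :=
    (hXc.continuousOn.sub hVc).add (by fun_prop)
  have hsub : Icc (0 : ℝ) 1 ⊆ {t | g t ≤ g 0} := by
    refine IsClosed.Icc_subset_of_forall_exists_gt ?_ (le_refl (g 0)) ?_
    · rw [inter_comm]
      exact hgc.preimage_isClosed_of_isClosed isClosed_Icc isClosed_Iic
    rintro t ⟨htg, ht0, ht1⟩ y hy
    have ht : t ∈ Icc (0 : ℝ) 1 := ⟨ht0, ht1.le⟩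
    have hty : t < min y 1 := lt_min hy ht1
    by_cases hZ : ∃ r ∈ Ioc t (min y 1), ∀ v ∈ Ioo t r, k v ≠ 0
    · obtain ⟨r, hr, hkr⟩ := hZ
      have hr1 : r ≤ 1 := hr.2.trans (min_le_right _ _)
      obtain ⟨v, -, hv⟩ := exists_hasDerivAt_eq_slope g (fun _ => 0) hr.1
        (hgc.mono (Icc_subset_Icc ht0 hr1))
        (fun v hv => h.hasDerivAt_abscissa hp hs ⟨ht0.trans_lt hv.1, hv.2.trans_le hr1⟩ (hkr v hv))
      have hgr : g r = g t := by
        rcases div_eq_zero_iff.1 hv.symm with h' | h'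
        · linarith
        · linarith [hr.1]
      exact ⟨r, hgr.le.trans htg, hr.1, hr.2.trans (min_le_left _ _)⟩
    -- Zeros of the curvature accumulate at `t` from the right, so `t` is itself flat; comparing `g`
    -- at `t` with `g` at a nearby zero requires only the derivative of `X + s/(p-1)` at `t`.
    · push Not at hZ
      have hkt : k t = 0 := by
        by_contra hk
        obtain ⟨ε, hε, hball⟩ := Metric.eventually_nhds_iff.1 (hkc.continuousAt.eventually_ne hk)
        obtain ⟨v, hv, hkv⟩ := hZ (min (t + ε) (min y 1))
          ⟨lt_min (by linarith) hty, min_le_right _ _⟩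
        refine hball (y := v) ?_ hkv
        rw [Real.dist_eq, abs_of_pos (by linarith [hv.1])]
        linarith [hv.2.trans_le (min_le_left _ _)]
      obtain ⟨hat, hVt⟩ := hflat t ht hkt
      have hd := (h.deriv_X t).fun_add ((hs t).div_const (p - 1))
      have hneg : u t * a t + u t / (p - 1) < 0 := by
        have : u t / (p - 1) < u t := div_lt_self (h.u_pos t) (by linarith)
        rw [hat]; linarith
      obtain ⟨ε, hε, hball⟩ := Metric.eventually_nhds_iff.1 (eventually_nhdsWithin_iff.1
        ((hasDerivAt_iff_tendsto_slope.1 hd).eventually_lt_const hneg))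
      obtain ⟨v, hv, hkv⟩ := hZ (min (t + ε) (min y 1))
        ⟨lt_min (by linarith) hty, min_le_right _ _⟩
      have hv2 := hv.2.trans_le (min_le_right _ _)
      have hvm : v ∈ Icc (0 : ℝ) 1 := ⟨by linarith [hv.1], hv2.le.trans (min_le_right _ _)⟩
      have hsl := hball (y := v) (by
        rw [Real.dist_eq, abs_of_pos (by linarith [hv.1])]
        linarith [hv.2.trans_le (min_le_left _ _)]) hv.1.ne'
      rw [slope_def_field, div_lt_iff₀ (by linarith [hv.1]), zero_mul] at hsl
      refine ⟨v, ?_, hv.1, hv2.le.trans (min_le_left _ _)⟩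
      refine le_trans (b := g t) (c := g 0) ?_ htg
      simp only [hg, hVt, (hflat v hvm hkv).2]
      linarith
  have h1 : g 1 ≤ g 0 := hsub (by simp)
  have hmono : s 0 < s 1 := strictMono_of_hasDerivAt_pos hs h.u_pos zero_lt_one
  have hlt := div_lt_div_of_pos_right hmono hp1
  simp only [hg, hV, hcl.X_eq, hcl.Y_eq, hcl.a_eq, hcl.b_eq] at h1
  linarith

/-- Only solutions of wavelike type close up. -/
theorem AdaptedSolution.abs_lt_of_closesUp (hp : 1 < p)
    (h : AdaptedSolution p C c lam u X Y a b k) (hu : Continuous u) (hs : ∀ t, HasDerivAt s (u t) t)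
    (hcl : ClosesUp X Y a b) : -(p * c) < lam ∧ lam < p * c := by
  refine ⟨?_, ?_⟩
  · by_contra hcon
    exact h.not_closesUp_of_le_neg hp (not_lt.1 hcon) hcl
  · by_contra hcon
    rcases (not_lt.1 hcon).eq_or_lt with heq | hlt
    · subst heq
      rcases le_or_gt p 2 with hp2 | hp2
      · exact h.not_closesUp_of_eq_of_le_two hp hp2 hs hu hcl
      · exact h.not_closesUp_of_eq_of_two_lt hp2 hs hcl
    · exact h.not_closesUp_of_lt hp hlt hcl

end Adapted

/-! ### Lifting of angles -/

/-- The path `f + i g` in the unit circle is lifted through the covering `Circle.exp` and extended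
beyond `[0,1]` by projection onto it. -/
theorem exists_angle_lift {f g : ℝ → ℝ} (hf : ContinuousOn f (Icc 0 1))
    (hg : ContinuousOn g (Icc 0 1)) (h : ∀ t ∈ Icc (0 : ℝ) 1, f t ^ 2 + g t ^ 2 = 1) :
    ∃ ξ : ℝ → ℝ, Continuous ξ ∧
      ∀ t ∈ Icc (0 : ℝ) 1, Real.cos (ξ t) = f t ∧ Real.sin (ξ t) = g t := by
  have hfr : Continuous fun t : unitInterval => f t := continuousOn_iff_continuous_domRestrict.1 hf
  have hgr : Continuous fun t : unitInterval => g t := continuousOn_iff_continuous_domRestrict.1 hg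
  let G : C(unitInterval, Circle) :=
    ⟨fun t => ⟨(f t : ℂ) + g t * Complex.I, mem_sphere_zero_iff_norm.2 (by
        rw [Complex.norm_add_mul_I, h t t.2, Real.sqrt_one])⟩,
      Continuous.subtype_mk ((Complex.continuous_ofReal.comp hfr).add
        ((Complex.continuous_ofReal.comp hgr).mul continuous_const)) _⟩
  obtain ⟨z, hz⟩ := Circle.exp_surjective (G 0)
  obtain ⟨Γ, hΓ, -⟩ := Circle.isCoveringMap_exp.exists_path_lifts G z hz.symm
  refine ⟨fun t => Γ (projIcc 0 1 zero_le_one t), Γ.continuous.comp continuous_projIcc,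
    fun t ht => ?_⟩
  have h1 := congrFun hΓ ⟨t, ht⟩
  have h2 : Complex.exp (Γ ⟨t, ht⟩ * Complex.I) = (f t : ℂ) + g t * Complex.I := by
    rw [← Circle.coe_exp]
    exact congrArg Subtype.val h1
  simp only
  rw [projIcc_of_mem _ ht]
  have hre := congrArg Complex.re h2
  have him := congrArg Complex.im h2
  rw [Complex.exp_ofReal_mul_I_re] at hre
  rw [Complex.exp_ofReal_mul_I_im] at him
  exact ⟨by simpa using hre, by simpa using him⟩

/-- Near such a point the continuous function `ξ` is the local inverse of the sine applied to `sin
ξ`. -/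
theorem hasDerivAt_of_sin {ξ : ℝ → ℝ} {d t : ℝ} (hξ : ContinuousAt ξ t)
    (hd : HasDerivAt (fun t => Real.sin (ξ t)) d t) (hc : Real.cos (ξ t) ≠ 0) :
    HasDerivAt ξ (d / Real.cos (ξ t)) t := by
  have hs := Real.hasStrictDerivAt_sin (ξ t)
  have h1 := (hs.to_localInverse hc).hasDerivAt.comp t hd
  rw [div_eq_inv_mul]
  refine h1.congr_of_eventuallyEq ?_
  filter_upwards [hξ.eventually (hs.eventually_left_inverse hc)] with r hr
  exact hr.symm

/-- Simple zeros are isolated, and a compact discrete set is finite. -/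
theorem finite_zeros_of_deriv_ne_zero {f f' : ℝ → ℝ} (hd : ∀ t, HasDerivAt f (f' t) t)
    (hz : ∀ t ∈ Icc (0 : ℝ) 1, f t = 0 → f' t ≠ 0) : {t ∈ Icc (0 : ℝ) 1 | f t = 0}.Finite := by
  have hf : Continuous f := continuous_iff_continuousAt.2 fun t => (hd t).continuousAt
  refine IsCompact.finite (isCompact_Icc.inter_right (isClosed_singleton.preimage hf)) ?_
  refine IsDiscrete.of_nhdsWithin fun t ht => ?_
  have h1 := (hd t).eventually_ne (c := 0) (hz t ht.1 ht.2)
  rw [eventually_nhdsWithin_iff] at h1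
  rw [le_pure_iff, mem_nhdsWithin_iff_eventually]
  filter_upwards [h1] with r hr hrm
  by_contra hne
  exact hr hne hrm.2

/-! ### Reconstruction of the amplitude of a wavelike solution -/

section Adapted

variable {p C c lam : ℝ} {u X Y a b k s : ℝ → ℝ}

/-- Solutions of wavelike type are wavelike curves. -/
theorem AdaptedSolution.exists_waveTangent (hp : 1 < p)
    (h : AdaptedSolution p C c lam u X Y a b k) (hs : ∀ t, HasDerivAt s (u t) t)
    (hl : -(p * c) < lam) (hl' : lam < p * c) :
    ∃ q ∈ Ioo (0 : ℝ) 1, ∃ r s₀ : ℝ, 0 < r ∧ ∀ t ∈ Icc (0 : ℝ) 1,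
      waveTangent p q (s t / r + s₀) = !₂[a t, b t] := by
  have hp0 : 0 < p := by linarith
  have hp1 : 0 < p - 1 := by linarith
  have hc := h.c_pos
  have hR : 0 < p * c := mul_pos hp0 hc
  have hac := h.continuous_a
  have hbc := h.continuous_b
  have hkc := h.continuous_k hp
  have hQ : 0 < (1 + lam / (p * c)) / 2 := by
    have : -1 < lam / (p * c) := by rw [lt_div_iff₀ hR]; linarith
    linarith
  have hQ1 : (1 + lam / (p * c)) / 2 < 1 := by
    have : lam / (p * c) < 1 := by rwa [div_lt_one hR]
    linarith
  -- Chosen so that `lam = p c (2 q² - 1)`. The first integral then says that `q² - sin²(θ/2)` is a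
  -- multiple of `|k|^p`, where `θ` is the tangential angle.
  set q := Real.sqrt ((1 + lam / (p * c)) / 2) with hq
  have hq0 : 0 < q := Real.sqrt_pos.2 hQ
  have hq2 : q ^ 2 = (1 + lam / (p * c)) / 2 := Real.sq_sqrt hQ.le
  have hq1 : q < 1 := by
    rw [hq, Real.sqrt_lt' one_pos]; simpa using hQ1
  have hlam : lam = p * c * (2 * q ^ 2 - 1) := by rw [hq2]; field_simp; ring
  -- the scaling factor
  set m := (p - 1) / (2 * q ^ 2 * (p * c)) with hm
  have hmpos : 0 < m := by positivity
  set ρ := m ^ (1 / p) with hρ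
  have hρpos : 0 < ρ := Real.rpow_pos_of_pos hmpos _
  have hρp : ρ ^ p = m := by
    rw [hρ, ← Real.rpow_mul hmpos.le, one_div_mul_cancel hp0.ne', Real.rpow_one]
  -- half angles
  have hapos : ∀ t ∈ Icc (0 : ℝ) 1, 0 < 1 + a t := by
    intro t ht
    have h1 := h.energy t ht
    have h2 : 0 ≤ (p - 1) * |k t| ^ p :=
      mul_nonneg hp1.le (Real.rpow_nonneg (abs_nonneg _) _)
    by_contra hcon
    nlinarith [mul_nonneg hR.le (neg_nonneg.2 (not_lt.1 hcon)), mul_pos hR (sq_pos_of_pos hq0)]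
  set D : ℝ → ℝ := fun t => Real.sqrt ((1 + a t) / 2) with hD
  have hDpos : ∀ t ∈ Icc (0 : ℝ) 1, 0 < D t := fun t ht =>
    Real.sqrt_pos.2 (half_pos (hapos t ht))
  have hD2 : ∀ t ∈ Icc (0 : ℝ) 1, D t ^ 2 = (1 + a t) / 2 := fun t ht =>
    Real.sq_sqrt (half_pos (hapos t ht)).le
  have hDc : Continuous D := by simp only [hD]; fun_prop
  set S : ℝ → ℝ := fun t => b t / (2 * D t) with hS
  have hSc : ContinuousOn S (Icc 0 1) :=
    hbc.continuousOn.div (by fun_prop) fun t ht => (mul_pos two_pos (hDpos t ht)).ne'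
  have hS2 : ∀ t ∈ Icc (0 : ℝ) 1, S t ^ 2 = (1 - a t) / 2 := by
    intro t ht
    have hd := hD2 t ht
    have hd0 := hapos t ht
    simp only [hS]
    rw [div_pow, mul_pow, hd, div_eq_div_iff (by positivity) two_ne_zero]
    linear_combination 2 * h.sq_add t
  have hb2 : ∀ t ∈ Icc (0 : ℝ) 1, b t = 2 * S t * D t := by
    intro t ht
    have := (hDpos t ht).ne'
    simp only [hS]
    field_simp
  have hSd : ∀ t ∈ Ioo (0 : ℝ) 1, HasDerivAt S (k t * u t * D t / 2) t := by
    intro t ht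
    have ht' := Ioo_subset_Icc_self ht
    have hd0 := (hDpos t ht').ne'
    have e1 := (((h.deriv_a t ht).const_add 1).div_const 2).sqrt (half_pos (hapos t ht')).ne'
    have e2 := (h.deriv_b t ht).fun_div (e1.const_mul 2) (mul_ne_zero two_ne_zero hd0)
    refine e2.congr_deriv ?_
    change (k t * u t * a t * (2 * D t) - b t * (2 * (-(k t * u t * b t) / 2 / (2 * D t))))
      / (2 * D t) ^ 2 = _
    have hd2 := hD2 t ht'
    have hsq := h.sq_add t
    have ha2 : a t = 2 * D t ^ 2 - 1 := by linarith
    rw [ha2] at hsq ⊢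
    field_simp
    linear_combination (k t * u t) * hsq
  -- the cosine of the amplitude
  set N : ℝ → ℝ := fun t => spow (p / 2) (ρ * k t) with hN
  have hNc : Continuous N := (continuous_spow (by positivity)).comp (by fun_prop)
  have hNS : ∀ t ∈ Icc (0 : ℝ) 1, N t ^ 2 + (S t / q) ^ 2 = 1 := by
    intro t ht
    have e1 : N t ^ 2 = m * |k t| ^ p := by
      simp only [hN]
      rw [← sq_abs, abs_spow (by positivity), ← Real.rpow_natCast, ← Real.rpow_mul (abs_nonneg _),
        show p / 2 * ((2 : ℕ) : ℝ) = p by push_cast; ring, abs_mul, abs_of_pos hρpos,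
        Real.mul_rpow hρpos.le (abs_nonneg _), hρp]
    have hen := h.energy t ht
    rw [e1, div_pow, hS2 t ht, hm]
    rw [hlam] at hen
    field_simp
    linear_combination hen
  obtain ⟨ξ, hξc, hξ⟩ := exists_angle_lift hNc.continuousOn (hSc.div_const q) hNS
  have hDξ : ∀ t ∈ Icc (0 : ℝ) 1, Real.sqrt (1 - q ^ 2 * Real.sin (ξ t) ^ 2) = D t := by
    intro t ht
    rw [(hξ t ht).2, div_pow, mul_div_cancel₀ _ (pow_ne_zero 2 hq0.ne'), hS2 t ht]
    simp only [hD]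
    congr 1
    ring
  have hkN : ∀ t, spow (2 / p) (N t) = ρ * k t := by
    intro t
    simp only [hN]
    rw [spow_spow, show p / 2 * (2 / p) = 1 by field_simp, spow_one]
  -- the zeros of the curvature
  have hwd : ∀ t, HasDerivAt (fun t => C - c * Y t) (-(c * (u t * b t))) t := fun t =>
    ((h.deriv_Y t).const_mul c).const_sub C
  -- Where the curvature vanishes, `a = 1 - 2q²` lies strictly between `-1` and `1`; hence `b ≠ 0`,
  -- and the zero of `C - c Y` is simple.
  have hfin := finite_zeros_of_deriv_ne_zero hwd (by
    intro t ht hw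
    have hen := h.energy t ht
    rw [h.curv, hw, spow_zero_right, abs_zero, Real.zero_rpow hp0.ne', mul_zero, hlam] at hen
    have ha : a t = 1 - 2 * q ^ 2 := by
      have : p * c * (a t - (1 - 2 * q ^ 2)) = 0 := by linarith
      have := (mul_eq_zero.1 this).resolve_left hR.ne'
      linarith
    have hb : b t ≠ 0 := by
      intro hb
      have hsq := h.sq_add t
      rw [hb, ha] at hsq
      have : q ^ 2 * (1 - q ^ 2) = 0 := by linarith
      rcases mul_eq_zero.1 this with h' | h'
      · exact hq0.ne' (pow_eq_zero_iff two_ne_zero |>.1 h')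
      · nlinarith
    exact neg_ne_zero.2 (mul_ne_zero h.c_pos.ne' (mul_ne_zero (h.u_pos t).ne' hb)))
  have hker := isAmplitudeKernel_kernel1 hp hq0.le hq1
  have hmeas := measurable_kernel1 p q
  -- The model has curvature `2 q cn_p`, where `cn_p = ρ k`, that is, `r` times the given curvature;
  -- hence its arclength is `s / r`.
  set r := 2 * q * ρ with hr
  have hrpos : 0 < r := by positivity
  have hsc : Continuous s := continuous_iff_continuousAt.2 fun t => (hs t).continuousAt
  -- The lifted angle satisfies the differential equation of the amplitude away from the zeros of
  -- the curvature. These being finitely many, `F₁(ξ) - s/r` is constant, which identifies `ξ` with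
  -- the amplitude.
  have hFd : ∀ t ∈ Ioo (0 : ℝ) 1 \ {t ∈ Icc (0 : ℝ) 1 | C - c * Y t = 0},
      HasDerivAt (fun t => primitive (kernel1 p q) (ξ t) - s t / r) 0 t := by
    rintro t ⟨ht, htw⟩
    have ht' := Ioo_subset_Icc_self ht
    have hk : k t ≠ 0 := by
      intro h0
      rw [h.curv, spow_eq_zero_iff] at h0
      exact htw ⟨ht', h0⟩
    have hNt : N t ≠ 0 := by
      simp only [hN]
      rw [Ne, spow_eq_zero_iff]
      exact mul_ne_zero hρpos.ne' hk
    have hcos : Real.cos (ξ t) ≠ 0 := by rw [(hξ t ht').1]; exact hNt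
    have e1 : HasDerivAt (fun t => Real.sin (ξ t)) (k t * u t * D t / 2 / q) t := by
      refine ((hSd t ht).div_const q).congr_of_eventuallyEq ?_
      filter_upwards [isOpen_Ioo.mem_nhds ht] with v hv
      exact (hξ v (Ioo_subset_Icc_self hv)).2
    have e2 := hasDerivAt_of_sin hξc.continuousAt e1 hcos
    have e3 := ((hker.hasDerivAt hmeas hcos).comp t e2).fun_sub ((hs t).div_const r)
    refine e3.congr_deriv ?_
    rw [kernel1, hDξ t ht', (hξ t ht').1]
    have hD0 := (hDpos t ht').ne'
    have e4 : |N t| ^ (1 - 2 / p) * (ρ * k t) = N t := by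
      rw [← hkN, spow, ← mul_assoc, ← Real.rpow_add (abs_pos.2 hNt)]
      norm_num
    rw [sub_eq_zero, hr]
    generalize |N t| ^ (1 - 2 / p) = P at e4 ⊢
    field_simp
    linear_combination u t * e4
  have hconst : ∀ t ∈ Icc (0 : ℝ) 1, primitive (kernel1 p q) (ξ t) - s t / r
      = primitive (kernel1 p q) (ξ 0) - s 0 / r := by
    intro t ht
    have hcont : Continuous fun t => primitive (kernel1 p q) (ξ t) - s t / r :=
      ((continuous_primitive_of_integrable hker.integrable).comp hξc).sub (by fun_prop)
    have := integral_eq_of_hasDerivAt_off_countable_of_le _ (fun _ => (0 : ℝ)) ht.1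
      hfin.countable hcont.continuousOn
      (fun v hv => hFd v ⟨⟨hv.1.1, hv.1.2.trans_le ht.2⟩, hv.2⟩) (by simp)
    rw [intervalIntegral.integral_zero] at this
    linarith
  refine ⟨q, ⟨hq0, hq1⟩, r, primitive (kernel1 p q) (ξ 0) - s 0 / r, hrpos, fun t ht => ?_⟩
  have ham : am1 p (s t / r + (primitive (kernel1 p q) (ξ 0) - s 0 / r)) q = ξ t := by
    rw [← hconst t ht, am1_eq (not_degenerate_of_lt_one hq1), add_sub_cancel,
      hker.amplitude_primitive hmeas]
  have hsin : q * Real.sin (ξ t) = S t := by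
    rw [(hξ t ht).2, mul_div_cancel₀ _ hq0.ne']
  rw [waveTangent, waveSin, waveCos, ham, hDξ t ht, hsin, ← hb2 t ht, hS2 t ht]
  congr 2
  ring_nf

end Adapted

/-! ### Classification of closed elasticae -/

section Repr

variable {p : ℝ} {γ : ℝ → Plane} {x y : ℝ → ℝ}

/-- Closed curves of constant curvature are circles. -/
theorem HasAffineCurvature.exists_isNFoldCircle (h : IsRegularRepr p γ x y) {C : ℝ}
    (hc : HasAffineCurvature p C 0 0 x y) (hcl : IsClosedCurve γ) :
    ∃ N : ℕ, 1 ≤ N ∧ IsNFoldCircle N γ := by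
  set κ := spow (1 / (p - 1)) C with hκ
  have hdX : ∀ t ∈ Ioo (0 : ℝ) 1, HasDerivAt (tanX x y) (-(κ * (speed x y t * tanY x y t))) t := by
    intro t ht
    refine (hc.deriv_tanX t ht).congr_deriv ?_
    rw [zero_mul, zero_mul, add_zero, add_zero, h.speed_mul_tanY]
  have hdY : ∀ t ∈ Ioo (0 : ℝ) 1, HasDerivAt (tanY x y) (κ * (speed x y t * tanX x y t)) t := by
    intro t ht
    refine (hc.deriv_tanY t ht).congr_deriv ?_
    rw [zero_mul, zero_mul, add_zero, add_zero, h.speed_mul_tanX]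
  have hXc := h.continuous_tanX
  have hYc := h.continuous_tanY
  have hconst : ∀ f : ℝ → ℝ, Continuous f → (∀ t ∈ Ioo (0 : ℝ) 1, HasDerivAt f 0 t) →
      ∀ t ∈ Icc (0 : ℝ) 1, f t = f 0 := by
    intro f hf hd t ht
    rcases ht.1.eq_or_lt with h0 | h0
    · rw [← h0]
    · obtain ⟨v, -, hv⟩ := exists_hasDerivAt_eq_slope f (fun _ => 0) h0 hf.continuousOn
        fun v hv => hd v ⟨hv.1, hv.2.trans_le ht.2⟩
      rcases div_eq_zero_iff.1 hv.symm with h' | h' <;> linarith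
  set P := tanX x y 0 with hP
  set Q := tanY x y 0 with hQ
  have hPQ : P ^ 2 + Q ^ 2 = 1 := h.tan_sq_add 0
  have harc : Continuous (arc x y) :=
    continuous_iff_continuousAt.2 fun t => (h.hasDerivAt_arc t).continuousAt
  -- The tangent rotated back by the angle `κ` times arclength has zero derivative.
  have e1 := hconst (fun t => Real.cos (κ * arc x y t) * tanX x y t
      + Real.sin (κ * arc x y t) * tanY x y t) (by fun_prop) fun t ht => by
    have ha := (h.hasDerivAt_arc t).const_mul κ
    refine ((ha.cos.fun_mul (hdX t ht)).fun_add (ha.sin.fun_mul (hdY t ht))).congr_deriv ?_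
    ring
  have e2 := hconst (fun t => Real.cos (κ * arc x y t) * tanY x y t
      - Real.sin (κ * arc x y t) * tanX x y t) (by fun_prop) fun t ht => by
    have ha := (h.hasDerivAt_arc t).const_mul κ
    refine ((ha.cos.fun_mul (hdY t ht)).fun_sub (ha.sin.fun_mul (hdX t ht))).congr_deriv ?_
    ring
  simp only [arc_zero, mul_zero, Real.cos_zero, Real.sin_zero, one_mul, zero_mul, add_zero,
    sub_zero, ← hP, ← hQ] at e1 e2
  have htan : ∀ t ∈ Icc (0 : ℝ) 1,
      tanX x y t = P * Real.cos (κ * arc x y t) - Q * Real.sin (κ * arc x y t) ∧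
      tanY x y t = P * Real.sin (κ * arc x y t) + Q * Real.cos (κ * arc x y t) := by
    intro t ht
    have h1 := e1 t ht
    have h2 := e2 t ht
    have h3 := Real.sin_sq_add_cos_sq (κ * arc x y t)
    constructor
    · linear_combination Real.cos (κ * arc x y t) * h1 - Real.sin (κ * arc x y t) * h2
        - tanX x y t * h3
    · linear_combination Real.sin (κ * arc x y t) * h1 + Real.cos (κ * arc x y t) * h2
        - tanY x y t * h3
  rcases eq_or_ne κ 0 with hκ0 | hκ0
  -- With zero curvature the tangent is constantly `(P, Q)`, and `P x + Q y` increases with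
  -- arclength.
  · exfalso
    obtain ⟨⟨hx, hy⟩, -⟩ := h.isClosedCurve_iff.1 hcl
    have hd : ∀ t ∈ Ioo (0 : ℝ) 1, HasDerivAt (fun t => -(P * x t + Q * y t))
        (-speed x y t) t := by
      intro t ht
      refine (((h.hasDerivAt_fst t).const_mul P).add
        ((h.hasDerivAt_snd t).const_mul Q)).fun_neg.congr_deriv ?_
      obtain ⟨h1, h2⟩ := htan t (Ioo_subset_Icc_self ht)
      rw [hκ0, zero_mul, Real.cos_zero, Real.sin_zero] at h1 h2
      rw [← h.speed_mul_tanX, ← h.speed_mul_tanY, h1, h2]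
      linear_combination -speed x y t * hPQ
    have hxc := h.contDiff_fst.continuous
    have hyc := h.contDiff_snd.continuous
    have := deriv_eq_zero_of_nonpos_of_eq zero_lt_one (by fun_prop) hd
      (fun t _ => neg_nonpos.2 (h.speed_pos t).le) (by simp only [hx, hy]) (1 / 2)
      ⟨by norm_num, by norm_num⟩
    linarith [h.speed_pos (1 / 2)]
  · obtain ⟨δ, hδ, hδκ⟩ : ∃ δ : ℝ, (δ = 1 ∨ δ = -1) ∧ κ = δ * |κ| := by
      rcases lt_or_gt_of_ne hκ0 with hn | hn
      · exact ⟨-1, Or.inr rfl, by rw [abs_of_neg hn]; ring⟩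
      · exact ⟨1, Or.inl rfl, by rw [abs_of_pos hn]; ring⟩
    have hδ2 : δ ^ 2 = 1 := by rcases hδ with h | h <;> rw [h] <;> norm_num
    -- This isometry takes the initial tangent `(0, 1)` of the unit circle to `(P, Q)`; it reverses
    -- orientation when the curvature is negative.
    obtain ⟨A, hA⟩ := exists_isometry (a := δ * Q) (b := -(δ * P)) (δ := δ)
      (by linear_combination (P ^ 2 + Q ^ 2) * hδ2 + hPQ) hδ
    have hsmul : ∀ z, Real.cos (δ * z) = Real.cos z ∧ Real.sin (δ * z) = δ * Real.sin z := by
      intro z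
      rcases hδ with h | h <;> simp [h]
    have hr : 0 < 1 / |κ| := one_div_pos.2 (abs_pos.2 hκ0)
    have hder := fun s => (hasDerivAt_gammaCirc (s + 0)).comp_add_const s 0
    have hrep := h.isRepresentedBy hr A hder fun t ht => by
      obtain ⟨h1, h2⟩ := htan t ht
      obtain ⟨h3, h4⟩ := hsmul (|κ| * arc x y t)
      rw [← mul_assoc, ← hδκ] at h3 h4
      rw [hA, unitTangent, h1, h2, h3, h4, add_zero, div_div_eq_mul_div, div_one,
        mul_comm (arc x y t)]
      simp only [circTangent, Matrix.cons_val_zero, Matrix.cons_val_one]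
      generalize Real.cos (|κ| * arc x y t) = co
      generalize Real.sin (|κ| * arc x y t) = si
      congr 2
      · linear_combination -(P * co) * hδ2
      · congr 1
        linear_combination -(Q * co) * hδ2
    obtain ⟨hℓ, hiff⟩ := h.isClosedCurve_iff_of_isRepresentedBy hrep
      (fun s _ => (hder s).hasDerivWithinAt) fun s _ => norm_circTangent _
    obtain ⟨h1, -⟩ := hiff.1 hcl
    have hco := congrArg (fun z : Plane => z 0) h1
    have hsi := congrArg (fun z : Plane => z 1) h1
    simp only [gammaCirc, Matrix.cons_val_zero, Matrix.cons_val_one] at hco hsi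
    obtain ⟨n, hn⟩ := exists_int_of_cos_sin_eq hco.symm hsi.symm
    obtain ⟨N, hN, hNℓ⟩ := exists_nat_of_int_mul (n := n) hℓ Real.two_pi_pos (by linarith)
    refine ⟨N, hN, 0, ?_⟩
    rwa [show 2 * (N : ℝ) * Real.pi = arc x y 1 / (1 / |κ|) by rw [hNℓ]; ring]

/-- Closed curves whose curvature is a nonconstant function of position are figure-eights. -/
theorem HasAffineCurvature.exists_isNFoldFigureEight (hp : 1 < p) (h : IsRegularRepr p γ x y)
    {C c₀ c₁ : ℝ} (hc : HasAffineCurvature p C c₀ c₁ x y) (hne : ¬ (c₀ = 0 ∧ c₁ = 0))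
    (hcl : IsClosedCurve γ) :
    ∃ q, IsFigureEightModulus p q ∧ ∃ N : ℕ, 1 ≤ N ∧ IsNFoldFigureEight p q N γ := by
  have hp1 : p - 1 ≠ 0 := by linarith
  have hpos : 0 < c₀ ^ 2 + c₁ ^ 2 := by
    rcases not_and_or.1 hne with h0 | h0 <;> positivity
  set c := Real.sqrt (c₀ ^ 2 + c₁ ^ 2) with hcdef
  have hcpos : 0 < c := Real.sqrt_pos.2 hpos
  have hc2 : c ^ 2 = c₀ ^ 2 + c₁ ^ 2 := Real.sq_sqrt hpos.le
  -- The frame is turned so that the new height is `-(c₀ x + c₁ y)/c`; the affine function then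
  -- becomes `C - c Y`.
  set e₀ := -c₁ / c with he₀
  set e₁ := c₀ / c with he₁
  have he : e₀ ^ 2 + e₁ ^ 2 = 1 := by
    rw [he₀, he₁, div_pow, div_pow, ← add_div, div_eq_one_iff_eq (by positivity), hc2]; ring
  have hce₀ : c * e₀ = -c₁ := by rw [he₀]; field_simp
  have hce₁ : c * e₁ = c₀ := by rw [he₁]; field_simp
  obtain ⟨lam, hlam⟩ := hc.exists_const hp h
  have hXc := h.continuous_tanX
  have hYc := h.continuous_tanY
  have hsol : AdaptedSolution p C c lam (speed x y) (fun t => e₀ * x t + e₁ * y t)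
      (fun t => -e₁ * x t + e₀ * y t) (fun t => e₀ * tanX x y t + e₁ * tanY x y t)
      (fun t => -e₁ * tanX x y t + e₀ * tanY x y t)
      (fun t => spow (1 / (p - 1)) (C + c₀ * x t + c₁ * y t)) := by
    refine ⟨hcpos, h.speed_pos, fun t => ?_, fun t => ?_, by fun_prop, by fun_prop, fun t => ?_,
      fun t => ?_, fun t ht => ?_, fun t ht => ?_, fun t ht => ?_⟩
    · refine (((h.hasDerivAt_fst t).const_mul e₀).add
        ((h.hasDerivAt_snd t).const_mul e₁)).congr_deriv ?_
      rw [← h.speed_mul_tanX, ← h.speed_mul_tanY]; ring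
    · refine (((h.hasDerivAt_fst t).const_mul (-e₁)).add
        ((h.hasDerivAt_snd t).const_mul e₀)).congr_deriv ?_
      rw [← h.speed_mul_tanX, ← h.speed_mul_tanY]; ring
    · linear_combination (tanX x y t ^ 2 + tanY x y t ^ 2) * he + h.tan_sq_add t
    · congr 1
      linear_combination -x t * hce₁ + y t * hce₀
    · refine (((hc.deriv_tanX t ht).const_mul e₀).add
        ((hc.deriv_tanY t ht).const_mul e₁)).congr_deriv ?_
      rw [← h.speed_mul_tanX, ← h.speed_mul_tanY]; ring
    · refine (((hc.deriv_tanX t ht).const_mul (-e₁)).add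
        ((hc.deriv_tanY t ht).const_mul e₀)).congr_deriv ?_
      rw [← h.speed_mul_tanX, ← h.speed_mul_tanY]; ring
    · linear_combination hlam t ht - p * tanX x y t * hce₀ - p * tanY x y t * hce₁
  obtain ⟨⟨hx, hy⟩, htX, htY⟩ := h.isClosedCurve_iff.1 hcl
  have hcu : ClosesUp (fun t => e₀ * x t + e₁ * y t) (fun t => -e₁ * x t + e₀ * y t)
      (fun t => e₀ * tanX x y t + e₁ * tanY x y t)
      (fun t => -e₁ * tanX x y t + e₀ * tanY x y t) :=
    ⟨by simp only [hx, hy], by simp only [hx, hy], by simp only [htX, htY],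
      by simp only [htX, htY]⟩
  obtain ⟨hl, hl'⟩ := hsol.abs_lt_of_closesUp hp h.continuous_speed h.hasDerivAt_arc hcu
  obtain ⟨q, hq, r, s₀, hr, hT⟩ := hsol.exists_waveTangent hp h.hasDerivAt_arc hl hl'
  obtain ⟨A, hA⟩ := exists_isometry (δ := 1) he (Or.inl rfl)
  have hder := fun s => (hasDerivAt_gammaWave hp hq.1.le hq.2 (s + s₀)).comp_add_const s s₀
  have hrep := h.isRepresentedBy hr A hder fun t ht => by
    rw [hT t ht, hA, unitTangent]
    simp only [Matrix.cons_val_zero, Matrix.cons_val_one]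
    congr 2
    · linear_combination -tanX x y t * he
    · congr 1
      linear_combination -tanY x y t * he
  obtain ⟨hmod, hN⟩ := h.exists_isNFoldFigureEight hp hq hrep hcl
  exact ⟨q, hmod, hN⟩

/-- Closed `p`-elasticae are circles or figure-eights. -/
theorem IsPElastica.isNFoldCircle_or_isNFoldFigureEight (hp : 1 < p) (hγ : IsPElastica p γ)
    (hcl : IsClosedCurve γ) : ∃ N : ℕ, 1 ≤ N ∧
      (IsNFoldCircle N γ ∨ ∃ q, IsFigureEightModulus p q ∧ IsNFoldFigureEight p q N γ) := by
  obtain ⟨x, y, h⟩ := hγ.1.exists_repr hp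
  obtain ⟨C, c₀, c₁, hc⟩ := (isPElastica_iff_hasAffineCurvature hp hγ.1 h).1 hγ
  by_cases h0 : c₀ = 0 ∧ c₁ = 0
  · obtain ⟨rfl, rfl⟩ := h0
    obtain ⟨N, hN, hcirc⟩ := hc.exists_isNFoldCircle h hcl
    exact ⟨N, hN, Or.inl hcirc⟩
  · obtain ⟨q, hq, N, hN, hw⟩ := hc.exists_isNFoldFigureEight hp h h0 hcl
    exact ⟨N, hN, Or.inr ⟨q, hq, hw⟩⟩

end Repr

end PElastica

end

/-! ### The theorem -/

theorem theorem5 (p : ℝ) (hp : 1 < p) :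
    ∃ qs : ℝ,
      (PElastica.IsFigureEightModulus p qs ∧
        ∀ q : ℝ, PElastica.IsFigureEightModulus p q → q = qs) ∧
      (∀ γ : ℝ → PElastica.Plane, PElastica.IsImmersedW2p p γ →
        ((PElastica.IsPElastica p γ ∧ PElastica.IsClosedCurve γ) ↔
          ∃ N : ℕ, 1 ≤ N ∧
            (PElastica.IsNFoldCircle N γ ∨ PElastica.IsNFoldFigureEight p qs N γ))) ∧
      (∀ γ : ℝ → PElastica.Plane, PElastica.IsImmersedW2p p γ →
        (PElastica.IsLinear γ ∨ PElastica.IsBorderline p γ ∨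
          PElastica.IsOrbitlike p γ ∨ PElastica.IsFlatCore p γ) →
        ¬ PElastica.IsClosedCurve γ) := by
  obtain ⟨qs, hqs⟩ := PElastica.exists_isFigureEightModulus hp
  have huniq : ∀ q, PElastica.IsFigureEightModulus p q → q = qs := fun q hq => hq.unique hp hqs
  refine ⟨qs, ⟨hqs, huniq⟩, fun γ hγ => ⟨?_, ?_⟩, fun γ hγ h => ?_⟩
  · rintro ⟨hel, hcl⟩
    obtain ⟨N, hN, hcirc | ⟨q, hq, hw⟩⟩ := hel.isNFoldCircle_or_isNFoldFigureEight hp hcl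
    · exact ⟨N, hN, Or.inl hcirc⟩
    -- The classification yields some root of the modulus equation, and uniqueness identifies it
    -- with the chosen one.
    · rw [huniq q hq] at hw
      exact ⟨N, hN, Or.inr hw⟩
  · obtain ⟨x, y, hr⟩ := hγ.exists_repr hp
    rintro ⟨N, -, hcirc | hw⟩
    · exact hcirc.isPElastica_and_isClosedCurve hp hγ hr
    · exact hw.isPElastica_and_isClosedCurve hp hγ hr hqs
  · obtain ⟨x, y, hr⟩ := hγ.exists_repr hp
    rcases h with h | h | h | h
    · exact h.not_isClosedCurve hr
    · exact h.not_isClosedCurve hp hr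
    · exact h.not_isClosedCurve hp hr
    · exact h.not_isClosedCurve hr
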